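/- Let $\Sigma_2\subset\mathbb{R}^3$ be a compact connected smoothly embedded surface of genus $2$ which is symmetric with respect to the planes $\{x=0\}$, $\{y=0\}$ and $\{z=0\}$. Let $N$ be its outer unit normal field and let $\omega_{\Sigma_2}=\iota_N(dx\wedge dy\wedge dz)|_{\Sigma_2}$. The maps $\phi(x,y,z)=(-x,y,-z)$ and $\gamma(x,y,z)=(-x,-y,z)$ restrict to diffeomorphisms of $\Sigma_2$. Let $$M_\gamma(\Sigma_2)=(\Sigma_2\times[-1,1])/\big((p,1)\sim(\gamma(p),-1)\big)$$ be the mapping torus of $\gamma$, let $S^1=[-1,1]/(1\sim-1)$, and let $t$ and $s$ be the coordinates of the intervals $[-1,1]$ in $M_\gamma(\Sigma_2)$ and in $S^1$. The involutions $$\phi([p,t],s)=([\phi(p),t],s),\qquad \xi([p,t],s)=([p,-t],-s)$$ of $M_\gamma(\Sigma_2)\times S^1$ generate a group $\langle\phi,\xi\rangle\cong\mathbb{Z}_2\times\mathbb{Z}_2$; let $X$ be the $4$-dimensional orbifold $$X=\frac{M_\gamma(\Sigma_2)\times S^1}{\langle\phi,\xi\rangle}.$$ Let $H^2(X,\mathbb{R})$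 denote its second de Rham cohomology, i.e. the space of closed orbifold $2$-forms modulo the exterior derivatives of orbifold $1$-forms, where an orbifold form is a family of smooth forms on the domains of the orbifold charts, invariant under the chart groups and compatible with all changes of charts. Then the forms $\omega_{\Sigma_2}$ and $dt\wedge ds$ on $M_\gamma(\Sigma_2)\times S^1$ define closed orbifold $2$-forms on $X$, and their classes form a basis of $H^2(X,\mathbb{R})$. In particular $$H^2(X,\mathbb{R})=\langle \omega_{\Sigma_2},\, dt\wedge ds\rangle\quad\text{and}\quad \dim H^2(X,\mathbb{R})=2 .$$ -/

import Mathlib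

open Set Filter Topology Manifold
open scoped ContDiff

set_option maxSynthPendingDepth 3

/-! # Orbifold charts and orbifold differential forms -/

section OrbifoldForms

variable {E : Type*} [NormedAddCommGroup E] [NormedSpace ℝ E]

/-- An orbifold chart `(U, V, f, Γ)` on a topological space `X`, modelled on the vector space `E`:
an open set `U ⊆ E`, a finite group `Γ` of diffeomorphisms of `U`, and a `Γ`-invariant map
`f : U → X` which induces a homeomorphism of `U / Γ` onto the open set `V = f(U)`, that is, a
continuous open map whose fibres are exactly the `Γ`-orbits. -/
structure OrbifoldChart (E : Type*) [NormedAddCommGroup E] [NormedSpace ℝ E]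
    (X : Type*) [TopologicalSpace X] where
  /-- the open set `U` -/
  source : Set E
  isOpen_source : IsOpen source
  /-- the group `Γ` -/
  group : Subgroup (Equiv.Perm source)
  finite_group : Finite group
  smooth_group : ∀ g ∈ group, ∃ G : E → E,
    ContDiffOn ℝ ∞ G source ∧ ∀ u : source, G u = g u
  /-- the map `f : U → X` -/
  toFun : source → X
  continuous_toFun : Continuous toFun
  isOpenMap_toFun : IsOpenMap toFun
  toFun_eq_iff : ∀ u v : source, toFun u = toFun v ↔ ∃ g ∈ group, g u = v

/-- `lam` is (on the domain of `c`) an open differentiable embedding of the orbifold chart `c` into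
the orbifold chart `c'`, over the identity of `X`. -/
structure IsChartEmbedding {X : Type*} [TopologicalSpace X] (c c' : OrbifoldChart E X)
    (lam : E → E) : Prop where
  smooth : ContDiffOn ℝ ∞ lam c.source
  injOn : InjOn lam c.source
  bijective_fderiv : ∀ u ∈ c.source, Function.Bijective (fderiv ℝ lam u)
  mapsTo : MapsTo lam c.source c'.source
  over_base : ∀ u : c.source, c'.toFun ⟨lam u, mapsTo u.2⟩ = c.toFun u

variable {X : Type*} [TopologicalSpace X]

/-- The space `Ω^k_orb(X)` of orbifold differential `k`-forms of a space `X` with a set `A` of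
orbifold charts: families of smooth `k`-forms `α c` on the domains of the charts `c ∈ A` which agree
under all embeddings of charts (hence under all changes of charts). The elements of the group of a
chart `c` are embeddings of `c` into itself, so each `α c` is invariant under that group.
A form on an open set `U ⊆ E` is a function on `E` that is extended by zero outside `U`. -/
def orbifoldForms (A : Set (OrbifoldChart E X)) (k : ℕ) :
    Submodule ℝ (A → E → E [⋀^Fin k]→L[ℝ] ℝ) where
  carrier := {α |
    (∀ c : A, ContDiffOn ℝ ∞ (α c) c.1.source) ∧
    (∀ c : A, ∀ u ∉ c.1.source, α c u = 0) ∧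
    ∀ (c c' : A) (lam : E → E), IsChartEmbedding c.1 c'.1 lam → ∀ u ∈ c.1.source,
      α c u = (α c' (lam u)).compContinuousLinearMap (fderiv ℝ lam u)}
  add_mem' := by
    rintro α β ⟨h1, h2, h3⟩ ⟨k1, k2, k3⟩
    refine ⟨fun c => (h1 c).add (k1 c), fun c u hu => ?_, fun c c' l hl u hu => ?_⟩
    · simp [h2 c u hu, k2 c u hu]
    · ext v
      simp [h3 c c' l hl u hu, k3 c c' l hl u hu]
  zero_mem' := by
    refine ⟨fun c => contDiffOn_const, fun c u hu => rfl, fun c c' l hl u hu => ?_⟩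
    ext v
    simp
  smul_mem' := by
    rintro r α ⟨h1, h2, h3⟩
    refine ⟨fun c => (h1 c).const_smul r, fun c u hu => ?_, fun c c' l hl u hu => ?_⟩
    · simp [h2 c u hu]
    · ext v
      simp [h3 c c' l hl u hu]

open Classical in
/-- The exterior derivative `d : Ω^k_orb(X) → Ω^(k+1)_orb(X)`, computed in each chart. -/
noncomputable def orbifoldD (A : Set (OrbifoldChart E X)) (k : ℕ) :
    orbifoldForms A k →ₗ[ℝ] orbifoldForms A (k + 1) where
  toFun α := ⟨fun c u => if u ∈ c.1.source then extDeriv (α.1 c) u else 0, by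
    obtain ⟨α, h1, h2, h3⟩ := α
    refine ⟨fun c => ?_, fun c u hu => by simp [hu], fun c c' l hl u hu => ?_⟩
    · have h : ContDiffOn ℝ ∞ (extDeriv (α c)) c.1.source := by
        have h' : ContDiffOn ℝ ∞ (fderiv ℝ (α c)) c.1.source :=
          (h1 c).fderiv_of_isOpen c.1.isOpen_source (by simp)
        exact (ContinuousAlternatingMap.alternatizeUncurryFinCLM ℝ E ℝ).contDiff.comp_contDiffOn h'
      exact h.congr fun u hu => by simp [hu]
    · have hlu : l u ∈ c'.1.source := hl.mapsTo hu
      have hn : c.1.source ∈ 𝓝 u := c.1.isOpen_source.mem_nhds hu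
      have hn' : c'.1.source ∈ 𝓝 (l u) := c'.1.isOpen_source.mem_nhds hlu
      simp only [hu, hlu, if_true]
      have he : α c =ᶠ[𝓝 u]
          fun x => (α c' (l x)).compContinuousLinearMap (fderiv ℝ l x) := by
        filter_upwards [hn] with x hx using h3 c c' l hl x hx
      rw [he.extDeriv_eq]
      exact extDeriv_pullback (r := ∞)
        (((h1 c').contDiffAt hn').differentiableAt (by simp))
        (hl.smooth.contDiffAt hn) (by
          rw [minSmoothness_of_isRCLikeNormedField]
          exact WithTop.coe_le_coe.2 le_top)⟩
  map_add' := by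
    rintro ⟨α, h1, h2, h3⟩ ⟨β, k1, k2, k3⟩
    ext c u : 3
    by_cases hu : u ∈ c.1.source
    · have hn : c.1.source ∈ 𝓝 u := c.1.isOpen_source.mem_nhds hu
      have := extDeriv_add (((h1 c).contDiffAt hn).differentiableAt (by simp))
        (((k1 c).contDiffAt hn).differentiableAt (by simp))
      simpa [hu] using this
    · simp [hu]
  map_smul' := by
    rintro r ⟨α, h1, h2, h3⟩
    ext c u : 3
    by_cases hu : u ∈ c.1.source
    · simpa [hu] using extDeriv_smul r (α c) (x := u)
    · simp [hu]

/-- The closed orbifold `k`-forms. -/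
noncomputable abbrev closedForms (A : Set (OrbifoldChart E X)) (k : ℕ) :
    Submodule ℝ (orbifoldForms A k) :=
  LinearMap.ker (orbifoldD A k)

/-- The exact orbifold `k`-forms. -/
noncomputable def exactForms (A : Set (OrbifoldChart E X)) :
    (k : ℕ) → Submodule ℝ (orbifoldForms A k)
  | 0 => ⊥
  | k + 1 => LinearMap.range (orbifoldD A k)

/-- The `k`-th (de Rham) cohomology `H^k(X, ℝ)`: closed orbifold forms modulo exact ones. -/
abbrev orbifoldCohomology (A : Set (OrbifoldChart E X)) (k : ℕ) : Type _ :=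
  closedForms A k ⧸ (exactForms A k).submoduleOf (closedForms A k)

/-- The class in `H^k(X, ℝ)` of a closed orbifold form. -/
noncomputable abbrev cohomologyClass (A : Set (OrbifoldChart E X)) (k : ℕ)
    (α : closedForms A k) : orbifoldCohomology A k :=
  Submodule.Quotient.mk α

end OrbifoldForms

section QuotientOrbifold

variable {E : Type*} [NormedAddCommGroup E] [NormedSpace ℝ E]
  {H : Type*} [TopologicalSpace H] (I : ModelWithCorners ℝ E H)
  {Y : Type*} [TopologicalSpace Y] [ChartedSpace H Y]
  {X : Type*} [TopologicalSpace X]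

/-- `psi` is a lift of the orbifold chart `c` of `X` through `q : Y → X`, by a smooth
local diffeomorphism from the domain of `c` to the manifold `Y`. -/
structure IsChartLift (q : Y → X) (c : OrbifoldChart E X) (psi : E → Y) : Prop where
  smooth : ContMDiffOn 𝓘(ℝ, E) I ∞ psi c.source
  bijective_mfderiv : ∀ u ∈ c.source, Function.Bijective (mfderiv 𝓘(ℝ, E) I psi u)
  over_base : ∀ u : c.source, q (psi u) = c.toFun u

/-- The orbifold atlas on a quotient `q : Y → X` of a manifold `Y` by a properly discontinuous group
of diffeomorphisms: all orbifold charts of the space `X` that lift to local diffeomorphisms into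
`Y`. For `q = id` this is the smooth structure of the manifold `Y` itself. -/
def quotientAtlas (q : Y → X) : Set (OrbifoldChart E X) :=
  {c | ∃ psi : E → Y, IsChartLift I q c psi}

/-- The orbifold form `α` on the quotient `X` of `Y` is the one which is induced by the `k`-form `Ω`
on `Y`; in other words, the pullback of `α` by `q : Y → X` is `Ω`. -/
def IsInducedBy {k : ℕ} (q : Y → X) (α : orbifoldForms (quotientAtlas I q) k)
    (Ω : (y : Y) → (Fin k → TangentSpace I y) → ℝ) : Prop :=
  ∀ (c : quotientAtlas I q) (psi : E → Y), IsChartLift I q c.1 psi →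
    ∀ u ∈ c.1.source, ∀ v : Fin k → E,
      α.1 c u v = Ω (psi u) fun i => mfderiv 𝓘(ℝ, E) I psi u (v i)

end QuotientOrbifold

/-! # The surface -/

/-- The Euclidean space `ℝ³`. -/
abbrev E3 := EuclideanSpace ℝ (Fin 3)

/-- The Euclidean plane `ℝ²`, the model space of surfaces. -/
abbrev E2 := EuclideanSpace ℝ (Fin 2)

/-- The reflection of `ℝ³` in the plane on which the `i`-th coordinate vanishes. -/
noncomputable def planeReflection (i : Fin 3) (p : E3) : E3 :=
  WithLp.toLp 2 (Function.update p.ofLp i (-p i))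

/-- The map `φ(x, y, z) = (-x, y, -z)` of `ℝ³`. -/
noncomputable def phi3 (p : E3) : E3 := !₂[-p 0, p 1, -p 2]

/-- The map `γ(x, y, z) = (-x, -y, z)` of `ℝ³`. -/
noncomputable def gamma3 (p : E3) : E3 := !₂[-p 0, -p 1, p 2]

/-- The set `S` is symmetric with respect to the planes `x = 0`, `y = 0`, `z = 0`. -/
def IsPlaneSymmetric (S : Set E3) : Prop :=
  ∀ i : Fin 3, ∀ p ∈ S, planeReflection i p ∈ S

theorem IsPlaneSymmetric.mapsTo_phi3 {S : Set E3} (hS : IsPlaneSymmetric S) :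
    MapsTo phi3 S S := by
  intro p hp
  have h : phi3 p = planeReflection 0 (planeReflection 2 p) := by
    ext j
    fin_cases j <;> simp [phi3, planeReflection, Function.update]
  rw [h]
  exact hS _ _ (hS _ _ hp)

theorem IsPlaneSymmetric.mapsTo_gamma3 {S : Set E3} (hS : IsPlaneSymmetric S) :
    MapsTo gamma3 S S := by
  intro p hp
  have h : gamma3 p = planeReflection 0 (planeReflection 1 p) := by
    ext j
    fin_cases j <;> simp [gamma3, planeReflection, Function.update]
  rw [h]
  exact hS _ _ (hS _ _ hp)

/-- A genus `g` surface smoothly embedded in `ℝ³`: a compact connected embedded surface, with first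
Betti number `dim H¹(S, ℝ) = 2 g` (for the de Rham cohomology of the manifold `S`). -/
structure IsEmbeddedSurfaceOfGenus (S : Set E3) [ChartedSpace E2 S] (g : ℕ) : Prop where
  isCompact : IsCompact S
  isConnected : IsConnected S
  isSmoothEmbedding :
    IsSmoothEmbedding (𝓡 2) 𝓘(ℝ, E3) ∞ (Subtype.val : S → E3)
  genus : Module.finrank ℝ (orbifoldCohomology (quotientAtlas (𝓡 2) (id : S → S)) 1) = 2 * g

/-- `N` is the outer unit normal field of the closed surface `S ⊂ ℝ³`: it is smooth, of norm one,
orthogonal to the tangent planes, and points from the bounded side of `S` to the unbounded one. -/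
structure IsOuterUnitNormal (S : Set E3) [ChartedSpace E2 S] (N : S → E3) : Prop where
  smooth : ContMDiff (𝓡 2) 𝓘(ℝ, E3) ∞ N
  norm_eq_one : ∀ p, ‖N p‖ = 1
  orthogonal : ∀ (p : S) (v : TangentSpace (𝓡 2) p),
    inner ℝ (N p) (mfderiv (𝓡 2) 𝓘(ℝ, E3) (Subtype.val : S → E3) p v) = 0
  outside : ∀ p : S, ∀ᶠ r in 𝓝[>] (0 : ℝ),
    (p : E3) + r • N p ∉ S ∧
      ¬ Bornology.IsBounded (connectedComponentIn Sᶜ ((p : E3) + r • N p))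
  inside : ∀ p : S, ∀ᶠ r in 𝓝[>] (0 : ℝ),
    (p : E3) - r • N p ∉ S ∧
      Bornology.IsBounded (connectedComponentIn Sᶜ ((p : E3) - r • N p))

/-! # The orbifold -/

/-- The map `φ : S → S`. -/
noncomputable def surfacePhi {S : Set E3} (hS : IsPlaneSymmetric S) : S → S :=
  hS.mapsTo_phi3.restrict phi3 S S

/-- The map `γ : S → S`. -/
noncomputable def surfaceGamma {S : Set E3} (hS : IsPlaneSymmetric S) : S → S :=
  hS.mapsTo_gamma3.restrict gamma3 S S

theorem surfaceGamma_surfaceGamma {S : Set E3} (hS : IsPlaneSymmetric S) (p : S) :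
    surfaceGamma hS (surfaceGamma hS p) = p := by
  apply Subtype.ext
  ext j
  fin_cases j <;> simp [surfaceGamma, gamma3]

theorem surfacePhi_surfaceGamma {S : Set E3} (hS : IsPlaneSymmetric S) (p : S) :
    surfacePhi hS (surfaceGamma hS p) = surfaceGamma hS (surfacePhi hS p) := by
  apply Subtype.ext
  ext j
  fin_cases j <;> simp [surfacePhi, surfaceGamma, phi3, gamma3]

/-- The mapping torus `M_γ(S)`, as the quotient of `S × ℝ` by `(p, t) ∼ (γ(p), t - 2)`. The strip
`S × [-1, 1]` is a fundamental domain, with its ends identified by `(p, 1) ∼ (γ(p), -1)`. -/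
def MappingTorus {S : Set E3} (hS : IsPlaneSymmetric S) : Type :=
  Quot fun a b : S × ℝ => b = (surfaceGamma hS a.1, a.2 - 2)

instance {S : Set E3} (hS : IsPlaneSymmetric S) : TopologicalSpace (MappingTorus hS) :=
  inferInstanceAs (TopologicalSpace (Quot _))

/-- The point `[p, t]` of the mapping torus. -/
def MappingTorus.mk {S : Set E3} (hS : IsPlaneSymmetric S) (p : S) (t : ℝ) : MappingTorus hS :=
  Quot.mk _ (p, t)

/-- The product `M_γ(S) × S¹`, where `S¹ = ℝ / 2ℤ` is `[-1, 1]` with its end points identified. -/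
abbrev TorusProduct {S : Set E3} (hS : IsPlaneSymmetric S) : Type :=
  MappingTorus hS × AddCircle (2 : ℝ)

/-- The map `φ([p, t], s) = ([φ(p), t], s)`. -/
noncomputable def liftedPhi {S : Set E3} (hS : IsPlaneSymmetric S) (m : TorusProduct hS) :
    TorusProduct hS :=
  (Quot.lift (fun a : S × ℝ => MappingTorus.mk hS (surfacePhi hS a.1) a.2) (by
    rintro ⟨p, t⟩ b rfl
    apply Quot.sound
    simp [surfacePhi_surfaceGamma]) m.1, m.2)

/-- The map `ξ([p, t], s) = ([p, -t], -s)`. -/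
noncomputable def liftedXi {S : Set E3} (hS : IsPlaneSymmetric S) (m : TorusProduct hS) :
    TorusProduct hS :=
  (Quot.lift (fun a : S × ℝ => MappingTorus.mk hS a.1 (-a.2)) (by
    rintro ⟨p, t⟩ b rfl
    symm
    apply Quot.sound
    simp [surfaceGamma_surfaceGamma]) m.1, -m.2)

/-- The orbit space `X = (M_γ(S) × S¹) / ⟨φ, ξ⟩`, as a topological space: the quotient by the
equivalence relation generated by `m ∼ φ(m)` and `m ∼ ξ(m)`. -/
def OrbifoldX {S : Set E3} (hS : IsPlaneSymmetric S) : Type :=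
  Quot fun m n : TorusProduct hS => n = liftedPhi hS m ∨ n = liftedXi hS m

instance {S : Set E3} (hS : IsPlaneSymmetric S) : TopologicalSpace (OrbifoldX hS) :=
  inferInstanceAs (TopologicalSpace (Quot _))

/-- The projection `S × ℝ × ℝ → X`, `(p, t, s) ↦ [[p, t], s]`. -/
def projX {S : Set E3} (hS : IsPlaneSymmetric S) (y : S × ℝ × ℝ) : OrbifoldX hS :=
  Quot.mk _ (MappingTorus.mk hS y.1 y.2.1, (y.2.2 : AddCircle (2 : ℝ)))

/-- The model of the manifold `S × ℝ × ℝ`. -/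
noncomputable abbrev modelY :
    ModelWithCorners ℝ (E2 × ℝ × ℝ) (ModelProd E2 (ModelProd ℝ ℝ)) :=
  (𝓡 2).prod (𝓘(ℝ, ℝ).prod 𝓘(ℝ, ℝ))

/-- The `4`-dimensional orbifold structure of `X` (modelled on `ℝ² × ℝ × ℝ`): its charts are those which lift to `S × ℝ × ℝ`; equivalently, to
the manifold `M_γ(S) × S¹`, of which `S × ℝ × ℝ` is a covering by local diffeomorphisms. -/
def atlasX {S : Set E3} [ChartedSpace E2 S] (hS : IsPlaneSymmetric S) :
    Set (OrbifoldChart (E2 × ℝ × ℝ) (OrbifoldX hS)) :=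
  quotientAtlas modelY (projX hS)

/-- The volume form `dx ∧ dy ∧ dz` of `ℝ³`. -/
noncomputable def vol3 (a b c : E3) : ℝ :=
  Matrix.det !![a 0, b 0, c 0; a 1, b 1, c 1; a 2, b 2, c 2]

/-- The area form `ω_S = ι_N vol₃` of `S`, as a `2`-form on `S × ℝ × ℝ` (pulled back by the
projection to `S`). -/
noncomputable def areaForm {S : Set E3} [ChartedSpace E2 S] (N : S → E3)
    (y : S × ℝ × ℝ) (v : Fin 2 → TangentSpace modelY y) : ℝ :=
  vol3 (N y.1)
    (mfderiv modelY 𝓘(ℝ, E3) (fun z : S × ℝ × ℝ => (z.1 : E3)) y (v 0))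
    (mfderiv modelY 𝓘(ℝ, E3) (fun z : S × ℝ × ℝ => (z.1 : E3)) y (v 1))

/-- The differential `dt` of the coordinate `t` of `S × ℝ × ℝ`. -/
noncomputable def formDt {S : Set E3} [ChartedSpace E2 S] (y : S × ℝ × ℝ)
    (v : TangentSpace modelY y) : ℝ :=
  mfderiv modelY 𝓘(ℝ, ℝ) (fun z : S × ℝ × ℝ => z.2.1) y v

/-- The differential `ds` of the coordinate `s` of `S × ℝ × ℝ`. -/
noncomputable def formDs {S : Set E3} [ChartedSpace E2 S] (y : S × ℝ × ℝ)
    (v : TangentSpace modelY y) : ℝ :=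
  mfderiv modelY 𝓘(ℝ, ℝ) (fun z : S × ℝ × ℝ => z.2.2) y v

/-- The `2`-form `dt ∧ ds` on `S × ℝ × ℝ`. -/
noncomputable def formDtDs {S : Set E3} [ChartedSpace E2 S] (y : S × ℝ × ℝ)
    (v : Fin 2 → TangentSpace modelY y) : ℝ :=
  formDt y (v 0) * formDs y (v 1) - formDt y (v 1) * formDs y (v 0)

/-! The space X is the quotient of the covering S × ℝ × ℝ by the deck group generated by φ, ξ, (p,
t, s) ↦ (γ(p), t - 2, s) and s ↦ s + 2. Orbifold forms on X are therefore the forms on S × ℝ × ℝ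
that are invariant under this group, and H²(X) is the space of closed invariant 2-forms modulo
differentials of invariant 1-forms.

Spanning (`exists_eq_area_add_dtds_add_exact`). Since γ² = 1, an invariant form has period 4 in t
and period 2 in s. Averaging over these periods changes a closed invariant form only by the
differential of an invariant form. An averaged form has coefficients independent of t and s, so it
is a 2-form of S plus dt ∧ (1-form) plus ds ∧ (1-form) plus f dt ∧ ds. The involution ξ fixes S × 0
× 0 pointwise and reverses ∂/∂t and ∂/∂s, which kills the two mixed terms. Closedness and
connectedness of S make f constant. The 2-form of S is a multiple of the area form up to an exact
form, because H²(S) is one-dimensional (`IsNormalSurface.isMultipleModExact_area`), and averaging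
the primitive over the rotations generated by φ and γ makes it invariant. The area form itself is
invariant because these rotations preserve the orientation of ℝ³ and the outer normal.

Independence (`eq_zero_of_area_add_dtds_exact`). On a slice S × 0 × 0 only the area form survives,
and it is not exact by a form of Stokes' theorem (`IsNormalSurface.not_surfEq_extDeriv`). The
coefficient of dt ∧ ds is detected by integration over the torus {p} × [0, 4] × [0, 2].

All computations use smooth forms on the ambient spaces ℝ³ and ℝ³ × ℝ × ℝ, compared only on tangent
vectors of S (`SurfEq`, `AmbEq`). For this N is extended to a smooth field n on ℝ³, and S is
described by graph patches. The dictionary with orbifold forms is `Represents`: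
`exists_form_represents` goes from orbifold forms to ambient ones, `exists_represents` goes back. -/

/-- A graph patch of a surface `S ⊂ ℝ³` with normal field `n`: over the open set `O` of a plane,
`ψ` parametrizes `S ∩ V` and is inverse to the linear projection `P`, whose kernel is transverse
to `S`. -/
structure IsGraphPatch {F : Type*} [NormedAddCommGroup F] [NormedSpace ℝ F] (S : Set E3)
    (n : E3 → E3) (P : E3 →L[ℝ] F) (O : Set F) (V : Set E3) (ψ : F → E3) (m : E3) : Prop where
  isOpen_O : IsOpen O
  isOpen_V : IsOpen V
  smooth : ContDiffOn ℝ ∞ ψ O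
  proj : ∀ u ∈ O, P (ψ u) = u
  mem : ∀ u ∈ O, ψ u ∈ S ∩ V
  proj_mem : ∀ q ∈ V, P q ∈ O
  param_proj : ∀ q ∈ S ∩ V, ψ (P q) = q
  ker : ∀ v, P v = 0 → ∃ c : ℝ, v = c • m
  proj_dir : P m = 0
  inner_pos : ∀ q ∈ S ∩ V, 0 < inner ℝ (n q) m
  orthogonal : ∀ u ∈ O, ∀ v, inner ℝ (n (ψ u)) (fderiv ℝ ψ u v) = 0

/-- A compact connected surface in `ℝ³` with the smooth unit normal field `n|_S`. -/
structure IsNormalSurface (S : Set E3) (n : E3 → E3) : Prop where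
  isCompact : IsCompact S
  isConnected : IsConnected S
  smooth : ContDiff ℝ ∞ n
  norm_eq_one : ∀ q ∈ S, ‖n q‖ = 1
  exists_patch : ∀ p ∈ S, ∃ (P : E3 →L[ℝ] E2) (O : Set E2) (V : Set E3) (ψ : E2 → E3) (m : E3),
    p ∈ V ∧ IsGraphPatch S n P O V ψ m

/-! ### Graph patches and an ambient normal field for an embedded surface -/

section Extraction

variable {S : Set E3} [ChartedSpace E2 S]

/-- In the normal form of an immersion the inclusion reads u ↦ (u, 0). Hence the first component of
the ambient chart is a smooth left inverse of the parametrization, and the chain rule gives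
injectivity of the derivative. -/
theorem fderiv_comp_domChart_symm_injective {p : S}
    (h : IsImmersionAt (𝓡 2) 𝓘(ℝ, E3) ∞ (Subtype.val : S → E3) p) :
    ContDiffOn ℝ ∞ (fun u => (h.domChart.symm u : E3)) h.domChart.target ∧
    ∀ u ∈ h.domChart.target,
      Function.Injective (fderiv ℝ (fun u => (h.domChart.symm u : E3)) u) := by
  have hsm : ContDiffOn ℝ ∞ (fun u => (h.domChart.symm u : E3)) h.domChart.target := by
    rw [← contMDiffOn_iff_contDiffOn]
    have h1 := contMDiffOn_symm_of_mem_maximalAtlas h.domChart_mem_maximalAtlas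
    exact h.contMDiffOn.comp h1 (fun u hu => h.domChart.map_target hu)
  refine ⟨hsm, fun u hu => ?_⟩
  have hcod : ContDiffOn ℝ ∞ h.codChart h.codChart.source := by
    rw [← contMDiffOn_iff_contDiffOn]
    exact contMDiffOn_of_mem_maximalAtlas h.codChart_mem_maximalAtlas
  have hev : (fun x => (h.equiv.symm (h.codChart (h.domChart.symm x : E3))).1)
      =ᶠ[𝓝 u] id := by
    filter_upwards [h.domChart.open_target.mem_nhds hu] with x hx
    have hx' : x ∈ (h.domChart.extend (𝓡 2)).target := by simpa using hx
    have := h.writtenInCharts hx'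
    simp only [OpenPartialHomeomorph.extend, Function.comp_apply] at this
    simp only [mfld_simps] at this
    simp [this]
  have hd1 : DifferentiableAt ℝ (fun u => (h.domChart.symm u : E3)) u :=
    (hsm.contDiffAt (h.domChart.open_target.mem_nhds hu)).differentiableAt (by simp)
  have hmem : (h.domChart.symm u : E3) ∈ h.codChart.source :=
    h.source_subset_preimage_source (h.domChart.map_target hu)
  have hd2 : DifferentiableAt ℝ h.codChart (h.domChart.symm u : E3) :=
    (hcod.contDiffAt (h.codChart.open_source.mem_nhds hmem)).differentiableAt (by simp)
  have hd3 : DifferentiableAt ℝ (fun x : E3 => (h.equiv.symm (h.codChart x)).1)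
      (h.domChart.symm u : E3) :=
    (h.equiv.symm.differentiable.differentiableAt.comp _ hd2).fst
  have hc := (hd3.hasFDerivAt.comp u hd1.hasFDerivAt).congr_of_eventuallyEq hev.symm
  have hu' := hc.unique (hasFDerivAt_id u)
  intro v w hvw
  have e1 := congrArg (fun L => L v) hu'
  have e2 := congrArg (fun L => L w) hu'
  simp only [ContinuousLinearMap.comp_apply, ContinuousLinearMap.coe_id', id] at e1 e2
  rw [← e1, ← e2, hvw]

theorem inner_fderiv_domChart_symm_eq_zero [IsManifold (𝓡 2) ∞ S] {N : S → E3}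
    (hN : ∀ (p : S) (v : TangentSpace (𝓡 2) p),
      inner ℝ (N p) (mfderiv (𝓡 2) 𝓘(ℝ, E3) (Subtype.val : S → E3) p v) = 0)
    (hi : ContMDiff (𝓡 2) 𝓘(ℝ, E3) ∞ (Subtype.val : S → E3))
    {φ : OpenPartialHomeomorph S E2} (hφ : φ ∈ IsManifold.maximalAtlas (𝓡 2) ∞ S)
    {u : E2} (hu : u ∈ φ.target) (v : E2) :
    inner ℝ (N (φ.symm u)) (fderiv ℝ (fun u => (φ.symm u : E3)) u v) = 0 := by
  have h1 := (contMDiffOn_symm_of_mem_maximalAtlas hφ).contMDiffAt (φ.open_target.mem_nhds hu)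
  have h2 : MDifferentiableAt 𝓘(ℝ, E2) (𝓡 2) φ.symm u := h1.mdifferentiableAt (by simp)
  have h3 : MDifferentiableAt (𝓡 2) 𝓘(ℝ, E3) (Subtype.val : S → E3) (φ.symm u) :=
    (hi _).mdifferentiableAt (by simp)
  have h4 := mfderiv_comp u h3 h2
  rw [mfderiv_eq_fderiv] at h4
  have h5 : fderiv ℝ (fun u => (φ.symm u : E3)) u v = _ := congrArg (fun L => L v) h4
  rw [h5]
  exact hN (φ.symm u) (mfderiv 𝓘(ℝ, E2) (𝓡 2) φ.symm u v)

/-- The kernel of the adjoint of an injective linear map from the plane to `ℝ³` is spanned by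
any nonzero vector orthogonal to the range. -/
theorem exists_smul_of_adjoint_eq_zero (D : E2 →L[ℝ] E3) (hD : Function.Injective D) {m : E3}
    (hm : m ≠ 0) (hmD : ∀ v, inner ℝ m (D v) = 0) (w : E3)
    (hw : ContinuousLinearMap.adjoint D w = 0) : ∃ c : ℝ, w = c • m := by
  have hr : Module.finrank ℝ (LinearMap.range D.toLinearMap) = 2 := by
    rw [LinearMap.finrank_range_of_inj hD]; simp
  have hsum := Submodule.finrank_add_finrank_orthogonal (LinearMap.range D.toLinearMap)
  rw [hr, finrank_euclideanSpace_fin] at hsum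
  have h1 : Module.finrank ℝ (LinearMap.range D.toLinearMap)ᗮ = 1 := by omega
  have hmem : ∀ x : E3, (∀ v, inner ℝ x (D v) = 0) → x ∈ (LinearMap.range D.toLinearMap)ᗮ := by
    intro x hx
    rw [Submodule.mem_orthogonal']
    rintro _ ⟨v, rfl⟩
    exact hx v
  have hw' : w ∈ (LinearMap.range D.toLinearMap)ᗮ := hmem w fun v => by
    rw [← ContinuousLinearMap.adjoint_inner_left, hw, inner_zero_left]
  obtain ⟨c, hc⟩ := (finrank_eq_one_iff_of_nonzero' (⟨m, hmem m hmD⟩ :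
    (LinearMap.range D.toLinearMap)ᗮ) (by simpa [Subtype.ext_iff] using hm)).1 h1 ⟨w, hw'⟩
  exact ⟨c, by simpa [Subtype.ext_iff] using hc.symm⟩

/-- The projection P is the adjoint of the differential D of a parametrization j at p. Its kernel is
the normal line at p, and P ∘ D is injective, so P ∘ j is inverted by the inverse function theorem
and ψ = j ∘ (P ∘ j)⁻¹. The patch property is stated for every n extending N, and ν expresses N in
the patch, because such an n is only constructed later, out of these ν. -/
theorem exists_graphPatch_aux [IsManifold (𝓡 2) ∞ S] {N : S → E3}
    (hsm : ContMDiff (𝓡 2) 𝓘(ℝ, E3) ∞ N)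
    (hN : ∀ (p : S) (v : TangentSpace (𝓡 2) p),
      inner ℝ (N p) (mfderiv (𝓡 2) 𝓘(ℝ, E3) (Subtype.val : S → E3) p v) = 0)
    (hN1 : ∀ p, ‖N p‖ = 1)
    (hi : IsImmersion (𝓡 2) 𝓘(ℝ, E3) ∞ (Subtype.val : S → E3)) (p : S) :
    ∃ (P : E3 →L[ℝ] E2) (O : Set E2) (V : Set E3) (ψ : E2 → E3) (m : E3) (ν : E2 → E3),
      (p : E3) ∈ V ∧ ContDiffOn ℝ ∞ ν O ∧ (∀ q (hq : q ∈ S), q ∈ V → N ⟨q, hq⟩ = ν (P q)) ∧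
      ∀ n : E3 → E3, (∀ q : S, n q = N q) → IsGraphPatch S n P O V ψ m := by
  have h := hi.isImmersionAt p
  obtain ⟨hj, hjinj⟩ := fderiv_comp_domChart_symm_injective h
  set φ := h.domChart with hφ
  have hφm : φ ∈ IsManifold.maximalAtlas (𝓡 2) ∞ S := h.domChart_mem_maximalAtlas
  set j : E2 → E3 := fun u => (φ.symm u : E3) with hjdef
  have horth : ∀ u ∈ φ.target, ∀ v, inner ℝ (N (φ.symm u)) (fderiv ℝ j u v) = 0 :=
    fun u hu v => inner_fderiv_domChart_symm_eq_zero hN hi.contMDiff hφm hu v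
  have hps : p ∈ φ.source := h.mem_domChart_source
  set u0 := φ p with hu0
  have hu0t : u0 ∈ φ.target := φ.map_source hps
  have hφu0 : φ.symm u0 = p := φ.left_inv hps
  set m := N p with hm
  have hm0 : m ≠ 0 := by
    intro h0
    have := hN1 p
    rw [← hm, h0] at this
    simp at this
  set P : E3 →L[ℝ] E2 := ContinuousLinearMap.adjoint (fderiv ℝ j u0) with hP
  have hortho0 : ∀ v, inner ℝ m (fderiv ℝ j u0 v) = 0 := fun v => by
    have := horth u0 hu0t v
    rwa [hφu0] at this
  have hker : ∀ v, P v = 0 → ∃ c : ℝ, v = c • m :=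
    exists_smul_of_adjoint_eq_zero _ (hjinj u0 hu0t) hm0 hortho0
  have hPm : P m = 0 := by
    refine ext_inner_right ℝ fun v => ?_
    rw [hP, ContinuousLinearMap.adjoint_inner_left, hortho0, inner_zero_left]
  have hjat : ∀ u ∈ φ.target, ContDiffAt ℝ ∞ j u := fun u hu =>
    hj.contDiffAt (φ.open_target.mem_nhds hu)
  have hjd : ∀ u ∈ φ.target, HasFDerivAt j (fderiv ℝ j u) u := fun u hu =>
    ((hjat u hu).differentiableAt (by simp)).hasFDerivAt
  have hinjP : ∀ u ∈ φ.target, 0 < inner ℝ (N (φ.symm u)) m →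
      Function.Injective (P ∘L fderiv ℝ j u) := by
    intro u hu hpos
    refine (injective_iff_map_eq_zero _).2 fun v hv => ?_
    obtain ⟨c, hc⟩ := hker _ hv
    have h1 : inner ℝ (N (φ.symm u)) (c • m) = 0 :=
      (congrArg (inner ℝ (N (φ.symm u))) hc).symm.trans (horth u hu v)
    rw [inner_smul_right] at h1
    have hc0 : c = 0 := by
      rcases mul_eq_zero.1 h1 with h1 | h1
      · exact h1
      · exact absurd h1 hpos.ne'
    rw [hc0, zero_smul] at hc
    exact hjinj u hu (hc.trans (map_zero _).symm)
  have hequiv : ∀ u ∈ φ.target, 0 < inner ℝ (N (φ.symm u)) m →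
      ∃ e : E2 ≃L[ℝ] E2, HasFDerivAt (fun x => P (j x)) (e : E2 →L[ℝ] E2) u := by
    intro u hu hpos
    refine ⟨(LinearEquiv.ofInjectiveEndo (P ∘L fderiv ℝ j u).toLinearMap
      (hinjP u hu hpos)).toContinuousLinearEquiv, ?_⟩
    have : ((LinearEquiv.ofInjectiveEndo (P ∘L fderiv ℝ j u).toLinearMap
      (hinjP u hu hpos)).toContinuousLinearEquiv : E2 →L[ℝ] E2) = P ∘L fderiv ℝ j u := by
      ext v; rfl
    rw [this]
    exact P.hasFDerivAt.comp u (hjd u hu)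
  have hPj : ∀ u ∈ φ.target, ContDiffAt ℝ ∞ (fun x => P (j x)) u := fun u hu =>
    P.contDiff.contDiffAt.comp u (hjat u hu)
  have hpos0 : 0 < inner ℝ (N (φ.symm u0)) m := by
    rw [hφu0, ← hm, real_inner_self_eq_norm_sq, hm, hN1]; norm_num
  obtain ⟨e0, he0⟩ := hequiv u0 hu0t hpos0
  set lam := (hPj u0 hu0t).toOpenPartialHomeomorph _ he0 (by simp) with hlam
  have hlamc : ∀ x, lam x = P (j x) := fun x => rfl
  have hu0l : u0 ∈ lam.source := (hPj u0 hu0t).mem_toOpenPartialHomeomorph_source he0 (by simp)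
  have hcontN : ContinuousOn (fun u => inner ℝ (N (φ.symm u)) m) φ.target :=
    ((hsm.continuous.comp_continuousOn φ.continuousOn_symm).inner continuousOn_const)
  -- Where the inner product of N with m is positive the kernel of P stays transverse to S. This
  -- makes P ∘ j invertible to first order on all of A, so the local inverse is smooth on all of O
  -- and not only at the centre.
  set A : Set E2 := (φ.target ∩ (fun u => inner ℝ (N (φ.symm u)) m) ⁻¹' Ioi 0) ∩ lam.source with hA
  have hAo : IsOpen A := (hcontN.isOpen_inter_preimage φ.open_target isOpen_Ioi).inter
    lam.open_source
  set O : Set E2 := lam.target ∩ lam.symm ⁻¹' A with hO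
  have hOo : IsOpen O := lam.symm.isOpen_inter_preimage hAo
  have hlsymm : ContDiffOn ℝ ∞ lam.symm O := by
    intro x hx
    obtain ⟨e, he⟩ := hequiv (lam.symm x) hx.2.1.1 hx.2.1.2
    exact (lam.contDiffAt_symm hx.1 he (hPj _ hx.2.1.1)).contDiffWithinAt
  have hS0 : IsOpen (φ.source ∩ φ ⁻¹' A) := φ.isOpen_inter_preimage hAo
  -- S carries the induced topology, so the chart domain is cut out by an open set of ℝ³.
  obtain ⟨V0, hV0, hV0S⟩ := isOpen_induced_iff.1 hS0
  have hV0mem : ∀ q : S, (q : E3) ∈ V0 ↔ q ∈ φ.source ∧ φ q ∈ A := fun q => by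
    have := Set.ext_iff.1 hV0S q
    exact this
  have hPq : ∀ q : S, (q : E3) ∈ V0 → P q ∈ O ∧ φ.symm (lam.symm (P q)) = q := by
    intro q hq
    obtain ⟨h1, h2⟩ := (hV0mem q).1 hq
    have h3 : P q = lam (φ q) := by
      rw [hlamc, hjdef]; simp only; rw [φ.left_inv h1]
    rw [h3, hO]
    refine ⟨⟨lam.map_source h2.2, ?_⟩, ?_⟩
    · change lam.symm (lam (φ q)) ∈ A
      rw [lam.left_inv h2.2]; exact h2
    · rw [lam.left_inv h2.2, φ.left_inv h1]
  have hpV0 : (p : E3) ∈ V0 := (hV0mem p).2 ⟨hps, ⟨hu0t, hpos0⟩, hu0l⟩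
  refine ⟨P, O, V0 ∩ P ⁻¹' O, fun u => j (lam.symm u), m, fun u => N (φ.symm (lam.symm u)),
    ⟨hpV0, (hPq p hpV0).1⟩, ?_, ?_, ?_⟩
  · have h1 : ContDiffOn ℝ ∞ (fun u => N (φ.symm u)) φ.target := by
      rw [← contMDiffOn_iff_contDiffOn]
      exact hsm.comp_contMDiffOn (contMDiffOn_symm_of_mem_maximalAtlas hφm)
    exact h1.comp hlsymm fun u hu => hu.2.1.1
  · intro q hq hqV
    simp only
    rw [(hPq ⟨q, hq⟩ hqV.1).2]
  · intro n hn
    have hproj : ∀ u ∈ O, P (j (lam.symm u)) = u := fun u hu => by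
      rw [← hlamc, lam.right_inv hu.1]
    refine ⟨hOo, hV0.inter (hOo.preimage P.continuous), ?_, hproj, ?_, fun q hq => hq.2, ?_, hker,
      hPm, ?_, ?_⟩
    · exact hj.comp hlsymm fun u hu => hu.2.1.1
    · intro u hu
      refine ⟨(φ.symm (lam.symm u)).2, (hV0mem _).2 ⟨φ.map_target hu.2.1.1, ?_⟩, ?_⟩
      · rw [φ.right_inv hu.2.1.1]; exact hu.2
      · change P (j (lam.symm u)) ∈ O
        rw [hproj u hu]; exact hu
    · rintro q ⟨hqS, hqV⟩
      exact congrArg Subtype.val (hPq ⟨q, hqS⟩ hqV.1).2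
    · rintro q ⟨hqS, hqV⟩
      have h1 := (hPq ⟨q, hqS⟩ hqV.1)
      have h2 := h1.1.2.1.2
      simp only [mem_preimage, h1.2, mem_Ioi] at h2
      rw [hn ⟨q, hqS⟩]
      exact h2
    · intro u hu v
      have hlt := hu.2.1.1
      have h1 : HasFDerivAt lam.symm (fderiv ℝ lam.symm u) u :=
        ((hlsymm.contDiffAt (hOo.mem_nhds hu)).differentiableAt (by simp)).hasFDerivAt
      have h2 : fderiv ℝ (fun u => j (lam.symm u)) u
          = fderiv ℝ j (lam.symm u) ∘L fderiv ℝ lam.symm u :=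
        ((hjd _ hlt).comp u h1).fderiv
      rw [h2, hn (φ.symm (lam.symm u))]
      exact horth _ hlt (fderiv ℝ lam.symm u v)

/-- The admissible values of n at x form a convex set: the single vector N(x) on S, everything
elsewhere. Local solutions are ν ∘ P near S and 0 off S, and a smooth partition of unity glues them.
-/
theorem exists_isNormalSurface [IsManifold (𝓡 2) ∞ S] {N : S → E3}
    (hsm : ContMDiff (𝓡 2) 𝓘(ℝ, E3) ∞ N)
    (hN : ∀ (p : S) (v : TangentSpace (𝓡 2) p),
      inner ℝ (N p) (mfderiv (𝓡 2) 𝓘(ℝ, E3) (Subtype.val : S → E3) p v) = 0)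
    (hN1 : ∀ p, ‖N p‖ = 1)
    (hi : IsImmersion (𝓡 2) 𝓘(ℝ, E3) ∞ (Subtype.val : S → E3))
    (hc : IsCompact S) (hconn : IsConnected S) :
    ∃ n : E3 → E3, IsNormalSurface S n ∧ ∀ q : S, n q = N q := by
  have key : ∃ g : C^∞⟮𝓘(ℝ, E3), E3; 𝓘(ℝ, E3), E3⟯,
      ∀ x, g x ∈ {y : E3 | ∀ h : x ∈ S, y = N ⟨x, h⟩} := by
    refine exists_contMDiffMap_forall_mem_convex_of_local 𝓘(ℝ, E3) (fun x => ?_) (fun x => ?_)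
    · intro y hy z hz a b _ _ hab h
      rw [hy h, hz h, ← add_smul, hab, one_smul]
    · by_cases hx : x ∈ S
      · obtain ⟨P, O, V, ψ, m, ν, hpV, hν, hNν, hpatch⟩ :=
          exists_graphPatch_aux hsm hN hN1 hi ⟨x, hx⟩
        classical
        -- Any extension of N, even a discontinuous one, gives access to the geometry of the patch.
        have hgp := hpatch (fun q => if h : q ∈ S then N ⟨q, h⟩ else 0) (by simp)
        refine ⟨V, hgp.isOpen_V.mem_nhds hpV, fun y => ν (P y), ?_, fun y hy h => ?_⟩
        · rw [contMDiffOn_iff_contDiffOn]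
          exact hν.comp P.contDiff.contDiffOn fun y hy => hgp.proj_mem y hy
        · exact (hNν y h hy).symm
      · exact ⟨Sᶜ, hc.isClosed.isOpen_compl.mem_nhds hx, fun _ => 0, contMDiffOn_const,
          fun y hy h => absurd h hy⟩
  obtain ⟨g, hg⟩ := key
  have hgN : ∀ q : S, g q = N q := fun q => hg q q.2
  refine ⟨g, ⟨hc, hconn, g.contMDiff.contDiff, fun q hq => ?_, fun p hp => ?_⟩, hgN⟩
  · rw [hgN ⟨q, hq⟩, hN1]
  · obtain ⟨P, O, V, ψ, m, ν, hpV, -, -, hpatch⟩ := exists_graphPatch_aux hsm hN hN1 hi ⟨p, hp⟩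
    exact ⟨P, O, V, ψ, m, hpV, hpatch g hgN⟩

end Extraction

namespace IsGraphPatch

variable {F : Type*} [NormedAddCommGroup F] [NormedSpace ℝ F] {S : Set E3} {n : E3 → E3}
  {P : E3 →L[ℝ] F} {O : Set F} {V : Set E3} {ψ : F → E3}
  {m : E3}

theorem hasFDerivAt (h : IsGraphPatch S n P O V ψ m) {u : F} (hu : u ∈ O) : HasFDerivAt ψ (fderiv ℝ ψ u) u :=
  ((h.smooth.contDiffAt (h.isOpen_O.mem_nhds hu)).differentiableAt (by simp)).hasFDerivAt

theorem proj_fderiv (h : IsGraphPatch S n P O V ψ m) {u : F} (hu : u ∈ O) (v : F) : P (fderiv ℝ ψ u v) = v := by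
  have h1 : HasFDerivAt (fun x => P (ψ x)) (P ∘L fderiv ℝ ψ u) u :=
    P.hasFDerivAt.comp u (h.hasFDerivAt hu)
  have h2 : (fun x => P (ψ x)) =ᶠ[𝓝 u] id := by
    filter_upwards [h.isOpen_O.mem_nhds hu] with x hx using h.proj x hx
  have h3 := (h1.congr_of_eventuallyEq h2.symm).unique (hasFDerivAt_id u)
  exact congrArg (fun L => L v) h3

theorem eq_zero_of_proj_eq_zero (h : IsGraphPatch S n P O V ψ m) {q : E3} (hq : q ∈ S ∩ V) {v : E3} (hv : inner ℝ (n q) v = 0)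
    (hPv : P v = 0) : v = 0 := by
  obtain ⟨c, rfl⟩ := h.ker v hPv
  rw [inner_smul_right] at hv
  rcases mul_eq_zero.1 hv with hc | hc
  · rw [hc, zero_smul]
  · exact absurd hc (h.inner_pos q hq).ne'

/-- On the tangent plane P and the differential of ψ are mutually inverse: the difference of the two
sides is tangent and is killed by P. -/
theorem fderiv_proj (h : IsGraphPatch S n P O V ψ m) {q : E3} (hq : q ∈ S ∩ V) {v : E3} (hv : inner ℝ (n q) v = 0) :
    fderiv ℝ ψ (P q) (P v) = v := by
  have hO := h.proj_mem q hq.2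
  refine (sub_eq_zero.1 (h.eq_zero_of_proj_eq_zero hq (v := fderiv ℝ ψ (P q) (P v) - v) ?_ ?_))
  · have := h.orthogonal (P q) hO (P v)
    rw [h.param_proj q hq] at this
    rw [inner_sub_right, this, hv, sub_zero]
  · rw [map_sub, h.proj_fderiv hO, sub_self]

/-- Used to replace the Euclidean plane by `ℝ × ℝ`, where iterated interval integrals are at hand.
-/
theorem transport {F' : Type*} [NormedAddCommGroup F'] [NormedSpace ℝ F']
    (h : IsGraphPatch S n P O V ψ m) (e : F ≃L[ℝ] F') :
    IsGraphPatch S n ((e : F →L[ℝ] F') ∘L P) (e.symm ⁻¹' O) V (fun u => ψ (e.symm u)) m where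
  isOpen_O := h.isOpen_O.preimage e.symm.continuous
  isOpen_V := h.isOpen_V
  smooth := h.smooth.comp e.symm.contDiff.contDiffOn fun _ hu => hu
  proj u hu := by simp [h.proj _ hu]
  mem u hu := h.mem _ hu
  proj_mem q hq := by simpa using h.proj_mem q hq
  param_proj q hq := by simpa using h.param_proj q hq
  ker v hv := h.ker v (by simpa using hv)
  proj_dir := by simp [h.proj_dir]
  inner_pos := h.inner_pos
  orthogonal u hu v := by
    have h1 := ((h.hasFDerivAt hu).comp u e.symm.hasFDerivAt).fderiv
    simp only [Function.comp_def] at h1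
    rw [h1]
    exact h.orthogonal _ hu _

end IsGraphPatch

/-- A map with values in S equals ψ ∘ P ∘ f near x, so its derivative has values in the range of the
differential of ψ. -/
theorem IsNormalSurface.inner_hasFDerivAt_eq_zero {S : Set E3} {n : E3 → E3}
    (hS : IsNormalSurface S n) {X : Type*} [NormedAddCommGroup X] [NormedSpace ℝ X] {f : X → E3}
    {f' : X →L[ℝ] E3} {x : X} (hf : HasFDerivAt f f' x) (hfS : ∀ᶠ y in 𝓝 x, f y ∈ S) (v : X) :
    inner ℝ (n (f x)) (f' v) = 0 := by
  have hx : f x ∈ S := hfS.self_of_nhds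
  obtain ⟨P, O, V, ψ, m, hV, h⟩ := hS.exists_patch _ hx
  have hO := h.proj_mem _ hV
  have hp := h.param_proj _ ⟨hx, hV⟩
  have h1 : HasFDerivAt (fun y => ψ (P (f y))) (fderiv ℝ ψ (P (f x)) ∘L (P ∘L f')) x :=
    (h.hasFDerivAt hO).comp x (P.hasFDerivAt.comp x hf)
  have h2 : (fun y => ψ (P (f y))) =ᶠ[𝓝 x] f := by
    filter_upwards [hfS, hf.continuousAt.eventually (h.isOpen_V.mem_nhds hV)] with y hy hyV
    exact h.param_proj _ ⟨hy, hyV⟩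
  rw [← (h1.congr_of_eventuallyEq h2.symm).unique hf]
  have := h.orthogonal _ hO (P (f' v))
  rwa [hp] at this

/-! ### Smoothness of form-valued maps -/

section SmoothForms

variable {E F : Type*} [NormedAddCommGroup E] [NormedSpace ℝ E] [NormedAddCommGroup F]
  [NormedSpace ℝ F] {k : ℕ}

theorem contDiff_alternating_uncurry :
    ContDiff ℝ ∞ (fun p : (F [⋀^Fin k]→L[ℝ] ℝ) × (Fin k → F) => p.1 p.2) := by
  have h : AnalyticOnNhd ℝ (fun p : (F [⋀^Fin k]→L[ℝ] ℝ) × (Fin k → F) => p.1 p.2) univ :=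
    ContinuousLinearMap.analyticOnNhd_uncurry_of_multilinear
      (ContinuousAlternatingMap.toContinuousMultilinearMapCLM ℝ :
        (F [⋀^Fin k]→L[ℝ] ℝ) →L[ℝ] ContinuousMultilinearMap ℝ (fun _ : Fin k => F) ℝ)
  exact contDiffOn_univ.1 h.contDiffOn_of_completeSpace

theorem ContDiffOn.alternating_apply {B : E → F [⋀^Fin k]→L[ℝ] ℝ} {w : E → Fin k → F} {s : Set E}
    (hB : ContDiffOn ℝ ∞ B s) (hw : ContDiffOn ℝ ∞ w s) :
    ContDiffOn ℝ ∞ (fun x => B x (w x)) s :=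
  contDiff_alternating_uncurry.comp_contDiffOn (hB.prodMk hw)

theorem ContDiff.alternating_apply {B : E → F [⋀^Fin k]→L[ℝ] ℝ} {w : E → Fin k → F}
    (hB : ContDiff ℝ ∞ B) (hw : ContDiff ℝ ∞ w) :
    ContDiff ℝ ∞ (fun x => B x (w x)) :=
  contDiff_alternating_uncurry.comp (hB.prodMk hw)

/-- Evaluation of an alternating map on all tuples of vectors of a finite basis. -/
noncomputable def alternatingEval (F : Type*) [NormedAddCommGroup F] [NormedSpace ℝ F]
    [FiniteDimensional ℝ F] (k : ℕ) :
    (F [⋀^Fin k]→L[ℝ] ℝ) →ₗ[ℝ] ((Fin k → Fin (Module.finrank ℝ F)) → ℝ) where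
  toFun B σ := B fun i => Module.finBasis ℝ F (σ i)
  map_add' _ _ := rfl
  map_smul' _ _ := rfl

theorem alternatingEval_injective (F : Type*) [NormedAddCommGroup F] [NormedSpace ℝ F]
    [FiniteDimensional ℝ F] (k : ℕ) : Function.Injective (alternatingEval F k) := by
  intro B B' h
  apply ContinuousAlternatingMap.toAlternatingMap_injective
  refine Module.Basis.ext_alternating (Module.finBasis ℝ F) fun σ _ => ?_
  exact congrFun h σ

/-- A form with values in a finite dimensional space is smooth if all its evaluations on constant
vectors are. -/
theorem contDiffOn_form [FiniteDimensional ℝ F] {B : E → F [⋀^Fin k]→L[ℝ] ℝ} {s : Set E}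
    (h : ∀ v : Fin k → F, ContDiffOn ℝ ∞ (fun x => B x v) s) : ContDiffOn ℝ ∞ B s := by
  -- A linear left inverse of the evaluation on basis vectors recovers the form smoothly from
  -- finitely many scalar functions.
  obtain ⟨Ψ, hΨ⟩ := LinearMap.exists_leftInverse_of_injective (alternatingEval F k)
    (LinearMap.ker_eq_bot.2 (alternatingEval_injective F k))
  have h1 : ContDiffOn ℝ ∞ (fun x => alternatingEval F k (B x)) s :=
    contDiffOn_pi.2 fun σ => h _
  have h2 := (LinearMap.toContinuousLinearMap Ψ).contDiff.comp_contDiffOn h1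
  refine h2.congr fun x _ => ?_
  exact (congrArg (fun L => L (B x)) hΨ).symm

theorem contDiff_form [FiniteDimensional ℝ F] {B : E → F [⋀^Fin k]→L[ℝ] ℝ}
    (h : ∀ v : Fin k → F, ContDiff ℝ ∞ (fun x => B x v)) : ContDiff ℝ ∞ B :=
  contDiffOn_univ.1 (contDiffOn_form fun v => (h v).contDiffOn)

end SmoothForms

/-! ### Pullback and exterior derivative in low degrees -/

section Pullback

variable {E F G : Type*} [NormedAddCommGroup E] [NormedSpace ℝ E] [NormedAddCommGroup F]
  [NormedSpace ℝ F] [NormedAddCommGroup G] [NormedSpace ℝ G] {k : ℕ}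

/-- The pullback of a differential form by a map. -/
noncomputable def formPullback (f : E → F) (B : F → F [⋀^Fin k]→L[ℝ] ℝ) : E → E [⋀^Fin k]→L[ℝ] ℝ :=
  fun u => (B (f u)).compContinuousLinearMap (fderiv ℝ f u)

theorem formPullback_apply (f : E → F) (B : F → F [⋀^Fin k]→L[ℝ] ℝ) (u : E) (v : Fin k → E) :
    formPullback f B u v = B (f u) fun i => fderiv ℝ f u (v i) := rfl

theorem ContDiffOn.formPullback [FiniteDimensional ℝ E] {f : E → F} {B : F → F [⋀^Fin k]→L[ℝ] ℝ} {s : Set E} {t : Set F}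
    (hs : IsOpen s) (hf : ContDiffOn ℝ ∞ f s) (hB : ContDiffOn ℝ ∞ B t) (hst : MapsTo f s t) :
    ContDiffOn ℝ ∞ (formPullback f B) s := by
  have h1 : ContDiffOn ℝ ∞ (fun u => B (f u)) s := hB.comp hf hst
  have h2 : ContDiffOn ℝ ∞ (fderiv ℝ f) s := hf.fderiv_of_isOpen hs (by simp)
  refine contDiffOn_form fun v => h1.alternating_apply ?_
  exact contDiffOn_pi.2 fun i => h2.clm_apply contDiffOn_const

theorem ContDiff.formPullback [FiniteDimensional ℝ E] {f : E → F} {B : F → F [⋀^Fin k]→L[ℝ] ℝ}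
    (hf : ContDiff ℝ ∞ f) (hB : ContDiff ℝ ∞ B) : ContDiff ℝ ∞ (formPullback f B) := by
  rw [← contDiffOn_univ] at *
  exact ContDiffOn.formPullback isOpen_univ hf hB (mapsTo_univ _ _)

theorem ContDiff.extDeriv {B : F → F [⋀^Fin k]→L[ℝ] ℝ} (hB : ContDiff ℝ ∞ B) :
    ContDiff ℝ ∞ (extDeriv B) :=
  (ContinuousAlternatingMap.alternatizeUncurryFinCLM ℝ F ℝ).contDiff.comp
    (hB.fderiv_right (by simp))

theorem extDeriv_formPullback {f : E → F} {B : F → F [⋀^Fin k]→L[ℝ] ℝ} {u : E}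
    (hB : ContDiff ℝ ∞ B) (hf : ContDiffAt ℝ ∞ f u) :
    extDeriv (formPullback f B) u = formPullback f (extDeriv B) u :=
  extDeriv_pullback (r := ∞) (hB.differentiable (by simp) _) hf (by
    rw [minSmoothness_of_isRCLikeNormedField]
    exact WithTop.coe_le_coe.2 le_top)

theorem extDeriv_one_apply {η : F → F [⋀^Fin 1]→L[ℝ] ℝ} {x : F} (h : DifferentiableAt ℝ η x)
    (v w : F) :
    extDeriv η x ![v, w] = fderiv ℝ η x v ![w] - fderiv ℝ η x w ![v] := by
  rw [extDeriv_apply h]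
  have e1 : (0 : Fin 2).removeNth ![v, w] = ![w] := by ext i; fin_cases i; rfl
  have e2 : (1 : Fin 2).removeNth ![v, w] = ![v] := by ext i; fin_cases i; rfl
  rw [Fin.sum_univ_two, e1, e2, fderiv_continuousAlternatingMap_apply_const_apply h,
    fderiv_continuousAlternatingMap_apply_const_apply h]
  simp [sub_eq_add_neg]

theorem extDeriv_two_apply {B : F → F [⋀^Fin 2]→L[ℝ] ℝ} {x : F} (h : DifferentiableAt ℝ B x)
    (u v w : F) :
    extDeriv B x ![u, v, w] = fderiv ℝ B x u ![v, w] - fderiv ℝ B x v ![u, w]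
      + fderiv ℝ B x w ![u, v] := by
  rw [extDeriv_apply h]
  have e1 : (0 : Fin 3).removeNth ![u, v, w] = ![v, w] := by ext i; fin_cases i <;> rfl
  have e2 : (1 : Fin 3).removeNth ![u, v, w] = ![u, w] := by ext i; fin_cases i <;> rfl
  have e3 : (2 : Fin 3).removeNth ![u, v, w] = ![u, v] := by ext i; fin_cases i <;> rfl
  rw [Fin.sum_univ_three, e1, e2, e3, fderiv_continuousAlternatingMap_apply_const_apply h,
    fderiv_continuousAlternatingMap_apply_const_apply h,
    fderiv_continuousAlternatingMap_apply_const_apply h]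
  simp [sub_eq_add_neg]

end Pullback

/-! ### Ambient forms and their restrictions -/

/-- The ambient space `ℝ³ × ℝ × ℝ` of `S × ℝ × ℝ`. -/
abbrev Amb := E3 × ℝ × ℝ

/-- Equality of the restrictions of two forms of `ℝ³` to the surface `S` with normal `n`. -/
def SurfEq (S : Set E3) (n : E3 → E3) {k : ℕ} (b b' : E3 → E3 [⋀^Fin k]→L[ℝ] ℝ) : Prop :=
  ∀ q ∈ S, ∀ v : Fin k → E3, (∀ i, inner ℝ (n q) (v i) = 0) → b q v = b' q v

/-- Equality of the restrictions to `S × ℝ × ℝ` of two forms of `ℝ³ × ℝ × ℝ`. -/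
def AmbEq (S : Set E3) (n : E3 → E3) {k : ℕ} (B B' : Amb → Amb [⋀^Fin k]→L[ℝ] ℝ) : Prop :=
  ∀ y : Amb, y.1 ∈ S → ∀ v : Fin k → Amb, (∀ i, inner ℝ (n y.1) (v i).1 = 0) → B y v = B' y v

section LiftPatch

variable {F : Type*} [NormedAddCommGroup F] [NormedSpace ℝ F]

/-- The product of a parametrization of a surface with the identity of `ℝ²`. -/
def liftPatch (ψ : F → E3) (w : F × ℝ × ℝ) : Amb := (ψ w.1, w.2)

/-- The product of a linear projection with the identity of `ℝ²`. -/
noncomputable def liftProj (P : E3 →L[ℝ] F) : Amb →L[ℝ] F × ℝ × ℝ :=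
  P.prodMap (ContinuousLinearMap.id ℝ (ℝ × ℝ))

theorem liftProj_apply (P : E3 →L[ℝ] F) (y : Amb) : liftProj P y = (P y.1, y.2) := rfl

namespace IsGraphPatch

variable {S : Set E3} {n : E3 → E3} {P : E3 →L[ℝ] F} {O : Set F} {V : Set E3} {ψ : F → E3}
  {m : E3}

theorem hasFDerivAt_liftPatch (h : IsGraphPatch S n P O V ψ m) {w : F × ℝ × ℝ} (hw : w.1 ∈ O) :
    HasFDerivAt (liftPatch ψ)
      ((fderiv ℝ ψ w.1).prodMap (ContinuousLinearMap.id ℝ (ℝ × ℝ))) w :=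
  HasFDerivAt.prodMk ((h.hasFDerivAt hw).comp w hasFDerivAt_fst) hasFDerivAt_snd

theorem contDiffOn_liftPatch (h : IsGraphPatch S n P O V ψ m) :
    ContDiffOn ℝ ∞ (liftPatch ψ) (Prod.fst ⁻¹' O) :=
  (h.smooth.comp contDiff_fst.contDiffOn fun _ hw => hw).prodMk contDiff_snd.contDiffOn

theorem isOpen_fst_preimage (h : IsGraphPatch S n P O V ψ m) :
    IsOpen (Prod.fst ⁻¹' O : Set (F × ℝ × ℝ)) := h.isOpen_O.preimage continuous_fst

theorem fderiv_liftPatch_apply (h : IsGraphPatch S n P O V ψ m) {w : F × ℝ × ℝ} (hw : w.1 ∈ O)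
    (v : F × ℝ × ℝ) : fderiv ℝ (liftPatch ψ) w v = (fderiv ℝ ψ w.1 v.1, v.2) := by
  rw [(h.hasFDerivAt_liftPatch hw).fderiv]; rfl

theorem inner_fderiv_liftPatch (h : IsGraphPatch S n P O V ψ m) {w : F × ℝ × ℝ} (hw : w.1 ∈ O)
    (v : F × ℝ × ℝ) :
    inner ℝ (n (liftPatch ψ w).1) (fderiv ℝ (liftPatch ψ) w v).1 = 0 := by
  rw [h.fderiv_liftPatch_apply hw]
  exact h.orthogonal _ hw _

theorem liftProj_mem (h : IsGraphPatch S n P O V ψ m) {y : Amb} (hy : y.1 ∈ V) :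
    (liftProj P y).1 ∈ O := h.proj_mem _ hy

theorem liftPatch_liftProj (h : IsGraphPatch S n P O V ψ m) {y : Amb} (hS : y.1 ∈ S)
    (hV : y.1 ∈ V) : liftPatch ψ (liftProj P y) = y :=
  Prod.ext (h.param_proj _ ⟨hS, hV⟩) rfl

theorem liftProj_liftPatch (h : IsGraphPatch S n P O V ψ m) {w : F × ℝ × ℝ} (hw : w.1 ∈ O) :
    liftProj P (liftPatch ψ w) = w :=
  Prod.ext (h.proj _ hw) rfl

theorem fderiv_liftPatch_liftProj (h : IsGraphPatch S n P O V ψ m) {y : Amb} (hS : y.1 ∈ S)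
    (hV : y.1 ∈ V) {v : Amb} (hv : inner ℝ (n y.1) v.1 = 0) :
    fderiv ℝ (liftPatch ψ) (liftProj P y) (liftProj P v) = v := by
  rw [h.fderiv_liftPatch_apply (h.proj_mem _ hV)]
  exact Prod.ext (h.fderiv_proj ⟨hS, hV⟩ hv) rfl

/-- Two forms whose pullbacks by a parametrization agree have the same restriction to `S`. -/
theorem apply_eq_of_formPullback_eq {k : ℕ} (h : IsGraphPatch S n P O V ψ m)
    {b b' : E3 → E3 [⋀^Fin k]→L[ℝ] ℝ} {q : E3} (hq : q ∈ S ∩ V)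
    (hb : formPullback ψ b (P q) = formPullback ψ b' (P q)) {v : Fin k → E3}
    (hv : ∀ i, inner ℝ (n q) (v i) = 0) : b q v = b' q v := by
  have := congrArg (fun L => L fun i => P (v i)) hb
  simp only [formPullback_apply, h.param_proj q hq] at this
  simpa only [h.fderiv_proj hq (hv _)] using this

end IsGraphPatch

end LiftPatch

variable {S : Set E3} {n : E3 → E3} {k : ℕ}

theorem SurfEq.trans {b b' b'' : E3 → E3 [⋀^Fin k]→L[ℝ] ℝ} (h : SurfEq S n b b')
    (h' : SurfEq S n b' b'') : SurfEq S n b b'' :=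
  fun q hq v hv => (h q hq v hv).trans (h' q hq v hv)

theorem AmbEq.refl (B : Amb → Amb [⋀^Fin k]→L[ℝ] ℝ) : AmbEq S n B B := fun _ _ _ _ => rfl

theorem AmbEq.symm {B B' : Amb → Amb [⋀^Fin k]→L[ℝ] ℝ} (h : AmbEq S n B B') : AmbEq S n B' B :=
  fun q hq v hv => (h q hq v hv).symm

theorem AmbEq.add {B B' C C' : Amb → Amb [⋀^Fin k]→L[ℝ] ℝ} (h : AmbEq S n B B')
    (h' : AmbEq S n C C') : AmbEq S n (B + C) (B' + C') := fun q hq v hv => by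
  simp [h q hq v hv, h' q hq v hv]

/-- The restriction of dB depends only on the restriction of B: equal restrictions have equal
pullbacks by a lifted patch, d commutes with pullback, and every tangent vector comes from the
patch. -/
theorem AmbEq.extDeriv (hS : IsNormalSurface S n) {B B' : Amb → Amb [⋀^Fin k]→L[ℝ] ℝ}
    (hB : ContDiff ℝ ∞ B) (hB' : ContDiff ℝ ∞ B') (h : AmbEq S n B B') :
    AmbEq S n (extDeriv B) (extDeriv B') := by
  intro y hy v hv
  obtain ⟨P, O, V, ψ, m, hV, hp⟩ := hS.exists_patch _ hy
  have hO : (liftProj P y).1 ∈ O := hp.liftProj_mem hV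
  have hopen := hp.isOpen_fst_preimage.mem_nhds hO
  have hev : formPullback (liftPatch ψ) B =ᶠ[𝓝 (liftProj P y)]
      formPullback (liftPatch ψ) B' := by
    filter_upwards [hopen] with w hw
    ext v
    exact h _ (hp.mem _ hw).1 _ fun i => hp.inner_fderiv_liftPatch hw _
  have hsm := hp.contDiffOn_liftPatch.contDiffAt hopen
  have h1 := hev.extDeriv_eq
  rw [extDeriv_formPullback hB hsm, extDeriv_formPullback hB' hsm] at h1
  have h2 := congrArg (fun L => L fun i => liftProj P (v i)) h1
  simp only [formPullback_apply, hp.liftPatch_liftProj hy hV] at h2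
  simpa only [hp.fderiv_liftPatch_liftProj hy hV (hv _)] using h2

/-! ### Integrals depending smoothly on parameters -/

section ParametricIntegral

open MeasureTheory

universe u

variable {E V : Type u} [NormedAddCommGroup E] [NormedSpace ℝ E] [FiniteDimensional ℝ E]
  [NormedAddCommGroup V] [NormedSpace ℝ V]

theorem hasFDerivAt_intervalIntegral_of_contDiff {f : E × ℝ → V} (hf : ContDiff ℝ 1 f) (a b : ℝ)
    (x : E) :
    HasFDerivAt (fun x => ∫ t in a..b, f (x, t))
      (∫ t in a..b, (fderiv ℝ f (x, t)).comp (ContinuousLinearMap.inl ℝ E ℝ)) x := by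
  have hF' : Continuous fun z : E × ℝ => (fderiv ℝ f z).comp (ContinuousLinearMap.inl ℝ E ℝ) :=
    (hf.continuous_fderiv one_ne_zero).clm_comp continuous_const
  have : ProperSpace E := FiniteDimensional.proper ℝ E
  -- The derivative is bounded on a compact neighbourhood of {x} × [a, b], and this constant serves
  -- as the dominating function.
  obtain ⟨C, hC⟩ := ((isCompact_closedBall x 1).prod
    (isCompact_uIcc (a := a) (b := b))).exists_bound_of_continuousOn hF'.continuousOn
  refine intervalIntegral.hasFDerivAt_integral_of_dominated_of_fderiv_le
    (F := fun x t => f (x, t))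
    (F' := fun x t => (fderiv ℝ f (x, t)).comp (ContinuousLinearMap.inl ℝ E ℝ))
    (bound := fun _ => C) (Metric.closedBall_mem_nhds x one_pos) ?_ ?_ ?_ ?_ ?_ ?_
  · exact Eventually.of_forall fun y =>
      (hf.continuous.comp (continuous_const.prodMk continuous_id)).aestronglyMeasurable
  · exact (hf.continuous.comp (continuous_const.prodMk continuous_id)).intervalIntegrable _ _
  · exact (hF'.comp (continuous_const.prodMk continuous_id)).aestronglyMeasurable
  · refine Eventually.of_forall fun t ht y hy => hC (y, t) ⟨hy, uIoc_subset_uIcc ht⟩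
  · exact intervalIntegrable_const
  · refine Eventually.of_forall fun t _ y _ => ?_
    exact ((hf.differentiable one_ne_zero) (y, t)).hasFDerivAt.comp y
      (hasFDerivAt_prodMk_left y t)

theorem ContDiff.intervalIntegral {f : E × ℝ → V} (hf : ContDiff ℝ ∞ f) (a b : ℝ) :
    ContDiff ℝ ∞ (fun x => ∫ t in a..b, f (x, t)) := by
  rw [contDiff_infty]
  intro n
  -- The derivative is again a parametric integral, now with values in E →L[ℝ] V. Hence the
  -- generalization over V, and the common universe of E and V.
  induction n generalizing V with
  | zero =>
    rw [Nat.cast_zero, contDiff_zero]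
    exact continuous_iff_continuousAt.2 fun x =>
      (hasFDerivAt_intervalIntegral_of_contDiff (hf.of_le (by simp)) a b x).continuousAt
  | succ n ih =>
    rw [Nat.cast_succ, contDiff_succ_iff_fderiv]
    have hd := hasFDerivAt_intervalIntegral_of_contDiff (hf.of_le (by simp)) a b
    refine ⟨fun x => (hd x).differentiableAt, by simp, ?_⟩
    rw [funext fun x => (hd x).fderiv]
    exact ih ((hf.fderiv_right (by simp)).clm_comp contDiff_const)

end ParametricIntegral

/-! ### The Poincaré lemma with supports in a rectangle -/

section PlanarPoincare

open MeasureTheory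

/-- An affine substitution moves the variable end point into the integrand, which leaves a
parametric integral over [0, 1]. -/
theorem ContDiff.primitive_snd {h : ℝ × ℝ → ℝ} (hh : ContDiff ℝ ∞ h) (a : ℝ) :
    ContDiff ℝ ∞ (fun z : ℝ × ℝ => ∫ y in a..z.2, h (z.1, y)) := by
  have h1 : (fun z : ℝ × ℝ => ∫ y in a..z.2, h (z.1, y)) =
      fun z => (z.2 - a) * ∫ t in (0:ℝ)..1, h (z.1, (z.2 - a) * t + a) := by
    ext z
    have := intervalIntegral.smul_integral_comp_mul_add (a := 0) (b := 1)
      (fun y => h (z.1, y)) (z.2 - a) a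
    simp only [mul_zero, zero_add, mul_one, sub_add_cancel, smul_eq_mul] at this
    exact this.symm
  rw [h1]
  refine (contDiff_snd.sub contDiff_const).mul (ContDiff.intervalIntegral
    (f := fun w : (ℝ × ℝ) × ℝ => h (w.1.1, (w.1.2 - a) * w.2 + a)) ?_ 0 1)
  exact hh.comp (by fun_prop)

theorem exists_bump_Icc {a b : ℝ} (hab : a < b) :
    ∃ ρ : ℝ → ℝ, ContDiff ℝ ∞ ρ ∧ (∀ y, y ∉ Icc a b → ρ y = 0) ∧ ∫ y in a..b, ρ y = 1 := by
  have hr : 0 < (b - a) / 2 := by linarith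
  let φ : ContDiffBump ((a + b) / 2) := ⟨(b - a) / 4, (b - a) / 2, by linarith, by linarith⟩
  have hz : ∀ y, y ∉ Ioc a b → φ.normed volume y = 0 := by
    intro y hy
    by_contra hne
    have : y ∈ Function.support (φ.normed volume) := hne
    rw [φ.support_normed_eq, Real.ball_eq_Ioo] at this
    simp only [mem_Ioo, φ] at this
    exact hy ⟨by linarith [this.1], by linarith [this.2]⟩
  refine ⟨φ.normed volume, φ.contDiff_normed, fun y hy => hz y fun h => hy ⟨h.1.le, h.2⟩, ?_⟩
  rw [intervalIntegral.integral_of_le hab.le, setIntegral_eq_integral_of_forall_compl_eq_zero hz,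
    φ.integral_normed]

/-- This is what keeps the supports of the primitives inside the rectangle. -/
theorem integral_eq_zero_of_notMem_Icc {g : ℝ → ℝ} (hg : Continuous g) {a b : ℝ} (_hab : a ≤ b)
    (h0 : ∀ x, x ∉ Icc a b → g x = 0) (hint : ∫ t in a..b, g t = 0) {x : ℝ} (hx : x ∉ Icc a b) :
    ∫ t in a..x, g t = 0 := by
  rcases lt_or_ge x a with h | h
  · refine intervalIntegral.integral_zero_ae ?_
    filter_upwards [compl_mem_ae_iff.2 (measure_singleton a)] with t ht htx
    rw [uIoc_of_ge h.le] at htx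
    exact h0 t fun h' => ht (le_antisymm htx.2 h'.1)
  · have hbx : b < x := not_le.1 fun h' => hx ⟨h, h'⟩
    rw [← intervalIntegral.integral_add_adjacent_intervals (hg.intervalIntegrable a b)
      (hg.intervalIntegrable b x), hint, zero_add]
    refine intervalIntegral.integral_zero_ae (Eventually.of_forall fun t ht => ?_)
    rw [uIoc_of_le hbx.le] at ht
    exact h0 t fun h' => absurd h'.2 (not_le.2 ht.1)

/-- The Poincaré lemma with supports in a rectangle, for `2`-forms on the plane of integral zero. -/
theorem exists_primitive_of_integral_eq_zero {f : ℝ × ℝ → ℝ} (hf : ContDiff ℝ ∞ f)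
    {a₁ b₁ a₂ b₂ : ℝ} (h₁ : a₁ < b₁) (h₂ : a₂ < b₂)
    (hsupp : ∀ z, z ∉ Icc a₁ b₁ ×ˢ Icc a₂ b₂ → f z = 0)
    (hint : ∫ x in a₁..b₁, ∫ y in a₂..b₂, f (x, y) = 0) :
    ∃ α β : ℝ × ℝ → ℝ, ContDiff ℝ ∞ α ∧ ContDiff ℝ ∞ β ∧
      (∀ z, z ∉ Icc a₁ b₁ ×ˢ Icc a₂ b₂ → α z = 0) ∧
      (∀ z, z ∉ Icc a₁ b₁ ×ˢ Icc a₂ b₂ → β z = 0) ∧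
      ∀ z, fderiv ℝ β z (1, 0) - fderiv ℝ α z (0, 1) = f z := by
  obtain ⟨ρ, hρ, hρ0, hρ1⟩ := exists_bump_Icc h₂
  set g : ℝ → ℝ := fun x => ∫ y in a₂..b₂, f (x, y) with hg
  have hgs : ContDiff ℝ ∞ g := ContDiff.intervalIntegral hf _ _
  have hg0 : ∀ x, x ∉ Icc a₁ b₁ → g x = 0 := by
    intro x hx
    have : ∀ y, f (x, y) = 0 := fun y => hsupp _ fun h => hx h.1
    simp [hg, this]
  set G : ℝ → ℝ := fun x => ∫ t in a₁..x, g t with hG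
  have hGd : ∀ x, HasDerivAt G (g x) x := fun x =>
    hgs.continuous.integral_hasStrictDerivAt a₁ x |>.hasDerivAt
  have hGs : ContDiff ℝ ∞ G := by
    rw [contDiff_infty_iff_deriv]
    refine ⟨fun x => (hGd x).differentiableAt, ?_⟩
    rw [funext fun x => (hGd x).deriv]
    exact hgs
  have hG0 : ∀ x, x ∉ Icc a₁ b₁ → G x = 0 := by
    intro x hx
    exact integral_eq_zero_of_notMem_Icc hgs.continuous h₁.le hg0 hint hx
  -- Write f = g(x) ρ(y) + h. The first summand is the x-derivative of G(x) ρ(y), where G is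
  -- supported in the interval because the total integral of f vanishes. The remainder h has
  -- integral zero over each vertical segment, so its primitive in y is supported in the rectangle.
  set h : ℝ × ℝ → ℝ := fun z => f z - g z.1 * ρ z.2 with hh
  have hhs : ContDiff ℝ ∞ h := hf.sub ((hgs.comp contDiff_fst).mul (hρ.comp contDiff_snd))
  have hh0 : ∀ z, z ∉ Icc a₁ b₁ ×ˢ Icc a₂ b₂ → h z = 0 := by
    intro z hz
    simp only [hh, hsupp z hz]
    by_cases hz1 : z.1 ∈ Icc a₁ b₁
    · rw [hρ0 z.2 fun hz2 => hz ⟨hz1, hz2⟩]; simp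
    · rw [hg0 _ hz1]; simp
  have hhint : ∀ x, ∫ y in a₂..b₂, h (x, y) = 0 := by
    intro x
    simp only [hh]
    rw [intervalIntegral.integral_sub, intervalIntegral.integral_const_mul, hρ1, mul_one, hg,
      sub_self]
    · exact (hf.continuous.comp (by fun_prop)).intervalIntegrable _ _
    · exact (continuous_const.mul hρ.continuous).intervalIntegrable _ _
  refine ⟨fun z => -∫ y in a₂..z.2, h (z.1, y), fun z => ρ z.2 * G z.1,
    (hhs.primitive_snd a₂).neg, (hρ.comp contDiff_snd).mul (hGs.comp contDiff_fst), ?_, ?_, ?_⟩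
  · intro z hz
    simp only [neg_eq_zero]
    by_cases hz1 : z.1 ∈ Icc a₁ b₁
    · exact integral_eq_zero_of_notMem_Icc
        (hhs.continuous.comp (continuous_const.prodMk continuous_id)) h₂.le
        (fun y hy => hh0 _ fun h' => hy h'.2) (hhint _) fun hz2 => hz ⟨hz1, hz2⟩
    · have : ∀ y, h (z.1, y) = 0 := fun y => hh0 _ fun h' => hz1 h'.1
      simp [this]
  · intro z hz
    by_cases hz1 : z.1 ∈ Icc a₁ b₁
    · simp only; rw [hρ0 z.2 fun hz2 => hz ⟨hz1, hz2⟩, zero_mul]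
    · simp only; rw [hG0 _ hz1, mul_zero]
  · intro z
    have e1 : fderiv ℝ (fun z : ℝ × ℝ => ρ z.2 * G z.1) z (1, 0) = ρ z.2 * g z.1 := by
      have hd1 := (hGd z.1).hasFDerivAt.comp z (hasFDerivAt_fst (𝕜 := ℝ) (E := ℝ) (F := ℝ))
      have hd2 := ((hρ.differentiable (by simp) z.2).hasFDerivAt).comp z
        (hasFDerivAt_snd (𝕜 := ℝ) (E := ℝ) (F := ℝ))
      have := (hd2.mul hd1).fderiv
      simp only [Function.comp_def] at this
      erw [this]
      simp
    have e2 : fderiv ℝ (fun z : ℝ × ℝ => -∫ y in a₂..z.2, h (z.1, y)) z (0, 1) = -h z := by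
      -- The derivative in the direction (0, 1) is computed along the vertical line through z, by
      -- the fundamental theorem of calculus.
      have hd1 := (((hhs.primitive_snd a₂).neg.differentiable (by simp)) z).hasFDerivAt
      have hd2 : HasDerivAt (fun y : ℝ => (z.1, y)) (0, 1) z.2 :=
        (hasDerivAt_const z.2 z.1).prodMk (hasDerivAt_id z.2)
      have hd3 := HasFDerivAt.comp_hasDerivAt (f := fun y : ℝ => (z.1, y)) z.2 hd1 hd2
      have hd4 : HasDerivAt (fun y : ℝ => -∫ y' in a₂..y, h (z.1, y')) (-h (z.1, z.2)) z.2 :=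
        ((hhs.continuous.comp
          (continuous_const.prodMk continuous_id)).integral_hasStrictDerivAt a₂ z.2).hasDerivAt.neg
      exact hd3.unique hd4
    rw [e1, e2]
    simp only [hh]
    ring

end PlanarPoincare

/-! ### Linear algebra of the area form -/

section AreaForm

theorem vol3_eq (a b c : E3) : vol3 a b c =
    a 0 * (b 1 * c 2 - b 2 * c 1) - a 1 * (b 0 * c 2 - b 2 * c 0)
      + a 2 * (b 0 * c 1 - b 1 * c 0) := by
  simp only [vol3, Matrix.det_fin_three, Matrix.of_apply, Matrix.cons_val', Matrix.cons_val_zero,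
    Matrix.cons_val_one, Matrix.cons_val_fin_one, Matrix.cons_val]
  ring

theorem inner_E3 (a b : E3) : inner ℝ a b = a 0 * b 0 + a 1 * b 1 + a 2 * b 2 := by
  simp only [PiLp.inner_apply, Fin.sum_univ_three, RCLike.inner_apply, conj_trivial]
  ring

/-- The `2`-form `ι_c (dx ∧ dy ∧ dz)` on `ℝ³`. -/
noncomputable def volContract (c : E3) : E3 [⋀^Fin 2]→L[ℝ] ℝ where
  toFun v := vol3 c (v 0) (v 1)
  map_update_add' v i x y := by
    fin_cases i <;> simp [vol3_eq] <;> ring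
  map_update_smul' v i r x := by
    fin_cases i <;> simp [vol3_eq] <;> ring
  map_eq_zero_of_eq' v i j hij hne := by
    have : v 0 = v 1 := by
      fin_cases i <;> fin_cases j <;> simp_all
    simp only [vol3_eq, this]
    ring
  cont := by
    simp only [vol3_eq]
    fun_prop

theorem volContract_apply (c : E3) (v : Fin 2 → E3) : volContract c v = vol3 c (v 0) (v 1) := rfl

theorem contDiff_volContract : ContDiff ℝ ∞ volContract := by
  refine contDiff_form fun v => ?_
  simp only [volContract_apply, vol3_eq]
  fun_prop

/-- The identity `det(c, n × x, n × y) = ⟨c, n⟩ det(n, x, y)`, for `c = n` of norm one: some tangent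
vectors of the plane orthogonal to `n` have `det(c, v, w) = ⟨c, n⟩`. -/
theorem exists_orthogonal_frame {n : E3} (hn : ‖n‖ = 1) :
    ∃ v w : E3, inner ℝ n v = 0 ∧ inner ℝ n w = 0 ∧ ∃ r : ℝ, r ≠ 0 ∧
      ∀ c : E3, vol3 c v w = r * inner ℝ c n := by
  have key : ∀ x y : E3, inner ℝ n (!₂[n 1 * x 2 - n 2 * x 1, n 2 * x 0 - n 0 * x 2,
      n 0 * x 1 - n 1 * x 0] : E3) = 0 ∧ ∀ c : E3,
      vol3 c !₂[n 1 * x 2 - n 2 * x 1, n 2 * x 0 - n 0 * x 2, n 0 * x 1 - n 1 * x 0]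
        !₂[n 1 * y 2 - n 2 * y 1, n 2 * y 0 - n 0 * y 2, n 0 * y 1 - n 1 * y 0]
        = vol3 n x y * inner ℝ c n := by
    intro x y
    refine ⟨?_, fun c => ?_⟩
    · rw [inner_E3]; simp; ring
    · rw [inner_E3, vol3_eq, vol3_eq]; simp; ring
  have hex : ∃ x y : E3, vol3 n x y ≠ 0 := by
    by_contra! h
    have h0 := h !₂[0, 1, 0] !₂[0, 0, 1]
    have h1 := h !₂[1, 0, 0] !₂[0, 0, 1]
    have h2 := h !₂[1, 0, 0] !₂[0, 1, 0]
    simp [vol3_eq] at h0 h1 h2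
    have : n = 0 := by
      ext i; fin_cases i <;> simp [h0, h1, h2]
    rw [this] at hn
    simp at hn
  obtain ⟨x, y, hxy⟩ := hex
  exact ⟨_, _, (key x y).1, (key y x).1, vol3 n x y, hxy, (key x y).2⟩

/-- For a and b orthogonal to the unit vector n, the cross product a × b is a multiple of n, with
coefficient det(n, a, b). So a × b = 0, componentwise `hx`, `hy`, `hz`, and the conclusion is the
expansion of the double product a × (b × a) = 0. -/
theorem eq_zero_of_vol3_eq_zero {n a b : E3} (hn : ‖n‖ = 1) (ha : inner ℝ n a = 0)
    (hb : inner ℝ n b = 0) (h : vol3 n a b = 0) : (inner ℝ a a : ℝ) • b = (inner ℝ a b : ℝ) • a := by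
  have hn2 : n 0 * n 0 + n 1 * n 1 + n 2 * n 2 = 1 := by
    rw [← inner_E3, real_inner_self_eq_norm_sq, hn]; norm_num
  rw [inner_E3] at ha hb
  rw [vol3_eq] at h
  have hx : a 1 * b 2 - a 2 * b 1 = 0 := by
    linear_combination (-(a 1 * b 2 - a 2 * b 1)) * hn2 + n 0 * h
      + (n 1 * b 2 - n 2 * b 1) * ha - (n 1 * a 2 - n 2 * a 1) * hb
  have hy : a 2 * b 0 - a 0 * b 2 = 0 := by
    linear_combination (-(a 2 * b 0 - a 0 * b 2)) * hn2 + n 1 * h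
      + (n 2 * b 0 - n 0 * b 2) * ha - (n 2 * a 0 - n 0 * a 2) * hb
  have hz : a 0 * b 1 - a 1 * b 0 = 0 := by
    linear_combination (-(a 0 * b 1 - a 1 * b 0)) * hn2 + n 2 * h
      + (n 0 * b 1 - n 1 * b 0) * ha - (n 0 * a 1 - n 1 * a 0) * hb
  rw [inner_E3, inner_E3]
  ext i
  fin_cases i
  · simp; linear_combination a 2 * hy - a 1 * hz
  · simp; linear_combination a 0 * hz - a 2 * hx
  · simp; linear_combination a 1 * hx - a 0 * hy

end AreaForm

/-! ### Cutoff functions, 1-forms, and 2-forms of the plane -/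

section Cutoff

variable {F : Type*} [NormedAddCommGroup F] [NormedSpace ℝ F] [FiniteDimensional ℝ F]

theorem exists_contDiff_cutoff {K V : Set F} (hK : IsCompact K) (hV : IsOpen V) (hKV : K ⊆ V) :
    ∃ χ : F → ℝ, ContDiff ℝ ∞ χ ∧ (∀ x ∈ K, χ x = 1) ∧ tsupport χ ⊆ V ∧ HasCompactSupport χ ∧
      ∀ x, 0 ≤ χ x := by
  have : ProperSpace F := FiniteDimensional.proper ℝ F
  obtain ⟨L, hL, hKL, hLV⟩ := exists_compact_between hK hV hKV
  obtain ⟨f, hf0, hf1, hf⟩ := exists_contMDiffMap_zero_one_of_isClosed 𝓘(ℝ, F) (n := ⊤)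
    (isOpen_interior (s := L)).isClosed_compl hK.isClosed
    (disjoint_left.2 fun x hx hxK => hx (hKL hxK))
  have hs : tsupport f ⊆ L := by
    refine closure_minimal (fun x hx => ?_) hL.isClosed
    by_contra hxL
    exact hx (hf0 fun h => hxL (interior_subset h))
  exact ⟨f, f.contMDiff.contDiff, fun x hx => hf1 hx, hs.trans hLV,
    HasCompactSupport.of_support_subset_isCompact hL (subset_tsupport _ |>.trans hs),
    fun x => (hf x).1⟩

end Cutoff

section OneForm

variable {F : Type*} [NormedAddCommGroup F] [NormedSpace ℝ F]

/-- The alternating `1`-form of a linear functional. -/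
noncomputable def oneForm (L : F →L[ℝ] ℝ) : F [⋀^Fin 1]→L[ℝ] ℝ :=
  ContinuousAlternatingMap.ofSubsingletonLIE (𝕜 := ℝ) (E := F) (F := ℝ) (0 : Fin 1) L

theorem oneForm_apply (L : F →L[ℝ] ℝ) (v : Fin 1 → F) : oneForm L v = L (v 0) := rfl

theorem contDiff_oneForm : ContDiff ℝ ∞ (oneForm : (F →L[ℝ] ℝ) → F [⋀^Fin 1]→L[ℝ] ℝ) :=
  (ContinuousAlternatingMap.ofSubsingletonLIE (𝕜 := ℝ) (E := F) (F := ℝ) (0 : Fin 1)).contDiff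

end OneForm

section PlaneForms

theorem extDeriv_oneForm_plane {α β : ℝ × ℝ → ℝ} (hα : ContDiff ℝ ∞ α) (hβ : ContDiff ℝ ∞ β)
    (z : ℝ × ℝ) :
    extDeriv (fun z => oneForm (α z • ContinuousLinearMap.fst ℝ ℝ ℝ
      + β z • ContinuousLinearMap.snd ℝ ℝ ℝ)) z ![(1, 0), (0, 1)]
      = fderiv ℝ β z (1, 0) - fderiv ℝ α z (0, 1) := by
  have hd : DifferentiableAt ℝ (fun z => oneForm (α z • ContinuousLinearMap.fst ℝ ℝ ℝ
      + β z • ContinuousLinearMap.snd ℝ ℝ ℝ)) z :=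
    (contDiff_oneForm.comp ((hα.smul contDiff_const).add
      (hβ.smul contDiff_const))).differentiable (by simp) z
  rw [extDeriv_one_apply hd, ← fderiv_continuousAlternatingMap_apply_const_apply hd,
    ← fderiv_continuousAlternatingMap_apply_const_apply hd]
  simp [oneForm_apply]

theorem planeForm_ext {B B' : (ℝ × ℝ) [⋀^Fin 2]→L[ℝ] ℝ}
    (h : B ![(1, 0), (0, 1)] = B' ![(1, 0), (0, 1)]) : B = B' := by
  apply ContinuousAlternatingMap.toAlternatingMap_injective
  refine Module.Basis.ext_alternating (Module.Basis.finTwoProd ℝ) fun σ hσ => ?_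
  have e : ∀ C : (ℝ × ℝ) [⋀^Fin 2]→L[ℝ] ℝ, C ![(0, 1), (1, 0)] = - C ![(1, 0), (0, 1)] := by
    intro C
    have := C.toAlternatingMap.map_swap ![((1 : ℝ), (0 : ℝ)), (0, 1)] (i := 0) (j := 1) (by simp)
    rw [← C.coe_toAlternatingMap, ← this]
    congr 1
    ext i <;> fin_cases i <;> simp
  have h01 : (σ 0 = 0 ∧ σ 1 = 1) ∨ (σ 0 = 1 ∧ σ 1 = 0) := by
    have := hσ.ne (show (0 : Fin 2) ≠ 1 by simp)
    omega
  rcases h01 with ⟨h0, h1⟩ | ⟨h0, h1⟩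
  · have : (fun i => (Module.Basis.finTwoProd ℝ) (σ i)) = ![((1 : ℝ), (0 : ℝ)), (0, 1)] := by
      funext i; fin_cases i <;> simp [h0, h1]
    rw [this]; exact h
  · have : (fun i => (Module.Basis.finTwoProd ℝ) (σ i)) = ![((0 : ℝ), (1 : ℝ)), (1, 0)] := by
      funext i; fin_cases i <;> simp [h0, h1]
    rw [this]
    exact (e B).trans ((congrArg Neg.neg h).trans (e B').symm)

end PlaneForms

/-! ### 2-forms supported in a disc of the surface -/

section DiscLemma

open MeasureTheory

variable {S : Set E3} {n : E3 → E3} {P : E3 →L[ℝ] ℝ × ℝ} {O : Set (ℝ × ℝ)} {V : Set E3}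
  {ψ : ℝ × ℝ → E3} {m : E3}

/-- The coefficient function of the pullback of a `2`-form by a parametrization. -/
noncomputable def planeCoeff (ψ : ℝ × ℝ → E3) (O : Set (ℝ × ℝ)) (θ : E3 → E3 [⋀^Fin 2]→L[ℝ] ℝ) :
    ℝ × ℝ → ℝ :=
  O.indicator fun z => formPullback ψ θ z ![(1, 0), (0, 1)]

theorem planeCoeff_add_smul (ψ : ℝ × ℝ → E3) (O : Set (ℝ × ℝ))
    (θ θ' : E3 → E3 [⋀^Fin 2]→L[ℝ] ℝ) (c : ℝ) (z : ℝ × ℝ) :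
    planeCoeff ψ O (θ + c • θ') z = planeCoeff ψ O θ z + c * planeCoeff ψ O θ' z := by
  by_cases hz : z ∈ O <;> simp [planeCoeff, hz, formPullback_apply]

theorem IsGraphPatch.planeCoeff_eq_zero (h : IsGraphPatch S n P O V ψ m) {Q : Set (ℝ × ℝ)}
    {θ : E3 → E3 [⋀^Fin 2]→L[ℝ] ℝ} (hs : tsupport θ ⊆ V ∩ P ⁻¹' Q) {z : ℝ × ℝ} (hz : z ∉ Q) :
    planeCoeff ψ O θ z = 0 := by
  by_cases hzO : z ∈ O
  · have h0 : θ (ψ z) = 0 := by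
      by_contra hne
      have := (hs (subset_tsupport θ hne)).2
      rw [mem_preimage, h.proj z hzO] at this
      exact hz this
    simp [planeCoeff, hzO, formPullback_apply, h0]
  · simp [planeCoeff, hzO]

/-- The closed set R between Q and O makes the extension by zero smooth: a point outside O has the
complement of R as a neighbourhood, where the coefficient vanishes. -/
theorem IsGraphPatch.contDiff_planeCoeff (h : IsGraphPatch S n P O V ψ m) {Q R : Set (ℝ × ℝ)}
    (hR : IsClosed R) (hQR : Q ⊆ R) (hRO : R ⊆ O)
    {θ : E3 → E3 [⋀^Fin 2]→L[ℝ] ℝ} (hθ : ContDiff ℝ ∞ θ) (hs : tsupport θ ⊆ V ∩ P ⁻¹' Q) :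
    ContDiff ℝ ∞ (planeCoeff ψ O θ) := by
  rw [contDiff_iff_contDiffAt]
  intro z
  by_cases hz : z ∈ O
  · have h1 : ContDiffOn ℝ ∞ (fun z => formPullback ψ θ z ![(1, 0), (0, 1)]) O :=
      (ContDiffOn.formPullback h.isOpen_O h.smooth hθ.contDiffOn
        (mapsTo_univ _ _)).alternating_apply contDiffOn_const
    refine (h1.contDiffAt (h.isOpen_O.mem_nhds hz)).congr_of_eventuallyEq ?_
    filter_upwards [h.isOpen_O.mem_nhds hz] with w hw
    simp [planeCoeff, hw]
  · have hzR : Rᶜ ∈ 𝓝 z := hR.isOpen_compl.mem_nhds fun hzR => hz (hRO hzR)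
    refine (contDiffAt_const (c := (0 : ℝ))).congr_of_eventuallyEq ?_
    filter_upwards [hzR] with w hw
    exact h.planeCoeff_eq_zero hs fun hwQ => hw (hQR hwQ)

/-- The planar primitive τ is carried to ℝ³ as χ · P*τ, where χ is supported in V and equals 1 over
the rectangle. As τ vanishes off the rectangle, the cutoff does not alter its pullback by ψ. -/
theorem IsGraphPatch.exists_primitive (h : IsGraphPatch S n P O V ψ m) {a₁ b₁ a₂ b₂ : ℝ}
    (h₁ : a₁ < b₁) (h₂ : a₂ < b₂) (hRO : Icc a₁ b₁ ×ˢ Icc a₂ b₂ ⊆ O)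
    {θ : E3 → E3 [⋀^Fin 2]→L[ℝ] ℝ} (hθ : ContDiff ℝ ∞ θ)
    (hs : tsupport θ ⊆ V ∩ P ⁻¹' (Ioo a₁ b₁ ×ˢ Ioo a₂ b₂))
    (hint : ∫ x in a₁..b₁, ∫ y in a₂..b₂, planeCoeff ψ O θ (x, y) = 0) :
    ∃ η : E3 → E3 [⋀^Fin 1]→L[ℝ] ℝ, ContDiff ℝ ∞ η ∧ SurfEq S n θ (extDeriv η) := by
  have hR : IsCompact (Icc a₁ b₁ ×ˢ Icc a₂ b₂) := isCompact_Icc.prod isCompact_Icc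
  have hQR : Ioo a₁ b₁ ×ˢ Ioo a₂ b₂ ⊆ Icc a₁ b₁ ×ˢ Icc a₂ b₂ :=
    prod_mono Ioo_subset_Icc_self Ioo_subset_Icc_self
  have hf := h.contDiff_planeCoeff hR.isClosed hQR hRO hθ hs
  obtain ⟨α, β, hα, hβ, hα0, hβ0, hαβ⟩ := exists_primitive_of_integral_eq_zero hf h₁ h₂
    (fun z hz => h.planeCoeff_eq_zero hs fun hzQ => hz (hQR hzQ)) hint
  obtain ⟨χ, hχ, hχ1, hχV, -, -⟩ := exists_contDiff_cutoff
    (hR.image_of_continuousOn (h.smooth.continuousOn.mono hRO)) h.isOpen_V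
    (by rintro _ ⟨z, hz, rfl⟩; exact (h.mem z (hRO hz)).2)
  set τ : ℝ × ℝ → (ℝ × ℝ) [⋀^Fin 1]→L[ℝ] ℝ := fun z => oneForm (α z • ContinuousLinearMap.fst ℝ ℝ ℝ
      + β z • ContinuousLinearMap.snd ℝ ℝ ℝ) with hτ
  have hτs : ContDiff ℝ ∞ τ := contDiff_oneForm.comp ((hα.smul contDiff_const).add
    (hβ.smul contDiff_const))
  have hτ0 : ∀ z, z ∉ Icc a₁ b₁ ×ˢ Icc a₂ b₂ → τ z = 0 := by
    intro z hz
    ext v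
    simp [hτ, hα0 z hz, hβ0 z hz, oneForm_apply]
  set η : E3 → E3 [⋀^Fin 1]→L[ℝ] ℝ := fun x => χ x • formPullback P τ x with hη
  have hηs : ContDiff ℝ ∞ η := hχ.smul (ContDiff.formPullback P.contDiff hτs)
  refine ⟨η, hηs, fun q hq v hv => ?_⟩
  by_cases hqV : q ∈ V
  · refine h.apply_eq_of_formPullback_eq ⟨hq, hqV⟩ ?_ hv
    have hO := h.proj_mem q hqV
    rw [← extDeriv_formPullback hηs (h.smooth.contDiffAt (h.isOpen_O.mem_nhds hO))]
    have hev : formPullback ψ η =ᶠ[𝓝 (P q)] τ := by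
      filter_upwards [h.isOpen_O.mem_nhds hO] with u hu
      ext w
      have e1 : formPullback ψ η u w = χ (ψ u) * τ u w := by
        have hPd : ∀ x, fderiv ℝ (P : E3 → ℝ × ℝ) x = P := fun x => P.fderiv
        simp [formPullback_apply, hη, hPd, h.proj u hu, h.proj_fderiv hu]
      rw [e1]
      by_cases huR : u ∈ Icc a₁ b₁ ×ˢ Icc a₂ b₂
      · rw [hχ1 _ (mem_image_of_mem ψ huR), one_mul]
      · rw [hτ0 u huR]; simp
    rw [hev.extDeriv_eq]
    apply planeForm_ext
    rw [hτ, extDeriv_oneForm_plane hα hβ, hαβ]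
    simp [planeCoeff, hO]
  · have hθ0 : θ q = 0 := by
      by_contra hne
      exact hqV (hs (subset_tsupport θ hne)).1
    have hη0 : η =ᶠ[𝓝 q] fun _ => 0 := by
      have := notMem_tsupport_iff_eventuallyEq.1 fun hq' => hqV (hχV hq')
      filter_upwards [this] with x hx
      simp [hη, hx]
    rw [hη0.extDeriv_eq, hθ0]
    simp [extDeriv, ContinuousAlternatingMap.alternatizeUncurryFin_apply]

theorem IsGraphPatch.vol3_ne_zero (hS : IsNormalSurface S n) (h : IsGraphPatch S n P O V ψ m)
    {z : ℝ × ℝ} (hz : z ∈ O) :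
    vol3 (n (ψ z)) (fderiv ℝ ψ z (1, 0)) (fderiv ℝ ψ z (0, 1)) ≠ 0 := by
  intro h0
  have h1 := eq_zero_of_vol3_eq_zero (hS.norm_eq_one _ (h.mem z hz).1) (h.orthogonal z hz _)
    (h.orthogonal z hz _) h0
  -- With a and b the images of the basis vectors, P turns ⟨a, a⟩ b = ⟨a, b⟩ a into (0, ⟨a, a⟩) =
  -- (⟨a, b⟩, 0), so a = 0. This contradicts P a = (1, 0).
  have h2 := congrArg P h1
  rw [map_smul, map_smul, h.proj_fderiv hz, h.proj_fderiv hz] at h2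
  have h3 : (inner ℝ (fderiv ℝ ψ z (1, 0)) (fderiv ℝ ψ z (1, 0)) : ℝ) = 0 := by
    simpa using congrArg Prod.snd h2
  have h4 := inner_self_eq_zero.1 h3
  have h5 := h.proj_fderiv hz (1, 0)
  rw [h4, map_zero] at h5
  simpa using congrArg Prod.fst h5

theorem intervalIntegral_pos_of_rectangle {f : ℝ × ℝ → ℝ} (hf : ContDiff ℝ ∞ f)
    {a₁ b₁ a₂ b₂ : ℝ} (h₁ : a₁ < b₁) (h₂ : a₂ < b₂) (hpos : ∀ z, 0 ≤ f z) {z : ℝ × ℝ}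
    (hz : z ∈ Icc a₁ b₁ ×ˢ Icc a₂ b₂) (hfz : 0 < f z) :
    0 < ∫ x in a₁..b₁, ∫ y in a₂..b₂, f (x, y) := by
  have hin : ∀ x, Continuous fun y => f (x, y) := fun x =>
    hf.continuous.comp (continuous_const.prodMk continuous_id)
  refine intervalIntegral.integral_pos h₁ (ContDiff.intervalIntegral hf _ _).continuous.continuousOn
    (fun x _ => intervalIntegral.integral_nonneg h₂.le fun y _ => hpos _) ⟨z.1, hz.1, ?_⟩
  exact intervalIntegral.integral_pos h₂ (hin _).continuousOn (fun y _ => hpos _)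
    ⟨z.2, hz.2, hfz⟩

/-- A cutoff multiple of the area form has nonzero integral once the sign of its coefficient J is
controlled. The extra constant J(P q) makes the coefficient χ · J · J(P q), which is positive at P q
whatever the orientation of the patch. -/
theorem IsGraphPatch.exists_bump (hS : IsNormalSurface S n) (h : IsGraphPatch S n P O V ψ m)
    (hn : ContDiff ℝ ∞ n) {a₁ b₁ a₂ b₂ : ℝ}
    (h₁ : a₁ < b₁) (h₂ : a₂ < b₂) (hRO : Icc a₁ b₁ ×ˢ Icc a₂ b₂ ⊆ O) {W : Set E3} (hW : IsOpen W)
    {q : E3} (hqS : q ∈ S) (hqW : q ∈ W) (hqV : q ∈ V) (hqQ : P q ∈ Ioo a₁ b₁ ×ˢ Ioo a₂ b₂) :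
    ∃ Θ : E3 → E3 [⋀^Fin 2]→L[ℝ] ℝ, ContDiff ℝ ∞ Θ ∧
      tsupport Θ ⊆ W ∩ (V ∩ P ⁻¹' (Ioo a₁ b₁ ×ˢ Ioo a₂ b₂)) ∧
      ∫ x in a₁..b₁, ∫ y in a₂..b₂, planeCoeff ψ O Θ (x, y) ≠ 0 := by
  have hR : IsCompact (Icc a₁ b₁ ×ˢ Icc a₂ b₂) := isCompact_Icc.prod isCompact_Icc
  have hQR : Ioo a₁ b₁ ×ˢ Ioo a₂ b₂ ⊆ Icc a₁ b₁ ×ˢ Icc a₂ b₂ :=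
    prod_mono Ioo_subset_Icc_self Ioo_subset_Icc_self
  set J : ℝ × ℝ → ℝ := fun z => vol3 (n (ψ z)) (fderiv ℝ ψ z (1, 0)) (fderiv ℝ ψ z (0, 1)) with hJ
  have hJf : ∀ z, J z = formPullback ψ (fun x => volContract (n x)) z ![(1, 0), (0, 1)] :=
    fun z => rfl
  have hωs : ContDiff ℝ ∞ fun x => volContract (n x) := contDiff_volContract.comp hn
  have hJc : ContinuousOn J O := by
    have h1 : ContDiffOn ℝ ∞ (fun z => formPullback ψ (fun x => volContract (n x)) z
        ![(1, 0), (0, 1)]) O :=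
      (ContDiffOn.formPullback h.isOpen_O h.smooth hωs.contDiffOn
        (mapsTo_univ _ _)).alternating_apply contDiffOn_const
    exact h1.continuousOn
  have hqO := h.proj_mem q hqV
  have hJq : J (P q) ≠ 0 := h.vol3_ne_zero hS hqO
  -- The support of χ is confined to the region where J keeps the sign that it has at P q.
  set O' := O ∩ (fun z => J z * J (P q)) ⁻¹' Ioi 0 with hO'
  have hO'o : IsOpen O' := (hJc.mul continuousOn_const).isOpen_inter_preimage h.isOpen_O isOpen_Ioi
  obtain ⟨χ, hχ, hχ1, hχV, -, hχ0⟩ := exists_contDiff_cutoff (isCompact_singleton (x := q))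
    (V := (W ∩ (V ∩ P ⁻¹' (Ioo a₁ b₁ ×ˢ Ioo a₂ b₂))) ∩ P ⁻¹' O')
    ((hW.inter (h.isOpen_V.inter ((isOpen_Ioo.prod isOpen_Ioo).preimage P.continuous))).inter
      (hO'o.preimage P.continuous))
    (singleton_subset_iff.2 ⟨⟨hqW, hqV, hqQ⟩, hqO, mul_self_pos.2 hJq⟩)
  have hts : tsupport (fun x => (J (P q) * χ x) • volContract (n x)) ⊆ tsupport χ := by
    refine closure_mono fun x hx hχx => hx ?_
    simp [hχx]
  have hΘs : ContDiff ℝ ∞ fun x => (J (P q) * χ x) • volContract (n x) :=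
    (contDiff_const.mul hχ).smul hωs
  refine ⟨fun x => (J (P q) * χ x) • volContract (n x), hΘs,
    hts.trans (hχV.trans inter_subset_left), ne_of_gt ?_⟩
  have hf := h.contDiff_planeCoeff hR.isClosed hQR hRO hΘs
    (hts.trans (hχV.trans (inter_subset_left.trans inter_subset_right)))
  have hval : ∀ z ∈ O, planeCoeff ψ O (fun x => (J (P q) * χ x) • volContract (n x)) z
      = χ (ψ z) * (J z * J (P q)) := by
    intro z hz
    simp only [planeCoeff, hz, indicator_of_mem, formPullback_apply, hJ,
      ContinuousAlternatingMap.smul_apply, volContract_apply, smul_eq_mul, Matrix.cons_val_zero,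
      Matrix.cons_val_one]
    ring
  refine intervalIntegral_pos_of_rectangle hf h₁ h₂ (fun z => ?_) (hQR hqQ) ?_
  · by_cases hz : z ∈ O
    · rw [hval z hz]
      by_cases hχz : χ (ψ z) = 0
      · simp [hχz]
      · have h1 := (hχV (subset_tsupport χ hχz)).2
        rw [mem_preimage, h.proj z hz] at h1
        exact mul_nonneg (hχ0 _) (le_of_lt h1.2)
    · simp [planeCoeff, hz]
  · rw [hval _ hqO, h.param_proj q ⟨hqS, hqV⟩, hχ1 q rfl, one_mul]
    exact mul_self_pos.2 hJq

/-- Every point of the surface has a neighbourhood `D` such that the `2`-forms supported in `D`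
are, up to exact forms, the multiples of a form supported in any prescribed open subset of `D`
which meets the surface. -/
theorem IsNormalSurface.exists_disc (hS : IsNormalSurface S n) {p : E3} (hp : p ∈ S) :
    ∃ D : Set E3, IsOpen D ∧ p ∈ D ∧ ∀ W, IsOpen W → (W ∩ D ∩ S).Nonempty →
      ∃ Θ : E3 → E3 [⋀^Fin 2]→L[ℝ] ℝ, ContDiff ℝ ∞ Θ ∧ tsupport Θ ⊆ W ∩ D ∧
        ∀ θ : E3 → E3 [⋀^Fin 2]→L[ℝ] ℝ, ContDiff ℝ ∞ θ → tsupport θ ⊆ D →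
          ∃ (c : ℝ) (η : E3 → E3 [⋀^Fin 1]→L[ℝ] ℝ), ContDiff ℝ ∞ η ∧
            SurfEq S n θ (c • Θ + extDeriv η) := by
  obtain ⟨P₀, O₀, V, ψ₀, m, hpV, h₀⟩ := hS.exists_patch p hp
  let e : E2 ≃L[ℝ] ℝ × ℝ :=
    (EuclideanSpace.equiv (Fin 2) ℝ).trans (ContinuousLinearEquiv.finTwoArrow ℝ ℝ)
  obtain ⟨P, O, ψ, h⟩ : ∃ (P : E3 →L[ℝ] ℝ × ℝ) (O : Set (ℝ × ℝ)) (ψ : ℝ × ℝ → E3),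
    IsGraphPatch S n P O V ψ m := ⟨_, _, _, h₀.transport e⟩
  have hO := h.proj_mem p hpV
  obtain ⟨r, hr, hrO⟩ := Metric.nhds_basis_closedBall.mem_iff.1 (h.isOpen_O.mem_nhds hO)
  obtain ⟨x, y, hxy⟩ : ∃ x y, P p = (x, y) := ⟨_, _, rfl⟩
  rw [hxy, ← closedBall_prod_same, Real.closedBall_eq_Icc, Real.closedBall_eq_Icc] at hrO
  have h₁ : x - r < x + r := by linarith
  have h₂ : y - r < y + r := by linarith
  refine ⟨V ∩ P ⁻¹' (Ioo (x - r) (x + r) ×ˢ Ioo (y - r) (y + r)),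
    h.isOpen_V.inter ((isOpen_Ioo.prod isOpen_Ioo).preimage P.continuous),
    ⟨hpV, by rw [mem_preimage, hxy]; constructor <;> constructor <;> simp [hr]⟩, ?_⟩
  rintro W hW ⟨q, ⟨hqW, hqV, hqQ⟩, hqS⟩
  obtain ⟨Θ, hΘ, hΘs, hΘi⟩ := h.exists_bump hS hS.smooth h₁ h₂ hrO hW hqS hqW hqV hqQ
  refine ⟨Θ, hΘ, hΘs, fun θ hθ hθs => ?_⟩
  set IΘ := ∫ x in (x - r)..(x + r), ∫ y in (y - r)..(y + r), planeCoeff ψ O Θ (x, y) with hIΘ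
  set Iθ := ∫ x in (x - r)..(x + r), ∫ y in (y - r)..(y + r), planeCoeff ψ O θ (x, y) with hIθ
  have hR : IsClosed (Icc (x - r) (x + r) ×ˢ Icc (y - r) (y + r)) := isClosed_Icc.prod isClosed_Icc
  have hQR : Ioo (x - r) (x + r) ×ˢ Ioo (y - r) (y + r) ⊆
    Icc (x - r) (x + r) ×ˢ Icc (y - r) (y + r) :=
    prod_mono Ioo_subset_Icc_self Ioo_subset_Icc_self
  have hc1 := h.contDiff_planeCoeff hR hQR hrO hθ hθs
  have hc2 := h.contDiff_planeCoeff hR hQR hrO hΘ (hΘs.trans inter_subset_right)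
  have hts : tsupport (θ + (-(Iθ / IΘ)) • Θ) ⊆
      V ∩ P ⁻¹' (Ioo (x - r) (x + r) ×ˢ Ioo (y - r) (y + r)) := by
    refine (tsupport_add _ _).trans (union_subset hθs ?_)
    exact (closure_mono (Function.support_const_smul_subset _ _)).trans
      (hΘs.trans inter_subset_right)
  -- Subtracting the multiple of Θ given by the ratio of the integrals leaves a form of integral
  -- zero, which the planar Poincaré lemma makes exact.
  obtain ⟨η, hη, hηeq⟩ := h.exists_primitive h₁ h₂ hrO (θ := θ + (-(Iθ / IΘ)) • Θ)
    (hθ.add (ContDiff.smul (f := fun _ => -(Iθ / IΘ)) contDiff_const hΘ)) hts (by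
      have hin : ∀ (f : ℝ × ℝ → ℝ), ContDiff ℝ ∞ f → ∀ x, Continuous fun y => f (x, y) :=
        fun f hf x => hf.continuous.comp (continuous_const.prodMk continuous_id)
      have e1 : ∀ x', ∫ y in (y - r)..(y + r), planeCoeff ψ O (θ + (-(Iθ / IΘ)) • Θ) (x', y)
          = (∫ y in (y - r)..(y + r), planeCoeff ψ O θ (x', y)) +
            (-(Iθ / IΘ)) * ∫ y in (y - r)..(y + r), planeCoeff ψ O Θ (x', y) := by
        intro x'
        simp only [planeCoeff_add_smul]
        rw [intervalIntegral.integral_add ((hin _ hc1 _).intervalIntegrable _ _)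
          (((hin _ hc2 _).const_mul _).intervalIntegrable _ _),
          intervalIntegral.integral_const_mul]
      simp only [e1]
      rw [intervalIntegral.integral_add
        ((ContDiff.intervalIntegral hc1 _ _).continuous.intervalIntegrable _ _)
        (((ContDiff.intervalIntegral hc2 _ _).continuous.const_mul _).intervalIntegrable _ _),
        intervalIntegral.integral_const_mul, ← hIθ, ← hIΘ]
      field_simp
      ring)
  refine ⟨Iθ / IΘ, η, hη, fun q hq v hv => ?_⟩
  have := hηeq q hq v hv
  simp only [Pi.add_apply, Pi.smul_apply, ContinuousAlternatingMap.add_apply,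
    ContinuousAlternatingMap.smul_apply, smul_eq_mul] at this ⊢
  rw [← this]
  ring

end DiscLemma

/-! ### A defining function of the surface -/

section DefiningFunction

variable {S : Set E3} {n : E3 → E3}

/-- Take h = χ · ⟨n(x), x - ψ(P x)⟩. On S the second factor of the inner product vanishes and the
differential of ψ is tangent, so dh(v) = χ ⟨n, v⟩ and κ = χ. -/
theorem IsNormalSurface.exists_local_defining_function (hS : IsNormalSurface S n) {p : E3}
    (hp : p ∈ S) :
    ∃ h κ : E3 → ℝ, ContDiff ℝ ∞ h ∧ Continuous κ ∧ (∀ q ∈ S, h q = 0) ∧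
      (∀ q ∈ S, ∀ v, fderiv ℝ h q v = κ q * inner ℝ (n q) v) ∧ (∀ x, 0 ≤ κ x) ∧ 0 < κ p := by
  obtain ⟨P, O, V, ψ, m, hpV, hp'⟩ := hS.exists_patch p hp
  obtain ⟨χ, hχ, hχ1, hχV, -, hχ0⟩ := exists_contDiff_cutoff (isCompact_singleton (x := p))
    hp'.isOpen_V (singleton_subset_iff.2 hpV)
  set g : E3 → ℝ := fun x => inner ℝ (n x) (x - ψ (P x)) with hg
  have hψP : ContDiffOn ℝ ∞ (fun x => ψ (P x)) V :=
    hp'.smooth.comp P.contDiff.contDiffOn fun x hx => hp'.proj_mem x hx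
  have hgs : ContDiffOn ℝ ∞ g V := hS.smooth.contDiffOn.inner ℝ (contDiffOn_id.sub hψP)
  have hz : ∀ x, x ∉ V → (fun x => χ x * g x) =ᶠ[𝓝 x] fun _ => 0 := by
    intro x hx
    filter_upwards [notMem_tsupport_iff_eventuallyEq.1 fun hx' => hx (hχV hx')] with y hy
    simp [hy]
  refine ⟨fun x => χ x * g x, χ, ?_, hχ.continuous, fun q hq => ?_, fun q hq v => ?_, hχ0, ?_⟩
  · rw [contDiff_iff_contDiffAt]
    intro x
    by_cases hx : x ∈ V
    · exact hχ.contDiffAt.mul (hgs.contDiffAt (hp'.isOpen_V.mem_nhds hx))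
    · exact contDiffAt_const.congr_of_eventuallyEq (hz x hx)
  · by_cases hqV : q ∈ V
    · simp [hg, hp'.param_proj q ⟨hq, hqV⟩]
    · exact (hz q hqV).self_of_nhds
  · by_cases hqV : q ∈ V
    · have hO := hp'.proj_mem q hqV
      have hpq := hp'.param_proj q ⟨hq, hqV⟩
      have hg0 : g q = 0 := by simp [hg, hpq]
      have d1 : HasFDerivAt χ (fderiv ℝ χ q) q :=
        (hχ.differentiable (by simp) q).hasFDerivAt
      have d2 : HasFDerivAt n (fderiv ℝ n q) q :=
        (hS.smooth.differentiable (by simp) q).hasFDerivAt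
      have d3 : HasFDerivAt (fun x => x - ψ (P x))
          (ContinuousLinearMap.id ℝ E3 - fderiv ℝ ψ (P q) ∘L P) q :=
        (hasFDerivAt_id q).sub ((hp'.hasFDerivAt hO).comp q P.hasFDerivAt)
      have d4 := d1.mul (d2.inner ℝ d3)
      have d5 := congrArg (fun L => L v) d4.fderiv
      simp only [Pi.mul_def] at d5
      refine d5.trans ?_
      have h1 := hp'.orthogonal (P q) hO (P v)
      rw [hpq] at h1
      simp [hpq, inner_sub_right, h1]
    · have hq0 : χ q = 0 := by
        by_contra hne
        exact hqV (hχV (subset_tsupport χ hne))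
      rw [(hz q hqV).fderiv_eq, hq0]
      simp
  · rw [hχ1 p rfl]; exact one_pos

/-- A finite sum of local functions works: their gradients along S are nonnegative multiples of the
same field n, so nothing cancels. -/
theorem IsNormalSurface.exists_defining_function (hS : IsNormalSurface S n) :
    ∃ h κ : E3 → ℝ, ContDiff ℝ ∞ h ∧ (∀ q ∈ S, h q = 0) ∧
      (∀ q ∈ S, ∀ v, fderiv ℝ h q v = κ q * inner ℝ (n q) v) ∧ ∀ q ∈ S, 0 < κ q := by
  choose! h κ h1 h2 h3 h4 h5 h6 using fun p (hp : p ∈ S) => hS.exists_local_defining_function hp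
  obtain ⟨t, htS, ht⟩ := hS.isCompact.elim_nhds_subcover (fun p => {x | 0 < κ p x})
    fun p hp => (isOpen_lt continuous_const (h2 p hp)).mem_nhds (h6 p hp)
  refine ⟨fun x => ∑ p ∈ t, h p x, fun x => ∑ p ∈ t, κ p x, ?_, fun q hq => ?_,
    fun q hq v => ?_, fun q hq => ?_⟩
  · exact ContDiff.sum fun p hp => h1 p (htS p hp)
  · exact Finset.sum_eq_zero fun p hp => h3 p (htS p hp) q hq
  · rw [fderiv_fun_sum fun p hp => (h1 p (htS p hp)).differentiable (by simp) q]
    rw [Finset.sum_mul, sum_apply]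
    exact Finset.sum_congr rfl fun p hp => h4 p (htS p hp) q hq v
  · obtain ⟨p, hp, hpq⟩ := mem_iUnion₂.1 (ht hq)
    exact Finset.sum_pos' (fun p hp => h5 p (htS p hp) q) ⟨p, hp, hpq⟩

/-- A point x near p and the surface point q = ψ(P x) differ by a multiple of m. The derivative of h
in the direction m is positive near p, so by Rolle's theorem h cannot vanish at both unless x = q.
-/
theorem IsNormalSurface.eventually_mem_of_eq_zero (hS : IsNormalSurface S n) {h κ : E3 → ℝ}
    (hh : ContDiff ℝ ∞ h) (h0 : ∀ q ∈ S, h q = 0)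
    (hd : ∀ q ∈ S, ∀ v, fderiv ℝ h q v = κ q * inner ℝ (n q) v) (hκ : ∀ q ∈ S, 0 < κ q)
    {p : E3} (hp : p ∈ S) : ∀ᶠ x in 𝓝 p, h x = 0 → x ∈ S := by
  obtain ⟨P, O, V, ψ, m, hpV, hp'⟩ := hS.exists_patch p hp
  have hdc : Continuous fun x => fderiv ℝ h x m := (hh.continuous_fderiv (by simp)).clm_apply
    continuous_const
  have hpos : 0 < fderiv ℝ h p m := by
    rw [hd p hp]
    exact mul_pos (hκ p hp) (hp'.inner_pos p ⟨hp, hpV⟩)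
  obtain ⟨r, hr, hball⟩ := Metric.isOpen_iff.1 (isOpen_lt continuous_const hdc) p hpos
  have hψc : ContinuousAt (fun x => ψ (P x)) p :=
    (hp'.hasFDerivAt (hp'.proj_mem p hpV)).continuousAt.comp P.continuous.continuousAt
  have hψb : ∀ᶠ x in 𝓝 p, ψ (P x) ∈ Metric.ball p r := by
    refine hψc.eventually ?_
    change Metric.ball p r ∈ 𝓝 (ψ (P p))
    rw [hp'.param_proj p ⟨hp, hpV⟩]
    exact Metric.ball_mem_nhds p hr
  filter_upwards [hψb, Metric.ball_mem_nhds p hr, hp'.isOpen_V.mem_nhds hpV] with x hx1 hx2 hx3 hx0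
  have hO := hp'.proj_mem x hx3
  set q := ψ (P x) with hq
  have hqS : q ∈ S := (hp'.mem _ hO).1
  obtain ⟨c, hc⟩ := hp'.ker (x - q) (by rw [map_sub, hq, hp'.proj _ hO, sub_self])
  have hxc : x = q + c • m := by rw [← hc]; abel
  by_cases hc0 : c = 0
  · rw [hxc, hc0, zero_smul, add_zero]; exact hqS
  exfalso
  have hline : ∀ t : ℝ, HasDerivAt (fun t : ℝ => h (q + (t * c) • m))
      (c * fderiv ℝ h (q + (t * c) • m) m) t := by
    intro t
    have e1 : HasDerivAt (fun t : ℝ => q + (t * c) • m) (c • m) t := by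
      simpa using (((hasDerivAt_id t).mul_const c).smul_const m).const_add q
    have e2 := ((hh.differentiable (by simp) (q + (t * c) • m)).hasFDerivAt).comp_hasDerivAt t e1
    rw [map_smul, smul_eq_mul] at e2
    exact e2
  obtain ⟨t, ht, ht0⟩ := exists_hasDerivAt_eq_zero (f := fun t : ℝ => h (q + (t * c) • m))
    (a := 0) (b := 1) one_pos
    (fun t _ => (hline t).continuousAt.continuousWithinAt)
    (by simp [← hxc, hx0, h0 q hqS]) (fun t _ => hline t)
  have hmem : q + (t * c) • m ∈ Metric.ball p r := by
    have e : q + (t * c) • m = (1 - t) • q + t • x := by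
      rw [hxc]; module
    rw [e]
    exact (convex_ball p r) hx1 hx2 (by linarith [ht.2]) ht.1.le (by ring)
  rcases mul_eq_zero.1 ht0 with h' | h'
  · exact hc0 h'
  · exact (hball hmem).ne' h'

end DefiningFunction

/-! ### The area form is not exact -/

section Stokes

open MeasureTheory

theorem integral_fderiv_apply_eq_zero {F : Type*} [NormedAddCommGroup F] [NormedSpace ℝ F]
    [FiniteDimensional ℝ F] [MeasurableSpace F] [BorelSpace F] (μ : Measure F)
    [μ.IsAddHaarMeasure] {f : F → ℝ} (hf : ContDiff ℝ 1 f) (hc : HasCompactSupport f) (v : F) :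
    ∫ x, fderiv ℝ f x v ∂μ = 0 := by
  have hc' : HasCompactSupport fun x => fderiv ℝ f x v := hc.fderiv_apply (𝕜 := ℝ) v
  have hcont : Continuous fun x => fderiv ℝ f x v :=
    (hf.continuous_fderiv one_ne_zero).clm_apply continuous_const
  have := integral_mul_fderiv_eq_neg_fderiv_mul_of_integrable (μ := μ) (f := fun _ : F => (1 : ℝ))
    (g := f) (v := v) (by simp) (by simpa using hcont.integrable_of_hasCompactSupport hc')
    (by simpa using hf.continuous.integrable_of_hasCompactSupport hc) (fun _ _ => by fun_prop)
    (fun x _ => hf.differentiable one_ne_zero x)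
  simpa using this

/-- The standard basis vectors of `ℝ³`. -/
noncomputable abbrev stdVec (i : Fin 3) : E3 := EuclideanSpace.single i 1

/-- Every `2`-form on `ℝ³` is the contraction of the volume form with a vector. -/
theorem eq_volContract (B : E3 [⋀^Fin 2]→L[ℝ] ℝ) :
    B = volContract !₂[B ![stdVec 1, stdVec 2], B ![stdVec 2, stdVec 0],
      B ![stdVec 0, stdVec 1]] := by
  have hsw : ∀ i j : Fin 3, B ![stdVec i, stdVec j] = - B ![stdVec j, stdVec i] := by
    intro i j
    have := B.toAlternatingMap.map_swap ![stdVec i, stdVec j] (i := 0) (j := 1) (by simp)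
    rw [← neg_eq_iff_eq_neg] at this
    rw [← B.coe_toAlternatingMap, ← this]
    congr 2
    ext a; fin_cases a <;> simp
  have hdiag : ∀ i : Fin 3, B ![stdVec i, stdVec i] = 0 := fun i =>
    B.map_eq_zero_of_eq _ (i := 0) (j := 1) (by simp) (by simp)
  apply ContinuousAlternatingMap.toAlternatingMap_injective
  refine Module.Basis.ext_alternating (EuclideanSpace.basisFun (Fin 3) ℝ).toBasis fun σ _ => ?_
  have hσ : (fun i => (EuclideanSpace.basisFun (Fin 3) ℝ).toBasis (σ i))
      = ![stdVec (σ 0), stdVec (σ 1)] := by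
    funext i; fin_cases i <;> simp
  rw [hσ]
  simp only [ContinuousAlternatingMap.coe_toAlternatingMap]
  generalize σ 0 = i
  generalize σ 1 = j
  rw [volContract_apply, vol3_eq]
  fin_cases i <;> fin_cases j <;> simp [hdiag]
  · exact hsw 0 2
  · exact hsw 1 0
  · exact hsw 2 1

variable {S : Set E3} {n : E3 → E3}

/-- The function c is b ∘ h, cut off to a compact neighbourhood L of S on which h vanishes only on
S. The bump b is supported in (-ε, ε) while |h| > ε on the boundary of L, so the cutoff is smooth.
The point of this form is that dc is proportional to dh. -/
theorem IsNormalSurface.exists_localized_defining_function (hS : IsNormalSurface S n)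
    {h κ : E3 → ℝ} (hh : ContDiff ℝ ∞ h) (h0 : ∀ q ∈ S, h q = 0)
    (hd : ∀ q ∈ S, ∀ v, fderiv ℝ h q v = κ q * inner ℝ (n q) v) (hκ : ∀ q ∈ S, 0 < κ q)
    {W : Set E3} (hW : IsOpen W) (hSW : S ⊆ W) :
    ∃ c : E3 → ℝ, ContDiff ℝ ∞ c ∧ HasCompactSupport c ∧ (∀ x, 0 ≤ c x) ∧
      (∀ x, c x ≠ 0 → x ∈ W) ∧ (∀ q ∈ S, c q = 1) ∧
      ∀ x, ∃ l : ℝ, ∀ v, fderiv ℝ c x v = l * fderiv ℝ h x v := by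
  set W' := W ∩ interior {x | h x = 0 → x ∈ S} with hW'
  obtain ⟨L, hL, hSL, hLW⟩ := exists_compact_between hS.isCompact (hW.inter isOpen_interior)
    (U := W') fun p hp => ⟨hSW hp, mem_interior_iff_mem_nhds.2
      (hS.eventually_mem_of_eq_zero hh h0 hd hκ hp)⟩
  have hbd : ∀ x ∈ L \ interior L, 0 < |h x| := fun x hx =>
    abs_pos.2 fun hx0 => hx.2 (hSL (interior_subset (hLW hx.1).2 hx0))
  obtain ⟨ε, hε, hεL⟩ : ∃ ε > 0, ∀ x ∈ L \ interior L, ε < |h x| := by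
    have hcomp : IsCompact (L \ interior L) := hL.diff isOpen_interior
    rcases (L \ interior L).eq_empty_or_nonempty with he | hne
    · exact ⟨1, one_pos, by simp [he]⟩
    · obtain ⟨x0, hx0, hmin⟩ := hcomp.exists_isMinOn hne hh.continuous.abs.continuousOn
      refine ⟨|h x0| / 2, half_pos (hbd _ hx0), fun x hx => ?_⟩
      have h1 := hmin hx
      have h2 := hbd _ hx0
      simp only [mem_ofPred_eq] at h1
      linarith
  obtain ⟨b, hb, hb1, hbV, -, hb0⟩ := exists_contDiff_cutoff (isCompact_singleton (x := (0 : ℝ)))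
    (isOpen_Ioo (a := -ε) (b := ε)) (by simp [hε])
  classical
  have hin : ∀ x ∈ interior L, (L.indicator fun x => b (h x)) =ᶠ[𝓝 x] fun x => b (h x) := by
    intro x hx
    filter_upwards [isOpen_interior.mem_nhds hx] with y hy
    simp [interior_subset hy]
  have hout : ∀ x, x ∉ interior L → (L.indicator fun x => b (h x)) =ᶠ[𝓝 x] fun _ => 0 := by
    intro x hx
    by_cases hxL : x ∈ L
    · filter_upwards [(isOpen_lt continuous_const hh.continuous.abs).mem_nhds
        (hεL x ⟨hxL, hx⟩)] with y hy
      have hby : b (h y) = 0 := by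
        by_contra hne
        have := hbV (subset_tsupport b hne)
        exact absurd (abs_lt.2 this) (not_lt.2 (le_of_lt hy))
      by_cases hyL : y ∈ L <;> simp [hyL, hby]
    · filter_upwards [hL.isClosed.isOpen_compl.mem_nhds hxL] with y hy
      simp [show y ∉ L from hy]
  refine ⟨L.indicator fun x => b (h x), ?_, ?_, fun x => indicator_nonneg (fun _ _ => hb0 _) _,
    fun x hx => ?_, fun q hq => ?_, fun x => ?_⟩
  · rw [contDiff_iff_contDiffAt]
    intro x
    by_cases hx : x ∈ interior L
    · exact (hb.comp hh).contDiffAt.congr_of_eventuallyEq (hin x hx)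
    · exact contDiffAt_const.congr_of_eventuallyEq (hout x hx)
  · exact HasCompactSupport.of_support_subset_isCompact hL support_indicator_subset
  · exact (hLW (mem_of_indicator_ne_zero hx)).1
  · rw [indicator_of_mem (interior_subset (hSL hq)), h0 q hq, hb1 0 rfl]
  · by_cases hx : x ∈ interior L
    · refine ⟨deriv b (h x), fun v => ?_⟩
      rw [(hin x hx).fderiv_eq]
      have := ((hb.differentiable (by simp) (h x)).hasDerivAt.comp_hasFDerivAt x
        (hh.differentiable (by simp) x).hasFDerivAt).fderiv
      simp only [Function.comp_def] at this
      rw [this]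
      simp
    · refine ⟨0, fun v => ?_⟩
      rw [(hout x hx).fderiv_eq]
      simp

/-- The area form of a compact surface is not exact. -/
theorem IsNormalSurface.not_surfEq_extDeriv (hS : IsNormalSurface S n)
    {η : E3 → E3 [⋀^Fin 1]→L[ℝ] ℝ} (hη : ContDiff ℝ ∞ η) :
    ¬ SurfEq S n (fun x => volContract (n x)) (extDeriv η) := by
  intro heq
  obtain ⟨h, κ, hh, h0, hd, hκ⟩ := hS.exists_defining_function
  -- Stokes' theorem on S is replaced by the divergence theorem on ℝ³. In vector notation y is the
  -- field of η, k = ∇h, C = curl y and Φ = ⟨C, ∇h⟩. If dη were the area form on S, then ⟨C, n⟩ = 1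
  -- and Φ = κ > 0 there, so ∫ c Φ > 0.
  set y : Fin 3 → E3 → ℝ := fun j x => η x ![stdVec j] with hy
  set k : Fin 3 → E3 → ℝ := fun j x => fderiv ℝ h x (stdVec j) with hk
  set C : E3 → E3 := fun x => !₂[extDeriv η x ![stdVec 1, stdVec 2],
    extDeriv η x ![stdVec 2, stdVec 0], extDeriv η x ![stdVec 0, stdVec 1]] with hC
  set Φ : E3 → ℝ := fun x => C x 0 * k 0 x + C x 1 * k 1 x + C x 2 * k 2 x with hΦ
  have hdη := ContDiff.extDeriv hη
  have hCs : ∀ i, Continuous fun x => C x i := by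
    have := fun v : Fin 2 → E3 => (hdη.alternating_apply (contDiff_const (c := v))).continuous
    intro i
    fin_cases i
    · exact this _
    · exact this _
    · exact this _
  have hys : ∀ j, ContDiff ℝ ∞ (y j) := fun j => hη.alternating_apply contDiff_const
  have hks : ∀ j, ContDiff ℝ ∞ (k j) := fun j => (hh.fderiv_right (by simp)).clm_apply
    contDiff_const
  have hΦc : Continuous Φ :=
    ((((hCs 0).mul (hks 0).continuous).add ((hCs 1).mul (hks 1).continuous)).add
      ((hCs 2).mul (hks 2).continuous))
  have hΦS : ∀ q ∈ S, 0 < Φ q := by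
    intro q hq
    have e1 : Φ q = κ q * inner ℝ (C q) (n q) := by
      simp only [hΦ, hk, hd q hq, inner_E3]
      simp
      ring
    obtain ⟨v, w, hv, hw, r, hr, hvw⟩ := exists_orthogonal_frame (hS.norm_eq_one q hq)
    have e2 := heq q hq ![v, w] (by intro i; fin_cases i <;> simp [hv, hw])
    rw [eq_volContract (extDeriv η q)] at e2
    simp only [volContract_apply, Matrix.cons_val_zero, Matrix.cons_val_one] at e2
    rw [hvw, hvw] at e2
    have e3 := mul_left_cancel₀ hr e2
    rw [real_inner_self_eq_norm_sq, hS.norm_eq_one q hq] at e3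
    have e4 : inner ℝ (C q) (n q) = (1 : ℝ) := by rw [hC]; simp only; rw [← e3]; norm_num
    rw [e1, e4, mul_one]
    exact hκ q hq
  obtain ⟨c, hc, hcc, hc0, hcW, hcS, hcd⟩ := hS.exists_localized_defining_function hh h0 hd hκ
    (isOpen_lt continuous_const hΦc) (fun q hq => hΦS q hq)
  have hpos : 0 < ∫ x, c x * Φ x := by
    obtain ⟨q, hq⟩ := hS.isConnected.nonempty
    refine (hc.continuous.mul hΦc).integral_pos_of_hasCompactSupport_nonneg_nonzero hcc.mul_right
      (fun x => ?_) (x := q) ?_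
    · by_cases hx : c x = 0
      · simp [hx]
      · exact mul_nonneg (hc0 x) (le_of_lt (hcW x hx))
    · rw [hcS q hq, one_mul]
      exact (hΦS q hq).ne'
  -- X = c (y × ∇h) has compact support and divergence c Φ: the term ⟨∇c, y × ∇h⟩ vanishes because
  -- ∇c is parallel to ∇h, and curl ∇h = 0. Therefore ∫ c Φ = 0, a contradiction.
  set X : Fin 3 → E3 → ℝ := ![fun x => c x * (y 1 x * k 2 x - y 2 x * k 1 x),
    fun x => c x * (y 2 x * k 0 x - y 0 x * k 2 x),
    fun x => c x * (y 0 x * k 1 x - y 1 x * k 0 x)] with hX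
  have hXs : ∀ i, ContDiff ℝ ∞ (X i) := by
    intro i
    fin_cases i
    · exact hc.mul (((hys 1).mul (hks 2)).sub ((hys 2).mul (hks 1)))
    · exact hc.mul (((hys 2).mul (hks 0)).sub ((hys 0).mul (hks 2)))
    · exact hc.mul (((hys 0).mul (hks 1)).sub ((hys 1).mul (hks 0)))
  have hXc : ∀ i, HasCompactSupport (X i) := by
    intro i
    fin_cases i
    · exact hcc.mul_right
    · exact hcc.mul_right
    · exact hcc.mul_right
  have hdiv : ∀ x, c x * Φ x = fderiv ℝ (X 0) x (stdVec 0) + fderiv ℝ (X 1) x (stdVec 1)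
      + fderiv ℝ (X 2) x (stdVec 2) := by
    intro x
    obtain ⟨l, hl⟩ := hcd x
    have dc : HasFDerivAt c (fderiv ℝ c x) x := (hc.differentiable (by simp) x).hasFDerivAt
    have dy : ∀ j, HasFDerivAt (y j) (fderiv ℝ (y j) x) x := fun j =>
      ((hys j).differentiable (by simp) x).hasFDerivAt
    have dk : ∀ j, HasFDerivAt (k j) (fderiv ℝ (k j) x) x := fun j =>
      ((hks j).differentiable (by simp) x).hasFDerivAt
    have f0 := (dc.mul (((dy 1).mul (dk 2)).sub ((dy 2).mul (dk 1)))).fderiv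
    have f1 := (dc.mul (((dy 2).mul (dk 0)).sub ((dy 0).mul (dk 2)))).fderiv
    have f2 := (dc.mul (((dy 0).mul (dk 1)).sub ((dy 1).mul (dk 0)))).fderiv
    have g0 : fderiv ℝ (X 0) x = _ := f0
    have g1 : fderiv ℝ (X 1) x = _ := f1
    have g2 : fderiv ℝ (X 2) x = _ := f2
    have hsymm : ∀ i j, fderiv ℝ (k j) x (stdVec i) = fderiv ℝ (k i) x (stdVec j) := by
      intro i j
      have hfd : DifferentiableAt ℝ (fderiv ℝ h) x :=
        (hh.fderiv_right (m := ∞) (by simp)).differentiable (by simp) x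
      have e : ∀ a b, fderiv ℝ (k b) x (stdVec a) = fderiv ℝ (fderiv ℝ h) x (stdVec a) (stdVec b) :=
        fun a b => by
          have := (hfd.hasFDerivAt.clm_apply (hasFDerivAt_const (stdVec b) x)).fderiv
          rw [hk]
          simp only
          rw [this]
          simp
      rw [e, e]
      refine (hh.contDiffAt.isSymmSndFDerivAt ?_) _ _
      rw [minSmoothness_of_isRCLikeNormedField]
      exact WithTop.coe_le_coe.2 le_top
    have hcurl : ∀ i j, extDeriv η x ![stdVec i, stdVec j]
        = fderiv ℝ (y j) x (stdVec i) - fderiv ℝ (y i) x (stdVec j) := by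
      intro i j
      have hηd := hη.differentiable (by simp) x
      rw [extDeriv_one_apply hηd, ← fderiv_continuousAlternatingMap_apply_const_apply hηd,
        ← fderiv_continuousAlternatingMap_apply_const_apply hηd]
    have hkl : ∀ i, fderiv ℝ c x (stdVec i) = l * k i x := fun i => hl _
    have c0 : C x 0 = fderiv ℝ (y 2) x (stdVec 1) - fderiv ℝ (y 1) x (stdVec 2) := hcurl 1 2
    have c1 : C x 1 = fderiv ℝ (y 0) x (stdVec 2) - fderiv ℝ (y 2) x (stdVec 0) := hcurl 2 0
    have c2 : C x 2 = fderiv ℝ (y 1) x (stdVec 0) - fderiv ℝ (y 0) x (stdVec 1) := hcurl 0 1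
    rw [g0, g1, g2]
    simp only [add_apply, sub_apply,
      smul_apply, smul_eq_mul, hkl, hΦ, c0, c1, c2, Pi.sub_apply, Pi.mul_apply,
      hsymm 1 0, hsymm 2 0, hsymm 2 1]
    ring
  have hint : ∀ i v, Integrable fun x => fderiv ℝ (X i) x v := fun i v =>
    (((hXs i).continuous_fderiv (by simp)).clm_apply
      continuous_const).integrable_of_hasCompactSupport ((hXc i).fderiv_apply (𝕜 := ℝ) v)
  have hzero : ∫ x, c x * Φ x = 0 := by
    simp only [hdiv]
    rw [integral_add (f := fun x => fderiv ℝ (X 0) x (stdVec 0) + fderiv ℝ (X 1) x (stdVec 1))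
      ((hint 0 _).add (hint 1 _)) (hint 2 _), integral_add (hint 0 _) (hint 1 _),
      integral_fderiv_apply_eq_zero _ ((hXs 0).of_le (by simp)) (hXc 0),
      integral_fderiv_apply_eq_zero _ ((hXs 1).of_le (by simp)) (hXc 1),
      integral_fderiv_apply_eq_zero _ ((hXs 2).of_le (by simp)) (hXc 2)]
    simp
  exact hpos.ne' hzero

end Stokes

/-! ### The second cohomology of the surface -/

section TopCohomology

variable {S : Set E3} {n : E3 → E3}

/-- On `S`, the form `θ` is the sum of a multiple of `Θ` and of an exact form. -/
def IsMultipleModExact (S : Set E3) (n : E3 → E3) (Θ θ : E3 → E3 [⋀^Fin 2]→L[ℝ] ℝ) : Prop :=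
  ∃ (c : ℝ) (η : E3 → E3 [⋀^Fin 1]→L[ℝ] ℝ), ContDiff ℝ ∞ η ∧ SurfEq S n θ (c • Θ + extDeriv η)

variable {Θ Θ' θ θ' : E3 → E3 [⋀^Fin 2]→L[ℝ] ℝ}

theorem IsMultipleModExact.congr (h : IsMultipleModExact S n Θ θ) (h' : SurfEq S n θ' θ) :
    IsMultipleModExact S n Θ θ' := by
  obtain ⟨c, η, hη, h⟩ := h
  exact ⟨c, η, hη, h'.trans h⟩

theorem IsMultipleModExact.zero : IsMultipleModExact S n Θ 0 :=
  ⟨0, fun _ => 0, contDiff_const, fun q _ v _ => by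
    simp [extDeriv, ContinuousAlternatingMap.alternatizeUncurryFin_apply]⟩

theorem IsMultipleModExact.add (h : IsMultipleModExact S n Θ θ)
    (h' : IsMultipleModExact S n Θ θ') : IsMultipleModExact S n Θ (θ + θ') := by
  obtain ⟨c, η, hη, h⟩ := h
  obtain ⟨c', η', hη', h'⟩ := h'
  refine ⟨c + c', η + η', hη.add hη', fun q hq v hv => ?_⟩
  have e := extDeriv_add (hη.differentiable (by simp) q) (hη'.differentiable (by simp) q)
  have e1 := h q hq v hv
  have e2 := h' q hq v hv
  simp only [Pi.add_apply, Pi.smul_apply, ContinuousAlternatingMap.add_apply,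
    ContinuousAlternatingMap.smul_apply, smul_eq_mul, e] at e1 e2 ⊢
  rw [e1, e2]
  ring

theorem IsMultipleModExact.trans (h : IsMultipleModExact S n Θ' θ)
    (h' : IsMultipleModExact S n Θ Θ') : IsMultipleModExact S n Θ θ := by
  obtain ⟨c, η, hη, h⟩ := h
  obtain ⟨c', η', hη', h'⟩ := h'
  refine ⟨c * c', c • η' + η, ContDiff.add (ContDiff.smul (f := fun _ => c) contDiff_const hη') hη,
    fun q hq v hv => ?_⟩
  have e := extDeriv_add (ω₁ := c • η') (ω₂ := η)
    ((hη'.differentiable (by simp) q).const_smul c) (hη.differentiable (by simp) q)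
  have e' := extDeriv_smul c η' (x := q)
  have e1 := h q hq v hv
  have e2 := h' q hq v hv
  simp only [Pi.add_apply, Pi.smul_apply, ContinuousAlternatingMap.add_apply,
    ContinuousAlternatingMap.smul_apply, smul_eq_mul, e, e'] at e1 e2 ⊢
  rw [e1, e2]
  ring

theorem IsMultipleModExact.sum {ι : Type*} (t : Finset ι) {f : ι → E3 → E3 [⋀^Fin 2]→L[ℝ] ℝ}
    (h : ∀ i ∈ t, IsMultipleModExact S n Θ (f i)) : IsMultipleModExact S n Θ (∑ i ∈ t, f i) := by
  classical
  induction t using Finset.induction_on with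
  | empty => simpa using IsMultipleModExact.zero
  | insert i t hi ih =>
    rw [Finset.sum_insert hi]
    exact (h i (Finset.mem_insert_self i t)).add
      (ih fun j hj => h j (Finset.mem_insert_of_mem hj))

/-- Connectedness of S propagates a generator from one disc to all others: the set of points having
a neighbourhood in which every 2-form is a multiple of Θ modulo exact forms is open and relatively
closed in S. -/
theorem IsNormalSurface.exists_generator (hS : IsNormalSurface S n) :
    ∃ Θ : E3 → E3 [⋀^Fin 2]→L[ℝ] ℝ, ∀ p ∈ S, ∃ D, IsOpen D ∧ p ∈ D ∧
      ∀ θ : E3 → E3 [⋀^Fin 2]→L[ℝ] ℝ, ContDiff ℝ ∞ θ → tsupport θ ⊆ D →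
        IsMultipleModExact S n Θ θ := by
  obtain ⟨p₀, hp₀⟩ := hS.isConnected.nonempty
  obtain ⟨D₀, hD₀, hpD₀, hdisc₀⟩ := hS.exists_disc hp₀
  obtain ⟨Θ, -, -, hΘ⟩ := hdisc₀ univ isOpen_univ ⟨p₀, ⟨trivial, hpD₀⟩, hp₀⟩
  refine ⟨Θ, ?_⟩
  set good : E3 → Prop := fun p => ∃ D, IsOpen D ∧ p ∈ D ∧
      ∀ θ : E3 → E3 [⋀^Fin 2]→L[ℝ] ℝ, ContDiff ℝ ∞ θ → tsupport θ ⊆ D →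
        IsMultipleModExact S n Θ θ with hgood
  have hopen : IsOpen {p | good p} := by
    rw [isOpen_iff_mem_nhds]
    rintro p ⟨D, hD, hpD, h⟩
    filter_upwards [hD.mem_nhds hpD] with q hq using ⟨D, hD, hq, h⟩
  have hg₀ : good p₀ := ⟨D₀, hD₀, hpD₀, hΘ⟩
  have hclosed : ∀ p ∈ S, p ∈ closure (S ∩ {p | good p}) → good p := by
    intro p hp hpc
    obtain ⟨D, hD, hpD, hdisc⟩ := hS.exists_disc hp
    obtain ⟨q, hqD, hqS, D', hD', hqD', h'⟩ := mem_closure_iff.1 hpc D hD hpD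
    -- Forms in D reduce to a form Θ' supported in the overlap of D with the good disc D', and there
    -- Θ' reduces to Θ.
    obtain ⟨Θ', hΘ's, hΘ't, hΘ'⟩ := hdisc D' hD' ⟨q, ⟨hqD', hqD⟩, hqS⟩
    exact ⟨D, hD, hpD, fun θ hθ hθs => IsMultipleModExact.trans (hΘ' θ hθ hθs)
      (h' Θ' hΘ's (hΘ't.trans inter_subset_left))⟩
  intro p hp
  by_contra hpg
  have hpre := hS.isConnected.isPreconnected {p | good p} (closure (S ∩ {p | good p}))ᶜ hopen
    isClosed_closure.isOpen_compl (fun q hq => by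
      by_cases hqc : q ∈ closure (S ∩ {p | good p})
      · exact Or.inl (hclosed q hq hqc)
      · exact Or.inr hqc) ⟨p₀, hp₀, hg₀⟩ ⟨p, hp, fun hpc => hpg (hclosed p hp hpc)⟩
  obtain ⟨q, hqS, hqg, hqc⟩ := hpre
  exact hqc (subset_closure ⟨hqS, hqg⟩)

/-- The second cohomology of a compact connected surface is spanned by the area form. -/
theorem IsNormalSurface.isMultipleModExact_area (hS : IsNormalSurface S n) (hθ : ContDiff ℝ ∞ θ) :
    IsMultipleModExact S n (fun x => volContract (n x)) θ := by
  obtain ⟨Θ, hΘ⟩ := hS.exists_generator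
  -- A partition of unity along S splits θ into forms supported in good discs.
  have hall : ∀ θ : E3 → E3 [⋀^Fin 2]→L[ℝ] ℝ, ContDiff ℝ ∞ θ → IsMultipleModExact S n Θ θ := by
    intro θ hθ
    choose! D hD hpD h using hΘ
    obtain ⟨t, htS, ht⟩ := hS.isCompact.elim_nhds_subcover D fun p hp => (hD p hp).mem_nhds (hpD p hp)
    obtain ⟨f, hf⟩ := SmoothPartitionOfUnity.exists_isSubordinate 𝓘(ℝ, E3) hS.isCompact.isClosed
      (fun p : t => D p) (fun p => hD p (htS p p.2)) (fun x hx => by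
        obtain ⟨p, hp, hxp⟩ := mem_iUnion₂.1 (ht hx)
        exact mem_iUnion.2 ⟨⟨p, hp⟩, hxp⟩)
    refine (IsMultipleModExact.sum Finset.univ (f := fun p : t => fun x => f p x • θ x)
      fun p _ => h p (htS p p.2) _ ((f p).contMDiff.contDiff.smul hθ) ?_).congr ?_
    · have hsub : Function.support (fun x => f p x • θ x) ⊆ Function.support (f p) :=
        fun x hx hfx => hx (by simp [hfx])
      exact (closure_mono hsub).trans (hf p)
    · intro q hq v _
      have h1 := f.sum_eq_one hq
      rw [finsum_eq_sum_of_fintype] at h1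
      have h2 : (∑ p : t, fun x => f p x • θ x) q = (∑ p : t, f p q) • θ q := by
        rw [Finset.sum_apply, Finset.sum_smul]
      rw [h2, h1, one_smul]
  obtain ⟨a, η, hη, ha⟩ := hall _ (contDiff_volContract.comp hS.smooth)
  -- The area form is a Θ + dη on S, and a = 0 would make it exact. Solving for Θ then lets the area
  -- form replace Θ as generator.
  have ha0 : a ≠ 0 := by
    rintro rfl
    refine hS.not_surfEq_extDeriv hη fun q hq v hv => ?_
    simpa using ha q hq v hv
  refine (hall θ hθ).trans ⟨a⁻¹, (-a⁻¹) • η, ContDiff.smul (f := fun _ => -a⁻¹) contDiff_const hη,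
    fun q hq v hv => ?_⟩
  have e1 := ha q hq v hv
  have e2 := extDeriv_smul (-a⁻¹) η (x := q)
  simp only [Function.comp_apply, Pi.add_apply, Pi.smul_apply, ContinuousAlternatingMap.add_apply,
    ContinuousAlternatingMap.smul_apply, smul_eq_mul, e2] at e1 ⊢
  rw [e1]
  field_simp
  ring

end TopCohomology

/-! ### Averaging over translations -/

section Averaging

open MeasureTheory

variable {k : ℕ}

/-- The average of a form over the translations by `[-T, T] • e`. -/
noncomputable def averageAlong (e : Amb) (T : ℝ) (B : Amb → Amb [⋀^Fin k]→L[ℝ] ℝ) (y : Amb) :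
    Amb [⋀^Fin k]→L[ℝ] ℝ :=
  ∫ r in (0 : ℝ)..1, (1 / 2 : ℝ) • (B (y + (r * T) • e) + B (y - (r * T) • e))

/-- A primitive of the difference between the average of a closed form over the translations by
`[-T, T] • e` and the form itself. -/
noncomputable def averagePrimitive (e : Amb) (T : ℝ) (B : Amb → Amb [⋀^Fin (k + 1)]→L[ℝ] ℝ)
    (y : Amb) : Amb [⋀^Fin k]→L[ℝ] ℝ :=
  ∫ r in (0 : ℝ)..1, (T / 2 * (1 - r)) •
    ((B (y + (r * T) • e)).curryLeft e - (B (y - (r * T) • e)).curryLeft e)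

theorem contDiff_averageAlong_integrand (e : Amb) (T : ℝ) {B : Amb → Amb [⋀^Fin k]→L[ℝ] ℝ}
    (hB : ContDiff ℝ ∞ B) : ContDiff ℝ ∞ fun z : Amb × ℝ =>
      (1 / 2 : ℝ) • (B (z.1 + (z.2 * T) • e) + B (z.1 - (z.2 * T) • e)) :=
  ContDiff.smul (f := fun _ => (1 / 2 : ℝ)) contDiff_const
    ((hB.comp (f := fun z : Amb × ℝ => z.1 + (z.2 * T) • e) (by fun_prop)).add
      (hB.comp (f := fun z : Amb × ℝ => z.1 - (z.2 * T) • e) (by fun_prop)))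

theorem contDiff_averagePrimitive_integrand (e : Amb) (T : ℝ)
    {B : Amb → Amb [⋀^Fin (k + 1)]→L[ℝ] ℝ} (hB : ContDiff ℝ ∞ B) :
    ContDiff ℝ ∞ fun z : Amb × ℝ => (T / 2 * (1 - z.2)) •
      ((B (z.1 + (z.2 * T) • e)).curryLeft e - (B (z.1 - (z.2 * T) • e)).curryLeft e) := by
  have hc : ContDiff ℝ ∞ fun L : Amb [⋀^Fin (k + 1)]→L[ℝ] ℝ => L.curryLeft e :=
    (ContinuousAlternatingMap.curryLeftLI (𝕜 := ℝ) (E := Amb) (F := ℝ)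
      (n := k)).contDiff.clm_apply contDiff_const
  exact ContDiff.smul (f := fun z : Amb × ℝ => T / 2 * (1 - z.2)) (by fun_prop)
    ((hc.comp (hB.comp (f := fun z : Amb × ℝ => z.1 + (z.2 * T) • e) (by fun_prop))).sub
      (hc.comp (hB.comp (f := fun z : Amb × ℝ => z.1 - (z.2 * T) • e) (by fun_prop))))

theorem contDiff_averageAlong (e : Amb) (T : ℝ) {B : Amb → Amb [⋀^Fin k]→L[ℝ] ℝ}
    (hB : ContDiff ℝ ∞ B) : ContDiff ℝ ∞ (averageAlong e T B) :=
  ContDiff.intervalIntegral (contDiff_averageAlong_integrand e T hB) 0 1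

theorem contDiff_averagePrimitive (e : Amb) (T : ℝ) {B : Amb → Amb [⋀^Fin (k + 1)]→L[ℝ] ℝ}
    (hB : ContDiff ℝ ∞ B) : ContDiff ℝ ∞ (averagePrimitive e T B) :=
  ContDiff.intervalIntegral (contDiff_averagePrimitive_integrand e T hB) 0 1

theorem averageAlong_apply (e : Amb) (T : ℝ) {B : Amb → Amb [⋀^Fin k]→L[ℝ] ℝ}
    (hB : ContDiff ℝ ∞ B) (y : Amb) (v : Fin k → Amb) :
    averageAlong e T B y v =
      ∫ r in (0 : ℝ)..1, (1 / 2 : ℝ) * (B (y + (r * T) • e) v + B (y - (r * T) • e) v) := by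
  have hc := ((contDiff_averageAlong_integrand e T hB).continuous.comp
    (continuous_const.prodMk continuous_id : Continuous fun r : ℝ => (y, r)))
  exact ((ContinuousAlternatingMap.apply ℝ Amb ℝ v).intervalIntegral_comp_comm
    (hc.intervalIntegrable 0 1)).symm

theorem averagePrimitive_apply (e : Amb) (T : ℝ) {B : Amb → Amb [⋀^Fin (k + 1)]→L[ℝ] ℝ}
    (hB : ContDiff ℝ ∞ B) (y : Amb) (v : Fin k → Amb) :
    averagePrimitive e T B y v =
      ∫ r in (0 : ℝ)..1, (T / 2 * (1 - r)) * (B (y + (r * T) • e) (Matrix.vecCons e v)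
        - B (y - (r * T) • e) (Matrix.vecCons e v)) := by
  have hc := ((contDiff_averagePrimitive_integrand e T hB).continuous.comp
    (continuous_const.prodMk continuous_id : Continuous fun r : ℝ => (y, r)))
  exact ((ContinuousAlternatingMap.apply ℝ Amb ℝ v).intervalIntegral_comp_comm
    (hc.intervalIntegrable 0 1)).symm

theorem fderiv_averagePrimitive (e : Amb) (T : ℝ) {B : Amb → Amb [⋀^Fin 2]→L[ℝ] ℝ}
    (hB : ContDiff ℝ ∞ B) (y v w : Amb) :
    fderiv ℝ (averagePrimitive e T B) y v ![w] =
      ∫ r in (0 : ℝ)..1, (T / 2 * (1 - r)) * (fderiv ℝ B (y + (r * T) • e) v ![e, w]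
        - fderiv ℝ B (y - (r * T) • e) v ![e, w]) := by
  have hd := (contDiff_averagePrimitive e T hB).differentiable (by simp) y
  rw [← fderiv_continuousAlternatingMap_apply_const_apply hd]
  simp only [averagePrimitive_apply e T hB]
  have hBw : ContDiff ℝ ∞ fun y => B y ![e, w] := hB.alternating_apply contDiff_const
  have hf : ContDiff ℝ ∞ fun z : Amb × ℝ => (T / 2 * (1 - z.2)) *
      (B (z.1 + (z.2 * T) • e) ![e, w] - B (z.1 - (z.2 * T) • e) ![e, w]) := by
    refine ContDiff.mul (by fun_prop) (ContDiff.sub ?_ ?_)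
    · exact hBw.comp (g := fun y => B y ![e, w]) (f := fun z : Amb × ℝ => z.1 + (z.2 * T) • e)
        (by fun_prop)
    · exact hBw.comp (g := fun y => B y ![e, w]) (f := fun z : Amb × ℝ => z.1 - (z.2 * T) • e)
        (by fun_prop)
  have h1 := (hasFDerivAt_intervalIntegral_of_contDiff (hf.of_le (by simp)) 0 1 y).fderiv
  refine (congrArg (fun L => L v) h1).trans ?_
  have hcont : Continuous fun r : ℝ => (fderiv ℝ (fun z : Amb × ℝ => (T / 2 * (1 - z.2)) *
      (B (z.1 + (z.2 * T) • e) ![e, w] - B (z.1 - (z.2 * T) • e) ![e, w])) (y, r)).comp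
        (ContinuousLinearMap.inl ℝ Amb ℝ) :=
    ((hf.continuous_fderiv (by simp)).comp (continuous_const.prodMk continuous_id)).clm_comp
      continuous_const
  refine (ContinuousLinearMap.intervalIntegral_apply (hcont.intervalIntegrable 0 1) v).trans ?_
  refine intervalIntegral.integral_congr fun r _ => ?_
  have e1 : HasFDerivAt (fun y' : Amb => B (y' + (r * T) • e) ![e, w])
      (fderiv ℝ (fun y => B y ![e, w]) (y + (r * T) • e)) y := by
    have := (hBw.differentiable (by simp) (y + (r * T) • e)).hasFDerivAt.comp y
      ((hasFDerivAt_id y).add_const ((r * T) • e))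
    rwa [ContinuousLinearMap.comp_id] at this
  have e2 : HasFDerivAt (fun y' : Amb => B (y' - (r * T) • e) ![e, w])
      (fderiv ℝ (fun y => B y ![e, w]) (y - (r * T) • e)) y := by
    have := (hBw.differentiable (by simp) (y - (r * T) • e)).hasFDerivAt.comp y
      ((hasFDerivAt_id y).sub_const ((r * T) • e))
    rwa [ContinuousLinearMap.comp_id] at this
  have e3 := (e1.sub e2).const_mul (T / 2 * (1 - r))
  have e4 := (hf.differentiable (by simp) (y, r)).hasFDerivAt.comp y
    (hasFDerivAt_prodMk_left (𝕜 := ℝ) y r)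
  replace e4 := HasFDerivAt.unique e4 e3
  refine (congrArg (fun L => L v) e4).trans ?_
  have e5 : ∀ x, fderiv ℝ (fun y => B y ![e, w]) x v = fderiv ℝ B x v ![e, w] := fun x =>
    fderiv_continuousAlternatingMap_apply_const_apply (hB.differentiable (by simp) x) _ _
  simp [e5]

/-- Integration by parts with the weight 1 - r, which vanishes at 1 and leaves only the boundary
term at 0. This explains the weight in `averagePrimitive`. -/
theorem integral_one_sub_mul_deriv {g g' : ℝ → ℝ} (hg : ∀ r, HasDerivAt g (g' r) r)
    (hg' : Continuous g') :
    ∫ r in (0 : ℝ)..1, (1 - r) * g' r = (∫ r in (0 : ℝ)..1, g r) - g 0 := by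
  have h := intervalIntegral.integral_mul_deriv_eq_deriv_mul (a := 0) (b := 1)
    (u := fun r => 1 - r) (v := g) (u' := fun _ => -1) (v' := g')
    (fun r _ => by simpa using (hasDerivAt_id r).const_sub 1) (fun r _ => hg r)
    intervalIntegrable_const (hg'.intervalIntegrable 0 1)
  rw [h]
  simp
  ring

theorem hasDerivAt_form_line {B : Amb → Amb [⋀^Fin k]→L[ℝ] ℝ} (hB : ContDiff ℝ ∞ B) (y e : Amb)
    (T : ℝ) (v : Fin k → Amb) (r : ℝ) :
    HasDerivAt (fun r : ℝ => B (y + (r * T) • e) v)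
      (T * fderiv ℝ B (y + (r * T) • e) e v) r := by
  have hBv : ContDiff ℝ ∞ fun y => B y v := hB.alternating_apply contDiff_const
  have e1 : HasDerivAt (fun r : ℝ => y + (r * T) • e) (T • e) r := by
    simpa using (((hasDerivAt_id r).mul_const T).smul_const e).const_add y
  have e2 := (hBv.differentiable (by simp) (y + (r * T) • e)).hasFDerivAt.comp_hasDerivAt r e1
  rw [map_smul, smul_eq_mul,
    fderiv_continuousAlternatingMap_apply_const_apply (hB.differentiable (by simp) _)] at e2
  exact e2

variable {S : Set E3} {n : E3 → E3}

/-- Cartan's formula: for closed B the derivative of B along e is the differential of the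
contraction of B with e. Integrating this along the segments from y to y ± T e with the weight 1 - r
gives the average minus the value at y. Closedness is known only on tangent vectors, which suffices
because e is tangent to S × ℝ × ℝ. -/
theorem extDeriv_averagePrimitive {e : Amb} (he : e.1 = 0) (T : ℝ)
    {B : Amb → Amb [⋀^Fin 2]→L[ℝ] ℝ} (hB : ContDiff ℝ ∞ B) (hcl : AmbEq S n (extDeriv B) 0) :
    AmbEq S n (extDeriv (averagePrimitive e T B)) (averageAlong e T B - B) := by
  intro y hy v hv
  have hv2 : v = ![v 0, v 1] := by ext i <;> fin_cases i <;> rfl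
  have hfd : Continuous (fderiv ℝ B) := hB.continuous_fderiv (by simp)
  have hcontp : ∀ (u : Amb) (w : Fin 2 → Amb) , Continuous fun r : ℝ =>
      fderiv ℝ B (y + (r * T) • e) u w := fun u w =>
    (ContinuousAlternatingMap.apply ℝ Amb ℝ w).continuous.comp
      ((hfd.comp (by fun_prop)).clm_apply continuous_const)
  have hcontm : ∀ (u : Amb) (w : Fin 2 → Amb) , Continuous fun r : ℝ =>
      fderiv ℝ B (y - (r * T) • e) u w := fun u w =>
    (ContinuousAlternatingMap.apply ℝ Amb ℝ w).continuous.comp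
      ((hfd.comp (by fun_prop)).clm_apply continuous_const)
  have hclosed : ∀ x : Amb, x.1 = y.1 →
      fderiv ℝ B x (v 0) ![e, v 1] - fderiv ℝ B x (v 1) ![e, v 0] = fderiv ℝ B x e v := by
    intro x hx
    have h1 := hcl x (by rw [hx]; exact hy) ![e, v 0, v 1] (by
      intro i
      rw [hx]
      fin_cases i
      · simp [he]
      · exact hv 0
      · exact hv 1)
    rw [extDeriv_two_apply (hB.differentiable (by simp) x), ← hv2] at h1
    change _ = (0 : ℝ) at h1
    linarith
  have h0 : extDeriv (averagePrimitive e T B) y v =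
      fderiv ℝ (averagePrimitive e T B) y (v 0) ![v 1]
        - fderiv ℝ (averagePrimitive e T B) y (v 1) ![v 0] := by
    conv_lhs => rw [hv2]
    exact extDeriv_one_apply ((contDiff_averagePrimitive e T hB).differentiable (by simp) y) _ _
  rw [h0, fderiv_averagePrimitive e T hB, fderiv_averagePrimitive e T hB,
    ← intervalIntegral.integral_sub]
  rotate_left
  · exact (Continuous.mul (by fun_prop) ((hcontp _ _).sub (hcontm _ _))).intervalIntegrable _ _
  · exact (Continuous.mul (by fun_prop) ((hcontp _ _).sub (hcontm _ _))).intervalIntegrable _ _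
  rw [show (averageAlong e T B - B) y v = averageAlong e T B y v - B y v from rfl,
    averageAlong_apply e T hB]
  have hg : ∀ r : ℝ, HasDerivAt
      (fun r : ℝ => (1 / 2 : ℝ) * (B (y + (r * T) • e) v + B (y - (r * T) • e) v))
      (T / 2 * (fderiv ℝ B (y + (r * T) • e) e v - fderiv ℝ B (y - (r * T) • e) e v)) r := by
    intro r
    have e1 := hasDerivAt_form_line hB y e T v r
    have e2 := hasDerivAt_form_line hB y e (-T) v r
    simp only [mul_neg, neg_smul, ← sub_eq_add_neg] at e2
    have e3 := (e1.add e2).const_mul (1 / 2 : ℝ)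
    refine e3.congr_deriv ?_
    ring
  have h2 := integral_one_sub_mul_deriv hg
    (continuous_const.mul ((hcontp e v).sub (hcontm e v)))
  have h3 : (1 / 2 : ℝ) * (B (y + ((0 : ℝ) * T) • e) v + B (y - ((0 : ℝ) * T) • e) v) = B y v := by
    simp; ring
  simp only [h3] at h2
  rw [← h2]
  refine intervalIntegral.integral_congr fun r _ => ?_
  have c1 := hclosed (y + (r * T) • e) (by simp [he])
  have c2 := hclosed (y - (r * T) • e) (by simp [he])
  simp only [← c1, ← c2]
  ring

/-- When 2T is a period the average is the mean over one full period, whose starting point does not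
matter. -/
theorem averageAlong_add_smul {e : Amb} {T : ℝ} (hT : 0 < T) {B : Amb → Amb [⋀^Fin k]→L[ℝ] ℝ}
    (hB : ContDiff ℝ ∞ B) {y : Amb} {v : Fin k → Amb}
    (hper : ∀ a : ℝ, B (y + (a + 2 * T) • e) v = B (y + a • e) v) (c : ℝ) :
    averageAlong e T B (y + c • e) v = averageAlong e T B y v := by
  set f : ℝ → ℝ := fun a => B (y + a • e) v with hf
  have hfc : Continuous f := (hB.alternating_apply contDiff_const).continuous.comp
    (f := fun a : ℝ => y + a • e) (by fun_prop)
  have hp : Function.Periodic f (2 * T) := hper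
  have key : ∀ c : ℝ, averageAlong e T B (y + c • e) v
      = (1 / (2 * T)) * ∫ a in (c - T)..(c - T + 2 * T), f a := by
    intro c
    rw [averageAlong_apply e T hB, intervalIntegral.integral_const_mul,
      intervalIntegral.integral_add]
    rotate_left
    · exact ((hB.alternating_apply contDiff_const).continuous.comp
        (f := fun r : ℝ => y + c • e + (r * T) • e) (by fun_prop)).intervalIntegrable _ _
    · exact ((hB.alternating_apply contDiff_const).continuous.comp
        (f := fun r : ℝ => y + c • e - (r * T) • e) (by fun_prop)).intervalIntegrable _ _
    have e1 : ∫ r in (0 : ℝ)..1, B (y + c • e + (r * T) • e) v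
        = T⁻¹ * ∫ a in c..(c + T), f a := by
      have := intervalIntegral.integral_comp_mul_add (a := 0) (b := 1) f hT.ne' c
      simp only [mul_zero, zero_add, mul_one, smul_eq_mul] at this
      rw [add_comm c T, ← this]
      refine intervalIntegral.integral_congr fun r _ => ?_
      simp only [hf]
      congr 2
      module
    have e2 : ∫ r in (0 : ℝ)..1, B (y + c • e - (r * T) • e) v
        = T⁻¹ * ∫ a in (c - T)..c, f a := by
      have := intervalIntegral.integral_comp_sub_mul (a := 0) (b := 1) f hT.ne' c
      simp only [mul_zero, sub_zero, mul_one, smul_eq_mul] at this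
      rw [← this]
      refine intervalIntegral.integral_congr fun r _ => ?_
      simp only [hf]
      congr 2
      module
    rw [e1, e2, ← mul_add, add_comm, intervalIntegral.integral_add_adjacent_intervals
      (hfc.intervalIntegrable _ _) (hfc.intervalIntegrable _ _)]
    rw [show c - T + 2 * T = c + T by ring]
    field_simp
  have k0 := key 0
  rw [zero_smul, add_zero] at k0
  rw [key c, k0, hp.intervalIntegral_add_eq (c - T) (0 - T)]

end Averaging

/-! ### The deck transformations of S × ℝ × ℝ -/

section SymmetryGroup

/-- The real number `1` or `-1` given by a unit of `ℤ`. -/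
noncomputable def unitSign : ℤˣ →* ℝ :=
  (Int.castRingHom ℝ : ℤ →* ℝ).comp (Units.coeHom ℤ)

theorem unitSign_eq (u : ℤˣ) : unitSign u = 1 ∨ unitSign u = -1 := by
  rcases Int.units_eq_one_or u with rfl | rfl
  · exact Or.inl (map_one _)
  · right
    simp [unitSign]

theorem unitSign_mul_self (u : ℤˣ) : unitSign u * unitSign u = 1 := by
  rcases unitSign_eq u with h | h <;> rw [h] <;> norm_num

/-- The rotation `(x, y, z) ↦ (u w x, w y, u z)` with signs `u` and `w`. -/
noncomputable def signMap (u w : ℤˣ) : E3 →L[ℝ] E3 :=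
  LinearMap.toContinuousLinearMap
    { toFun := fun x => !₂[unitSign u * unitSign w * x 0, unitSign w * x 1, unitSign u * x 2]
      map_add' := fun x y => by
        ext i
        fin_cases i <;> simp [mul_add]
      map_smul' := fun c x => by
        ext i
        fin_cases i <;> simp <;> ring }

theorem signMap_apply (u w : ℤˣ) (x : E3) : signMap u w x =
    !₂[unitSign u * unitSign w * x 0, unitSign w * x 1, unitSign u * x 2] := rfl

theorem signMap_signMap (u w u' w' : ℤˣ) (x : E3) :
    signMap u w (signMap u' w' x) = signMap (u * u') (w * w') x := by
  ext i
  fin_cases i <;> simp [signMap_apply] <;> ring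

theorem signMap_one (x : E3) : signMap 1 1 x = x := by
  ext i
  fin_cases i <;> simp [signMap_apply]

theorem inner_signMap (u w : ℤˣ) (x y : E3) :
    inner ℝ (signMap u w x) (signMap u w y) = inner ℝ x y := by
  rw [inner_E3, inner_E3]
  simp only [signMap_apply, PiLp.toLp_apply, Matrix.cons_val]
  linear_combination
    (x 0 * y 0 * (unitSign w * unitSign w)) * unitSign_mul_self u
      + (x 0 * y 0 + x 1 * y 1) * unitSign_mul_self w + x 2 * y 2 * unitSign_mul_self u

theorem vol3_signMap (u w : ℤˣ) (a b c : E3) :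
    vol3 (signMap u w a) (signMap u w b) (signMap u w c) = vol3 a b c := by
  rw [vol3_eq, vol3_eq]
  simp only [signMap_apply, PiLp.toLp_apply, Matrix.cons_val]
  have h : unitSign u * unitSign w * (unitSign w * unitSign u) = 1 := by
    linear_combination unitSign w * unitSign w * unitSign_mul_self u + unitSign_mul_self w
  linear_combination (a 0 * (b 1 * c 2 - b 2 * c 1) - a 1 * (b 0 * c 2 - b 2 * c 0)
      + a 2 * (b 0 * c 1 - b 1 * c 0)) * h

theorem norm_signMap (u w : ℤˣ) (x : E3) : ‖signMap u w x‖ = ‖x‖ := by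
  rw [norm_eq_sqrt_real_inner, norm_eq_sqrt_real_inner x, inner_signMap]

/-- The parameters of the deck transformations of `S × ℝ × ℝ` over the orbit space. -/
abbrev SymIndex := ℤˣ × ℤˣ × ℤ × ℤ

/-- The linear part of a deck transformation. -/
noncomputable def symLin (g : SymIndex) : Amb →L[ℝ] Amb :=
  (signMap g.2.1 (Int.negOnePow g.2.2.1)).prodMap
    (unitSign g.1 • ContinuousLinearMap.id ℝ (ℝ × ℝ))

/-- The deck transformation
`(p, t, s) ↦ (u w x, w y, u z, ε t - 2 m, ε s + 2 n)` with `w = (-1) ^ m`. -/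
noncomputable def symMap (g : SymIndex) (y : Amb) : Amb :=
  symLin g y + (0, -2 * (g.2.2.1 : ℝ), 2 * (g.2.2.2 : ℝ))

theorem symLin_apply (g : SymIndex) (v : Amb) : symLin g v =
    (signMap g.2.1 (Int.negOnePow g.2.2.1) v.1, unitSign g.1 * v.2.1, unitSign g.1 * v.2.2) := rfl

theorem symMap_apply (g : SymIndex) (y : Amb) : symMap g y =
    (signMap g.2.1 (Int.negOnePow g.2.2.1) y.1, unitSign g.1 * y.2.1 - 2 * (g.2.2.1 : ℝ),
      unitSign g.1 * y.2.2 + 2 * (g.2.2.2 : ℝ)) := by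
  rw [symMap, symLin_apply]
  ext
  · simp
  · simp [sub_eq_add_neg]
  · simp

theorem symMap_fst (g : SymIndex) (y : Amb) :
    (symMap g y).1 = signMap g.2.1 (Int.negOnePow g.2.2.1) y.1 := by
  rw [symMap_apply]

theorem contDiff_symMap (g : SymIndex) : ContDiff ℝ ∞ (symMap g) :=
  (symLin g).contDiff.add contDiff_const

theorem hasFDerivAt_symMap (g : SymIndex) (y : Amb) : HasFDerivAt (symMap g) (symLin g) y :=
  (symLin g).hasFDerivAt.add_const _

theorem symMap_add_smul (g : SymIndex) (y e : Amb) (c : ℝ) :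
    symMap g (y + c • e) = symMap g y + c • symLin g e := by
  rw [symMap, symMap, map_add, map_smul]
  abel

theorem negOnePow_unit_mul (ε : ℤˣ) (m : ℤ) : Int.negOnePow ((ε : ℤ) * m) = Int.negOnePow m := by
  rcases Int.units_eq_one_or ε with rfl | rfl <;> simp

theorem unitSign_mul_intCast (ε : ℤˣ) (m : ℤ) :
    unitSign ε * (m : ℝ) = (((ε : ℤ) * m : ℤ) : ℝ) := by
  push_cast
  rfl

/-- The composition of deck transformations, in terms of their parameters. -/
def symMul (g h : SymIndex) : SymIndex :=
  (g.1 * h.1, g.2.1 * h.2.1, g.1 * h.2.2.1 + g.2.2.1, g.1 * h.2.2.2 + g.2.2.2)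

/-- The inverse of a deck transformation, in terms of its parameters. -/
def symInv (g : SymIndex) : SymIndex :=
  (g.1, g.2.1, -(g.1 * g.2.2.1), -(g.1 * g.2.2.2))

theorem symMap_symMap (g h : SymIndex) (y : Amb) :
    symMap g (symMap h y) = symMap (symMul g h) y := by
  simp only [symMap_apply, symMul, signMap_signMap, map_mul, Int.negOnePow_add,
    negOnePow_unit_mul, Prod.mk.injEq]
  refine ⟨by rw [mul_comm g.2.2.1.negOnePow], ?_, ?_⟩
  · rw [Int.cast_add, ← unitSign_mul_intCast]
    ring
  · rw [Int.cast_add, ← unitSign_mul_intCast]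
    ring

theorem symMap_symInv (g : SymIndex) (y : Amb) : symMap g (symMap (symInv g) y) = y := by
  simp only [symMap_apply, symInv, signMap_signMap, Int.negOnePow_neg, negOnePow_unit_mul,
    Int.cast_neg, ← unitSign_mul_intCast, Int.units_mul_self, signMap_one]
  ext
  · rfl
  · simp only
    linear_combination (y.2.1 + 2 * (g.2.2.1 : ℝ)) * unitSign_mul_self g.1
  · simp only
    linear_combination (y.2.2 - 2 * (g.2.2.2 : ℝ)) * unitSign_mul_self g.1

theorem symInv_symInv (g : SymIndex) : symInv (symInv g) = g := by
  obtain ⟨ε, u, m, n⟩ := g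
  have h : (ε : ℤ) * ε = 1 := by rcases Int.units_eq_one_or ε with rfl | rfl <;> rfl
  simp only [symInv, Prod.mk.injEq, true_and]
  constructor
  · linear_combination m * h
  · linear_combination n * h

theorem symInv_symMap (g : SymIndex) (y : Amb) : symMap (symInv g) (symMap g y) = y := by
  have := symMap_symInv (symInv g) y
  rwa [symInv_symInv] at this

theorem norm_symLin (g : SymIndex) (v : Amb) : ‖symLin g v‖ = ‖v‖ := by
  have h : |unitSign g.1| = 1 := by
    rcases unitSign_eq g.1 with h | h <;> simp [h]
  rw [symLin_apply, Prod.norm_def, Prod.norm_def, Prod.norm_def, Prod.norm_def, norm_signMap]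
  simp [h]

theorem dist_symMap (g : SymIndex) (y z : Amb) : dist (symMap g y) (symMap g z) = dist y z := by
  rw [dist_eq_norm, dist_eq_norm, ← norm_symLin g (y - z), map_sub, symMap, symMap]
  simp

theorem symLin_injective (g : SymIndex) : Function.Injective (symLin g) := by
  refine (injective_iff_map_eq_zero _).2 fun v hv => ?_
  rw [← norm_eq_zero, ← norm_symLin g, hv, norm_zero]

/-- The surface `S` and its normal field `n` are invariant under the rotations `signMap`. -/
structure IsSymmetricSurface (S : Set E3) (n : E3 → E3) : Prop where
  mapsTo : ∀ u w : ℤˣ, ∀ x ∈ S, signMap u w x ∈ S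
  normal : ∀ u w : ℤˣ, ∀ x ∈ S, n (signMap u w x) = signMap u w (n x)

variable {S : Set E3} {n : E3 → E3} {k : ℕ}

theorem IsSymmetricSurface.symMap_mem (h : IsSymmetricSurface S n) (g : SymIndex) {y : Amb}
    (hy : y.1 ∈ S) : (symMap g y).1 ∈ S := by
  rw [symMap_fst]
  exact h.mapsTo _ _ _ hy

theorem IsSymmetricSurface.inner_symLin (h : IsSymmetricSurface S n) (g : SymIndex) {y : Amb}
    (hy : y.1 ∈ S) {v : Amb} (hv : inner ℝ (n y.1) v.1 = 0) :
    inner ℝ (n (symMap g y).1) (symLin g v).1 = 0 := by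
  rw [symMap_fst, h.normal _ _ _ hy, symLin_apply, inner_signMap, hv]

/-- The restriction of the form `B` to `S × ℝ × ℝ` is invariant under the deck transformations. -/
def IsSymInvariant (S : Set E3) (n : E3 → E3) (B : Amb → Amb [⋀^Fin k]→L[ℝ] ℝ) : Prop :=
  ∀ (g : SymIndex) (y : Amb), y.1 ∈ S → ∀ v : Fin k → Amb, (∀ i, inner ℝ (n y.1) (v i).1 = 0) →
    B (symMap g y) (fun i => symLin g (v i)) = B y v

theorem IsSymInvariant.sub {B B' : Amb → Amb [⋀^Fin k]→L[ℝ] ℝ} (h : IsSymInvariant S n B) (h' : IsSymInvariant S n B') :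
    IsSymInvariant S n (B - B') := fun g y hy v hv => congrArg₂ (· - ·) (h g y hy v hv) (h' g y hy v hv)

/-- The average is taken symmetrically over ±e, so a deck transformation that reverses e only
exchanges its two summands. -/
theorem IsSymInvariant.averageAlong {B : Amb → Amb [⋀^Fin k]→L[ℝ] ℝ} (hB : ContDiff ℝ ∞ B)
    (h : IsSymInvariant S n B) {e : Amb} (he : e.1 = 0)
    (hg : ∀ g, symLin g e = e ∨ symLin g e = -e) (T : ℝ) : IsSymInvariant S n (averageAlong e T B) := by
  intro g y hy v hv
  rw [averageAlong_apply e T hB, averageAlong_apply e T hB]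
  refine intervalIntegral.integral_congr fun r _ => ?_
  have hp : ∀ c : ℝ, B (symMap g (y + c • e)) (fun i => symLin g (v i)) = B (y + c • e) v :=
    fun c => h g _ (by simpa [he] using hy) v (by simpa [he] using hv)
  have h1 := hp (r * T)
  have h2 := hp (-(r * T))
  rw [symMap_add_smul] at h1 h2
  simp only [neg_smul, ← sub_eq_add_neg] at h2
  beta_reduce
  rcases hg g with h' | h'
  · rw [h'] at h1 h2
    rw [h1, h2]
  · rw [h'] at h1 h2
    rw [smul_neg, ← sub_eq_add_neg] at h1
    rw [smul_neg, sub_neg_eq_add] at h2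
    rw [h1, h2, add_comm]

theorem ContinuousAlternatingMap.vecCons_neg {F : Type*} [NormedAddCommGroup F]
    [NormedSpace ℝ F] (L : F [⋀^Fin (k + 1)]→L[ℝ] ℝ) (e : F) (v : Fin k → F) :
    L (Matrix.vecCons (-e) v) = -L (Matrix.vecCons e v) := by
  have := L.vecCons_smul v (-1) e
  simpa using this

theorem IsSymInvariant.averagePrimitive {B : Amb → Amb [⋀^Fin (k + 1)]→L[ℝ] ℝ} (hB : ContDiff ℝ ∞ B)
    (h : IsSymInvariant S n B) {e : Amb} (he : e.1 = 0)
    (hg : ∀ g, symLin g e = e ∨ symLin g e = -e) (T : ℝ) :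
    IsSymInvariant S n (averagePrimitive e T B) := by
  intro g y hy v hv
  rw [averagePrimitive_apply e T hB, averagePrimitive_apply e T hB]
  refine intervalIntegral.integral_congr fun r _ => ?_
  have hp : ∀ c : ℝ, B (symMap g (y + c • e))
      (Matrix.vecCons (symLin g e) fun i => symLin g (v i)) =
        B (y + c • e) (Matrix.vecCons e v) := by
    intro c
    have := h g (y + c • e) (by simpa [he] using hy) (Matrix.vecCons e v) (by
      intro i
      refine Fin.cases ?_ (fun j => ?_) i
      · simp [he]
      · simpa [he] using hv j)
    rw [← this]
    congr 1
    ext1 i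
    refine Fin.cases ?_ (fun j => ?_) i <;> simp
  have h1 := hp (r * T)
  have h2 := hp (-(r * T))
  rw [symMap_add_smul] at h1 h2
  simp only [neg_smul, ← sub_eq_add_neg] at h2
  beta_reduce
  rcases hg g with h' | h'
  · rw [h'] at h1 h2
    rw [h1, h2]
  -- When e is reversed there are two sign changes, one from the contraction with e and one from
  -- exchanging the two summands of the difference. They cancel.
  · rw [h', ContinuousAlternatingMap.vecCons_neg] at h1 h2
    rw [smul_neg, ← sub_eq_add_neg] at h1
    rw [smul_neg, sub_neg_eq_add] at h2
    rw [← h1, ← h2]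
    ring

end SymmetryGroup

/-! ### Linearity of the exterior derivative -/

section ExteriorDerivativeLinear

variable {F : Type*} [NormedAddCommGroup F] [NormedSpace ℝ F] {k : ℕ}

theorem extDeriv_add_of_contDiff {B B' : F → F [⋀^Fin k]→L[ℝ] ℝ} (hB : ContDiff ℝ ∞ B)
    (hB' : ContDiff ℝ ∞ B') : extDeriv (B + B') = extDeriv B + extDeriv B' :=
  funext fun x => extDeriv_add (hB.differentiable (by simp) x) (hB'.differentiable (by simp) x)

theorem extDeriv_const_smul (c : ℝ) (B : F → F [⋀^Fin k]→L[ℝ] ℝ) :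
    extDeriv (c • B) = c • extDeriv B :=
  funext fun _ => extDeriv_smul c B

theorem extDeriv_sub_of_contDiff {B B' : F → F [⋀^Fin k]→L[ℝ] ℝ} (hB : ContDiff ℝ ∞ B)
    (hB' : ContDiff ℝ ∞ B') : extDeriv (B - B') = extDeriv B - extDeriv B' := by
  have h : ContDiff ℝ ∞ ((-1 : ℝ) • B') :=
    ContDiff.smul (f := fun _ => (-1 : ℝ)) contDiff_const hB'
  have h2 := extDeriv_add_of_contDiff hB h
  rw [extDeriv_const_smul, neg_one_smul, neg_one_smul, ← sub_eq_add_neg, ← sub_eq_add_neg] at h2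
  exact h2

theorem extDeriv_extDeriv_of_contDiff {B : F → F [⋀^Fin k]→L[ℝ] ℝ} (hB : ContDiff ℝ ∞ B) :
    extDeriv (extDeriv B) = 0 :=
  extDeriv_extDeriv hB (by
    rw [minSmoothness_of_isRCLikeNormedField]
    exact WithTop.coe_le_coe.2 le_top)

theorem ContDiff.const_smul_form {B : F → F [⋀^Fin k]→L[ℝ] ℝ} (hB : ContDiff ℝ ∞ B) (c : ℝ) :
    ContDiff ℝ ∞ (c • B) :=
  ContDiff.smul (f := fun _ => c) contDiff_const hB

end ExteriorDerivativeLinear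

/-! ### The area form and dt ∧ ds -/

section BasicForms

/-- The coordinate vector field `∂/∂t`. -/
def vecT : Amb := (0, 1, 0)

/-- The coordinate vector field `∂/∂s`. -/
def vecS : Amb := (0, 0, 1)

/-- The pullback of the area form to `ℝ³ × ℝ × ℝ`. -/
noncomputable def areaAmb (n : E3 → E3) : Amb → Amb [⋀^Fin 2]→L[ℝ] ℝ :=
  formPullback Prod.fst fun x => volContract (n x)

/-- The form `dt ∧ ds` on `ℝ³ × ℝ × ℝ`. -/
noncomputable def dtdsAmb : Amb → Amb [⋀^Fin 2]→L[ℝ] ℝ :=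
  extDeriv fun y : Amb => oneForm (y.2.1 • (ContinuousLinearMap.snd ℝ ℝ ℝ ∘L
    ContinuousLinearMap.snd ℝ E3 (ℝ × ℝ)))

theorem contDiff_areaAmb {n : E3 → E3} (hn : ContDiff ℝ ∞ n) : ContDiff ℝ ∞ (areaAmb n) :=
  contDiff_fst.formPullback (contDiff_volContract.comp hn)

theorem contDiff_dtdsAmb_primitive : ContDiff ℝ ∞ fun y : Amb =>
    oneForm (y.2.1 • (ContinuousLinearMap.snd ℝ ℝ ℝ ∘L ContinuousLinearMap.snd ℝ E3 (ℝ × ℝ))) :=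
  contDiff_oneForm.comp ((contDiff_fst.comp contDiff_snd).smul contDiff_const)

theorem contDiff_dtdsAmb : ContDiff ℝ ∞ dtdsAmb :=
  contDiff_dtdsAmb_primitive.extDeriv

/-- The form is defined as d(t ds), so it is closed at once. This does not make its class trivial on
X, because t ds is not periodic in t. -/
theorem extDeriv_dtdsAmb : extDeriv dtdsAmb = 0 :=
  extDeriv_extDeriv_of_contDiff contDiff_dtdsAmb_primitive

theorem areaAmb_apply (n : E3 → E3) (y : Amb) (v : Fin 2 → Amb) :
    areaAmb n y v = vol3 (n y.1) (v 0).1 (v 1).1 := by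
  rw [areaAmb, formPullback_apply, volContract_apply, fderiv_fst]
  rfl

theorem dtdsAmb_apply (y : Amb) (v : Fin 2 → Amb) :
    dtdsAmb y v = (v 0).2.1 * (v 1).2.2 - (v 1).2.1 * (v 0).2.2 := by
  have hd := contDiff_dtdsAmb_primitive.differentiable (by simp) y
  have hv : v = ![v 0, v 1] := by ext1 i; fin_cases i <;> rfl
  have key : ∀ a b : Amb, fderiv ℝ (fun y : Amb => oneForm (y.2.1 •
      (ContinuousLinearMap.snd ℝ ℝ ℝ ∘L ContinuousLinearMap.snd ℝ E3 (ℝ × ℝ)))) y a ![b]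
        = a.2.1 * b.2.2 := by
    intro a b
    rw [← fderiv_continuousAlternatingMap_apply_const_apply hd]
    simp only [oneForm_apply, Matrix.cons_val_zero]
    have h : HasFDerivAt (fun y : Amb => (y.2.1 • (ContinuousLinearMap.snd ℝ ℝ ℝ ∘L
        ContinuousLinearMap.snd ℝ E3 (ℝ × ℝ))) b)
        (b.2.2 • (ContinuousLinearMap.fst ℝ ℝ ℝ ∘L ContinuousLinearMap.snd ℝ E3 (ℝ × ℝ))) y :=
      (ContinuousLinearMap.fst ℝ ℝ ℝ ∘L ContinuousLinearMap.snd ℝ E3 (ℝ × ℝ)).hasFDerivAt.mul_const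
        b.2.2
    rw [h.fderiv]
    exact mul_comm _ _
  conv_lhs => rw [hv]
  rw [dtdsAmb, extDeriv_one_apply hd, key, key]

theorem symLin_vecT (g : SymIndex) : symLin g vecT = unitSign g.1 • vecT := by
  rw [symLin_apply, vecT]
  ext <;> simp

theorem symLin_vecS (g : SymIndex) : symLin g vecS = unitSign g.1 • vecS := by
  rw [symLin_apply, vecS]
  ext <;> simp

theorem symLin_vecT_eq_or (g : SymIndex) : symLin g vecT = vecT ∨ symLin g vecT = -vecT := by
  rw [symLin_vecT]
  rcases unitSign_eq g.1 with h | h <;> simp [h]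

theorem symLin_vecS_eq_or (g : SymIndex) : symLin g vecS = vecS ∨ symLin g vecS = -vecS := by
  rw [symLin_vecS]
  rcases unitSign_eq g.1 with h | h <;> simp [h]

variable {S : Set E3} {n : E3 → E3} {k : ℕ}

theorem isSymInvariant_areaAmb (hsym : IsSymmetricSurface S n) :
    IsSymInvariant S n (areaAmb n) := by
  intro g y hy v hv
  rw [areaAmb_apply, areaAmb_apply, symMap_fst, hsym.normal _ _ _ hy, symLin_apply, symLin_apply,
    vol3_signMap]

theorem isSymInvariant_dtdsAmb : IsSymInvariant S n dtdsAmb := by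
  intro g y hy v hv
  rw [dtdsAmb_apply, dtdsAmb_apply, symLin_apply, symLin_apply]
  simp only
  linear_combination ((v 0).2.1 * (v 1).2.2 - (v 1).2.1 * (v 0).2.2) * unitSign_mul_self g.1

/-- The differential is the pullback of a 3-form of ℝ³, evaluated on three vectors of the plane
orthogonal to n. Such vectors are linearly dependent. -/
theorem extDeriv_areaAmb (hS : IsNormalSurface S n) : AmbEq S n (extDeriv (areaAmb n)) 0 := by
  intro y hy v hv
  have hb : ContDiff ℝ ∞ fun x => volContract (n x) := contDiff_volContract.comp hS.smooth
  rw [areaAmb, extDeriv_formPullback hb contDiffAt_fst, formPullback_apply]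
  refine AlternatingMap.map_linearDependent (ContinuousAlternatingMap.toAlternatingMap _) _ ?_
  intro hli
  have hn : n y.1 ≠ 0 := by
    intro h
    have := hS.norm_eq_one _ hy
    rw [h, norm_zero] at this
    exact zero_ne_one this
  have hmem : ∀ i, fderiv ℝ Prod.fst y (v i) ∈ (ℝ ∙ n y.1)ᗮ := by
    intro i
    rw [Submodule.mem_orthogonal_singleton_iff_inner_right, fderiv_fst]
    exact hv i
  have hli' : LinearIndependent ℝ fun i => (⟨_, hmem i⟩ : (ℝ ∙ n y.1)ᗮ) :=
    LinearIndependent.of_comp (Submodule.subtype _) hli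
  have hf : Fact (Module.finrank ℝ E3 = 2 + 1) := ⟨by simp⟩
  have h4 := hli'.fintype_card_le_finrank
  rw [Submodule.finrank_orthogonal_span_singleton (n := 2) hn] at h4
  simp at h4

/-- Even powers of γ are trivial, so these deck transformations are pure translations. They give the
period 4 in t and the period 2 in s. -/
theorem symMap_translate (m n : ℤ) (y : Amb) : symMap (1, 1, 2 * m, n) y =
    y + (-(4 * (m : ℝ))) • vecT + (2 * (n : ℝ)) • vecS := by
  rw [symMap_apply, vecT, vecS]
  have h : Int.negOnePow (2 * m) = 1 := Int.negOnePow_two_mul m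
  rw [h, signMap_one]
  ext
  · simp
  · simp
    ring
  · simp

theorem symLin_translate (m n : ℤ) (v : Amb) : symLin (1, 1, 2 * m, n) v = v := by
  rw [symLin_apply]
  have h : Int.negOnePow (2 * m) = 1 := Int.negOnePow_two_mul m
  rw [h, signMap_one]
  simp

theorem IsSymInvariant.periodic_t {B : Amb → Amb [⋀^Fin k]→L[ℝ] ℝ} (h : IsSymInvariant S n B)
    {y : Amb} (hy : y.1 ∈ S) {v : Fin k → Amb} (hv : ∀ i, inner ℝ (n y.1) (v i).1 = 0) :
    B (y + (4 : ℝ) • vecT) v = B y v := by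
  have := h (1, 1, 2 * (-1), 0) y hy v hv
  simp only [symMap_translate, symLin_translate] at this
  simpa using this

theorem IsSymInvariant.periodic_s {B : Amb → Amb [⋀^Fin k]→L[ℝ] ℝ} (h : IsSymInvariant S n B)
    {y : Amb} (hy : y.1 ∈ S) {v : Fin k → Amb} (hv : ∀ i, inner ℝ (n y.1) (v i).1 = 0) :
    B (y + (2 : ℝ) • vecS) v = B y v := by
  have := h (1, 1, 2 * 0, 1) y hy v hv
  simp only [symMap_translate, symLin_translate] at this
  simpa using this

/-- In a patch, f ∘ ψ has zero derivative on a ball, so f is locally constant on the connected set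
S. It is applied to the coefficient of dt ∧ ds. -/
theorem IsNormalSurface.eq_of_fderiv_eq_zero (hS : IsNormalSurface S n) {f : E3 → ℝ}
    (hf : Differentiable ℝ f) (h0 : ∀ q ∈ S, ∀ v, inner ℝ (n q) v = 0 → fderiv ℝ f q v = 0)
    {p q : E3} (hp : p ∈ S) (hq : q ∈ S) : f p = f q := by
  refine hS.isConnected.isPreconnected.induction₂ (fun x y => f x = f y) (fun x hx => ?_)
    (fun _ _ _ _ _ _ h h' => h.trans h') (fun _ _ _ _ h => h.symm) hp hq
  obtain ⟨P, O, V, ψ, m, hV, hpt⟩ := hS.exists_patch x hx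
  obtain ⟨r, hr, hball⟩ := Metric.isOpen_iff.1 hpt.isOpen_O (P x) (hpt.proj_mem x hV)
  have hnear : ∀ᶠ y in 𝓝[S] x, y ∈ S ∧ y ∈ V ∧ P y ∈ Metric.ball (P x) r :=
    eventually_mem_nhdsWithin.and (((hpt.isOpen_V.eventually_mem hV).filter_mono
      nhdsWithin_le_nhds).and ((P.continuous.continuousAt.eventually (Metric.ball_mem_nhds _ hr)).filter_mono
        nhdsWithin_le_nhds))
  filter_upwards [hnear] with y ⟨hyS, hyV, hyr⟩
  have hder : ∀ u ∈ O, HasFDerivAt (fun u => f (ψ u)) ((fderiv ℝ f (ψ u)).comp (fderiv ℝ ψ u)) u :=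
    fun u hu => (hf (ψ u)).hasFDerivAt.comp u (hpt.hasFDerivAt hu)
  have h1 := Metric.isOpen_ball.is_const_of_fderiv_eq_zero (𝕜 := ℝ) (s := Metric.ball (P x) r)
    (f := fun u => f (ψ u)) (convex_ball _ _).isPreconnected
    (fun u hu => (hder u (hball hu)).differentiableAt.differentiableWithinAt)
    (fun u hu => by
      rw [(hder u (hball hu)).fderiv]
      ext v
      exact h0 _ (hpt.mem u (hball hu)).1 _ (hpt.orthogonal u (hball hu) v))
    (Metric.mem_ball_self hr) hyr
  simpa only [hpt.param_proj x ⟨hx, hV⟩, hpt.param_proj y ⟨hyS, hyV⟩] using h1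

end BasicForms

/-! ### Translation-invariant forms and averages over rotations -/

section Spanning

variable {S : Set E3} {n : E3 → E3}

theorem ContinuousAlternatingMap.apply_swap_two {F : Type*} [NormedAddCommGroup F]
    [NormedSpace ℝ F] (L : F [⋀^Fin 2]→L[ℝ] ℝ) (v w : F) : L ![w, v] = -L ![v, w] := by
  have h := L.toAlternatingMap.map_swap ![v, w] (show (0 : Fin 2) ≠ 1 by decide)
  have e : ![v, w] ∘ Equiv.swap (0 : Fin 2) 1 = ![w, v] := by
    ext1 i
    fin_cases i <;> simp
  rw [e] at h
  exact h

theorem ContinuousAlternatingMap.apply_self_two {F : Type*} [NormedAddCommGroup F]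
    [NormedSpace ℝ F] (L : F [⋀^Fin 2]→L[ℝ] ℝ) (v : F) : L ![v, v] = 0 := by
  have := L.apply_swap_two v v
  linarith

theorem amb_eq_add (v : Amb) : v = (v.1, 0) + (v.2.1 • vecT + v.2.2 • vecS) := by
  rw [vecT, vecS]
  ext <;> simp

/-- The expansion of a `2`-form on `ℝ³ × ℝ × ℝ` in the types of its arguments. -/
theorem twoForm_expand (L : Amb [⋀^Fin 2]→L[ℝ] ℝ) (v w : Amb) :
    L ![v, w] = L ![(v.1, 0), (w.1, 0)]
      + (v.2.1 * w.2.2 - w.2.1 * v.2.2) * L ![vecT, vecS]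
      + v.2.1 * L ![vecT, (w.1, 0)] + v.2.2 * L ![vecS, (w.1, 0)]
      - w.2.1 * L ![vecT, (v.1, 0)] - w.2.2 * L ![vecS, (v.1, 0)] := by
  have hadd : ∀ a b c : Amb, L ![a + b, c] = L ![a, c] + L ![b, c] := fun a b c =>
    L.vecCons_add ![c] a b
  have hsmul : ∀ (r : ℝ) (a c : Amb), L ![r • a, c] = r * L ![a, c] := fun r a c =>
    L.vecCons_smul ![c] r a
  have hleft : ∀ c : Amb, L ![v, c] = L ![(v.1, 0), c] + (v.2.1 * L ![vecT, c]
      + v.2.2 * L ![vecS, c]) := by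
    intro c
    conv_lhs => rw [amb_eq_add v]
    rw [hadd, hadd, hsmul, hsmul]
  have hright : ∀ c : Amb, L ![c, w] = L ![c, (w.1, 0)] + (w.2.1 * L ![c, vecT]
      + w.2.2 * L ![c, vecS]) := by
    intro c
    conv_lhs => rw [amb_eq_add w, L.apply_swap_two]
    rw [hadd, hadd, hsmul, hsmul, L.apply_swap_two c, L.apply_swap_two c, L.apply_swap_two c]
    ring
  rw [hleft, hright, hright, hright, L.apply_self_two, L.apply_self_two,
    L.apply_swap_two vecT (v.1, 0), L.apply_swap_two vecS (v.1, 0), L.apply_swap_two vecT vecS]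
  ring

/-- The restriction of a form to the slice `ℝ³ × 0 × 0`. -/
noncomputable def sliceForm {k : ℕ} (B : Amb → Amb [⋀^Fin k]→L[ℝ] ℝ) :
    E3 → E3 [⋀^Fin k]→L[ℝ] ℝ :=
  formPullback (ContinuousLinearMap.inl ℝ E3 (ℝ × ℝ)) B

theorem sliceForm_apply {k : ℕ} (B : Amb → Amb [⋀^Fin k]→L[ℝ] ℝ) (x : E3) (v : Fin k → E3) :
    sliceForm B x v = B (x, 0) fun i => (v i, 0) := by
  rw [sliceForm, formPullback_apply, ContinuousLinearMap.fderiv]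
  rfl

theorem contDiff_sliceForm {k : ℕ} {B : Amb → Amb [⋀^Fin k]→L[ℝ] ℝ} (hB : ContDiff ℝ ∞ B) :
    ContDiff ℝ ∞ (sliceForm B) :=
  (ContinuousLinearMap.contDiff _).formPullback hB

/-- The pullback of a form from `ℝ³` to `ℝ³ × ℝ × ℝ`. -/
noncomputable def cylinderForm {k : ℕ} (b : E3 → E3 [⋀^Fin k]→L[ℝ] ℝ) :
    Amb → Amb [⋀^Fin k]→L[ℝ] ℝ :=
  formPullback Prod.fst b

theorem cylinderForm_apply {k : ℕ} (b : E3 → E3 [⋀^Fin k]→L[ℝ] ℝ) (y : Amb) (v : Fin k → Amb) :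
    cylinderForm b y v = b y.1 fun i => (v i).1 := by
  rw [cylinderForm, formPullback_apply, fderiv_fst]
  rfl

theorem contDiff_cylinderForm {k : ℕ} {b : E3 → E3 [⋀^Fin k]→L[ℝ] ℝ} (hb : ContDiff ℝ ∞ b) :
    ContDiff ℝ ∞ (cylinderForm b) :=
  contDiff_fst.formPullback hb

theorem fderiv_form_eq_zero_of_line_const {k : ℕ} {B : Amb → Amb [⋀^Fin k]→L[ℝ] ℝ}
    (hB : ContDiff ℝ ∞ B) {y e : Amb} {v : Fin k → Amb} (h : ∀ r : ℝ, B (y + r • e) v = B y v) :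
    fderiv ℝ B y e v = 0 := by
  have h1 := hasDerivAt_form_line hB y e 1 v 0
  simp only [mul_one, zero_smul, add_zero, one_mul] at h1
  have h2 : (fun r : ℝ => B (y + r • e) v) = fun _ => B y v := funext h
  rw [h2] at h1
  exact h1.unique (hasDerivAt_const _ _)

/-- A closed invariant `2`-form which does not depend on `t` and `s` is the sum of a form of the
surface and of a multiple of `dt ∧ ds`. -/
theorem ambEq_of_translation_invariant (hS : IsNormalSurface S n)
    {B : Amb → Amb [⋀^Fin 2]→L[ℝ] ℝ} (hB : ContDiff ℝ ∞ B) (hinv : IsSymInvariant S n B)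
    (hcl : AmbEq S n (extDeriv B) 0)
    (htr : ∀ y : Amb, y.1 ∈ S → ∀ v : Fin 2 → Amb, (∀ i, inner ℝ (n y.1) (v i).1 = 0) →
      B y v = B (y.1, 0) v) :
    ∃ b : ℝ, AmbEq S n B (cylinderForm (sliceForm B) + b • dtdsAmb) := by
  -- The transformation ξ, with parameters (-1, 1, 0, 0), fixes (q, 0) and the vectors (x, 0) but
  -- reverses e. A mixed component therefore equals its own negative.
  have hmixed : ∀ e : Amb, e.1 = 0 → ∀ q ∈ S, ∀ x : E3, inner ℝ (n q) x = 0 →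
      B (q, 0) ![e, (x, 0)] = 0 := by
    intro e he q hq x hx
    have h1 := hinv (-1, 1, 0, 0) (q, 0) hq ![e, (x, 0)] (by
      intro i
      fin_cases i
      · simp [he]
      · exact hx)
    have e1 : symMap (-1, 1, 0, 0) (q, 0) = (q, 0) := by
      rw [symMap_apply]
      simp [signMap_one]
    have e2 : (fun i => symLin (-1, 1, 0, 0) ((![e, (x, 0)] : Fin 2 → Amb) i)) =
        ![-e, (x, 0)] := by
      ext1 i
      fin_cases i
      · simp only [Fin.zero_eta, Matrix.cons_val_zero, symLin_apply, he, map_zero]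
        ext <;> simp [he, unitSign]
      · simp [symLin_apply, signMap_one]
    rw [e1, e2, ContinuousAlternatingMap.vecCons_neg] at h1
    linarith
  set f : E3 → ℝ := fun x => B (x, 0) ![vecT, vecS] with hf
  have hBv : ContDiff ℝ ∞ fun y => B y ![vecT, vecS] := hB.alternating_apply contDiff_const
  have hfd : ∀ q, HasFDerivAt f ((fderiv ℝ (fun y => B y ![vecT, vecS]) (q, 0)).comp
      (ContinuousLinearMap.inl ℝ E3 (ℝ × ℝ))) q := fun q =>
    (hBv.differentiable (by simp) _).hasFDerivAt.comp q (hasFDerivAt_prodMk_left q 0)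
  have hconst : ∀ p ∈ S, ∀ q ∈ S, f p = f q := by
    intro p hp q hq
    refine hS.eq_of_fderiv_eq_zero (fun q => (hfd q).differentiableAt) (fun q hq x hx => ?_) hp hq
    rw [(hfd q).fderiv]
    -- Closedness on (x, ∂/∂t, ∂/∂s) has three terms. Two of them differentiate along t or s and
    -- vanish by `hline`, and the third is the derivative along x of the coefficient of dt ∧ ds.
    have h3 := hcl (q, 0) hq ![(x, 0), vecT, vecS] (by
      intro i
      fin_cases i
      · exact hx
      · simp [vecT]
      · simp [vecS])
    rw [extDeriv_two_apply (hB.differentiable (by simp) _)] at h3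
    have hline : ∀ e : Amb, e.1 = 0 → ∀ e' : Amb, e'.1 = 0 →
        fderiv ℝ B (q, 0) e ![(x, 0), e'] = 0 := by
      intro e he e' he'
      refine fderiv_form_eq_zero_of_line_const hB fun r => ?_
      have ht : ∀ i, inner ℝ (n q) ((![(x, 0), e'] : Fin 2 → Amb) i).1 = 0 := by
        intro i
        fin_cases i
        · exact hx
        · simp [he']
      have e1 : ((q, 0) + r • e : Amb).1 = q := by simp [he]
      rw [htr _ (by rw [e1]; exact hq) _ (by rw [e1]; exact ht), e1]
    rw [hline vecT rfl vecS rfl, hline vecS rfl vecT rfl] at h3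
    change _ = (0 : ℝ) at h3
    change fderiv ℝ (fun y => B y ![vecT, vecS]) (q, 0) (x, 0) = 0
    rw [fderiv_continuousAlternatingMap_apply_const_apply (hB.differentiable (by simp) _)]
    linarith
  obtain ⟨p, hp⟩ := hS.isConnected.nonempty
  refine ⟨f p, fun y hy v hv => ?_⟩
  rw [htr y hy v hv]
  change _ = cylinderForm (sliceForm B) y v + f p * dtdsAmb y v
  rw [cylinderForm_apply, sliceForm_apply, dtdsAmb_apply, hconst p hp _ hy]
  have hv2 : v = ![v 0, v 1] := by ext1 i; fin_cases i <;> rfl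
  have hv3 : (fun i => ((v i).1, (0 : ℝ × ℝ))) = ![((v 0).1, 0), ((v 1).1, 0)] := by
    ext1 i
    fin_cases i <;> rfl
  rw [hv3]
  conv_lhs => rw [hv2]
  rw [twoForm_expand, hmixed vecT rfl _ hy _ (hv 0), hmixed vecT rfl _ hy _ (hv 1),
    hmixed vecS rfl _ hy _ (hv 0), hmixed vecS rfl _ hy _ (hv 1)]
  ring

/-- The average of a form over the four rotations `signMap`. -/
noncomputable def signAverage {k : ℕ} (b : E3 → E3 [⋀^Fin k]→L[ℝ] ℝ) :
    E3 → E3 [⋀^Fin k]→L[ℝ] ℝ :=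
  (1 / 4 : ℝ) • ∑ g : ℤˣ × ℤˣ, formPullback (signMap g.1 g.2) b

theorem signAverage_apply {k : ℕ} (b : E3 → E3 [⋀^Fin k]→L[ℝ] ℝ) (x : E3) (v : Fin k → E3) :
    signAverage b x v =
      (1 / 4 : ℝ) * ∑ g : ℤˣ × ℤˣ, b (signMap g.1 g.2 x) fun i => signMap g.1 g.2 (v i) := by
  rw [signAverage]
  simp [formPullback_apply]

theorem contDiff_signAverage {k : ℕ} {b : E3 → E3 [⋀^Fin k]→L[ℝ] ℝ} (hb : ContDiff ℝ ∞ b) :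
    ContDiff ℝ ∞ (signAverage b) := by
  refine ContDiff.const_smul_form ?_ _
  have : (∑ g : ℤˣ × ℤˣ, formPullback (signMap g.1 g.2) b) =
      fun x => ∑ g : ℤˣ × ℤˣ, formPullback (signMap g.1 g.2) b x := by
    ext1 x
    simp
  rw [this]
  exact ContDiff.sum fun g _ => (signMap g.1 g.2).contDiff.formPullback hb

theorem extDeriv_signAverage {k : ℕ} {b : E3 → E3 [⋀^Fin k]→L[ℝ] ℝ} (hb : ContDiff ℝ ∞ b) :
    extDeriv (signAverage b) = signAverage (extDeriv b) := by
  rw [signAverage, signAverage, extDeriv_const_smul]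
  congr 1
  have hsum : ∀ t : Finset (ℤˣ × ℤˣ),
      ContDiff ℝ ∞ (∑ g ∈ t, formPullback (signMap g.1 g.2) b) ∧
      extDeriv (∑ g ∈ t, formPullback (signMap g.1 g.2) b) =
        ∑ g ∈ t, formPullback (signMap g.1 g.2) (extDeriv b) := by
    intro t
    classical
    induction t using Finset.induction_on with
    | empty =>
      simp only [Finset.sum_empty]
      refine ⟨contDiff_const, ?_⟩
      simpa using extDeriv_const_smul (0 : ℝ) (0 : E3 → E3 [⋀^Fin k]→L[ℝ] ℝ)
    | insert a t ha ih =>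
      have h1 := (signMap a.1 a.2).contDiff.formPullback hb
      rw [Finset.sum_insert ha, Finset.sum_insert ha, extDeriv_add_of_contDiff h1 ih.1, ih.2]
      refine ⟨h1.add ih.1, ?_⟩
      congr 1
      ext1 x
      exact extDeriv_formPullback hb (signMap a.1 a.2).contDiff.contDiffAt
  exact (hsum _).2

theorem signAverage_signMap {k : ℕ} (b : E3 → E3 [⋀^Fin k]→L[ℝ] ℝ) (u w : ℤˣ) (x : E3)
    (v : Fin k → E3) :
    signAverage b (signMap u w x) (fun i => signMap u w (v i)) = signAverage b x v := by
  rw [signAverage_apply, signAverage_apply]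
  congr 1
  refine Fintype.sum_equiv (Equiv.mulRight (u, w)) _ _ fun g => ?_
  simp only [signMap_signMap, Equiv.coe_mulRight, Prod.fst_mul, Prod.snd_mul]

theorem signAverage_surfEq (hsym : IsSymmetricSurface S n) {k : ℕ}
    {b b' : E3 → E3 [⋀^Fin k]→L[ℝ] ℝ} (h : SurfEq S n b b') :
    SurfEq S n (signAverage b) (signAverage b') := by
  intro q hq v hv
  rw [signAverage_apply, signAverage_apply]
  congr 1
  refine Finset.sum_congr rfl fun g _ => ?_
  refine h _ (hsym.mapsTo _ _ _ hq) _ fun i => ?_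
  rw [hsym.normal _ _ _ hq, inner_signMap, hv]

theorem isSymInvariant_cylinderForm_signAverage {k : ℕ} (b : E3 → E3 [⋀^Fin k]→L[ℝ] ℝ) :
    IsSymInvariant S n (cylinderForm (signAverage b)) := by
  intro g y hy v hv
  rw [cylinderForm_apply, cylinderForm_apply, symMap_fst]
  simp only [symLin_apply]
  exact signAverage_signMap b _ _ _ _

/-- A form which is invariant under the rotations agrees with its average. -/
theorem signAverage_eq_self {k : ℕ} {b : E3 → E3 [⋀^Fin k]→L[ℝ] ℝ}
    (h : ∀ u w : ℤˣ, ∀ q ∈ S, ∀ v : Fin k → E3, (∀ i, inner ℝ (n q) (v i) = 0) →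
      b (signMap u w q) (fun i => signMap u w (v i)) = b q v) :
    SurfEq S n (signAverage b) b := by
  intro q hq v hv
  rw [signAverage_apply, Finset.sum_congr rfl fun g _ => h g.1 g.2 q hq v hv]
  simp [Fintype.card_prod, Fintype.card_units_int]

theorem ambEq_cylinderForm {k : ℕ} {b b' : E3 → E3 [⋀^Fin k]→L[ℝ] ℝ} (h : SurfEq S n b b') :
    AmbEq S n (cylinderForm b) (cylinderForm b') := by
  intro y hy v hv
  rw [cylinderForm_apply, cylinderForm_apply]
  exact h _ hy _ hv

end Spanning

/-! ### Cohomology of the invariant forms -/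

section InvariantCohomology

open MeasureTheory

variable {S : Set E3} {n : E3 → E3}

theorem tangent_smul_eq_zero {e : Amb} (he : e.1 = 0) (y : Amb) (r : ℝ) :
    (y + r • e).1 = y.1 := by
  simp [he]

theorem averageAlong_line_const {k : ℕ} {B : Amb → Amb [⋀^Fin k]→L[ℝ] ℝ} (hB : ContDiff ℝ ∞ B)
    {e : Amb} {T : ℝ} (hT : 0 < T) (he : e.1 = 0)
    (hper : ∀ y : Amb, y.1 ∈ S → ∀ v : Fin k → Amb, (∀ i, inner ℝ (n y.1) (v i).1 = 0) →
      B (y + (2 * T) • e) v = B y v) {y : Amb} (hy : y.1 ∈ S) {v : Fin k → Amb}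
    (hv : ∀ i, inner ℝ (n y.1) (v i).1 = 0) (c : ℝ) :
    averageAlong e T B (y + c • e) v = averageAlong e T B y v := by
  refine averageAlong_add_smul hT hB (fun a => ?_) c
  rw [add_smul, ← add_assoc]
  refine hper _ ?_ _ ?_
  · rwa [tangent_smul_eq_zero he]
  · rwa [tangent_smul_eq_zero he]

/-- A closed invariant `2`-form is a combination of the area form and of `dt ∧ ds`, up to the
exterior derivative of an invariant `1`-form. -/
theorem exists_eq_area_add_dtds_add_exact (hS : IsNormalSurface S n)
    (hsym : IsSymmetricSurface S n) {B : Amb → Amb [⋀^Fin 2]→L[ℝ] ℝ} (hB : ContDiff ℝ ∞ B)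
    (hinv : IsSymInvariant S n B) (hcl : AmbEq S n (extDeriv B) 0) :
    ∃ (a b : ℝ) (η : Amb → Amb [⋀^Fin 1]→L[ℝ] ℝ), ContDiff ℝ ∞ η ∧ IsSymInvariant S n η ∧
      AmbEq S n B (a • areaAmb n + b • dtdsAmb + extDeriv η) := by
  -- The half-length 2 matches the period 4 in t. The half-length 1 used below for s matches the
  -- period 2.
  set B₁ := averageAlong vecT 2 B with hB₁
  set η₁ := averagePrimitive vecT 2 B with hη₁
  have sB₁ : ContDiff ℝ ∞ B₁ := contDiff_averageAlong _ _ hB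
  have sη₁ : ContDiff ℝ ∞ η₁ := contDiff_averagePrimitive _ _ hB
  have iB₁ : IsSymInvariant S n B₁ := hinv.averageAlong hB rfl symLin_vecT_eq_or 2
  have iη₁ : IsSymInvariant S n η₁ := hinv.averagePrimitive hB rfl symLin_vecT_eq_or 2
  have d₁ : AmbEq S n (extDeriv η₁) (B₁ - B) := extDeriv_averagePrimitive rfl 2 hB hcl
  -- Adding an exact form preserves closedness along S × ℝ × ℝ. This is needed before averaging a
  -- second time.
  have closed : ∀ {B B' : Amb → Amb [⋀^Fin 2]→L[ℝ] ℝ} {η : Amb → Amb [⋀^Fin 1]→L[ℝ] ℝ},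
      ContDiff ℝ ∞ B → ContDiff ℝ ∞ B' → ContDiff ℝ ∞ η → AmbEq S n (extDeriv B) 0 →
      AmbEq S n (extDeriv η) (B' - B) → AmbEq S n (extDeriv B') 0 := by
    intro B B' η hB hB' hη h hd
    have h1 := AmbEq.extDeriv hS hη.extDeriv (hB'.sub hB) hd
    rw [extDeriv_extDeriv_of_contDiff hη] at h1
    have h2 : AmbEq S n (extDeriv (B' - B)) 0 := h1.symm
    rw [extDeriv_sub_of_contDiff hB' hB] at h2
    have h3 := h2.add h
    rwa [sub_add_cancel, add_zero] at h3
  have c₁ : AmbEq S n (extDeriv B₁) 0 := closed hB sB₁ sη₁ hcl d₁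
  set B₂ := averageAlong vecS 1 B₁ with hB₂
  set η₂ := averagePrimitive vecS 1 B₁ with hη₂
  have sB₂ : ContDiff ℝ ∞ B₂ := contDiff_averageAlong _ _ sB₁
  have sη₂ : ContDiff ℝ ∞ η₂ := contDiff_averagePrimitive _ _ sB₁
  have iB₂ : IsSymInvariant S n B₂ := iB₁.averageAlong sB₁ rfl symLin_vecS_eq_or 1
  have iη₂ : IsSymInvariant S n η₂ := iB₁.averagePrimitive sB₁ rfl symLin_vecS_eq_or 1
  have d₂ : AmbEq S n (extDeriv η₂) (B₂ - B₁) := extDeriv_averagePrimitive rfl 1 sB₁ c₁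
  have c₂ : AmbEq S n (extDeriv B₂) 0 := closed sB₁ sB₂ sη₂ c₁ d₂
  have tr₁ : ∀ y : Amb, y.1 ∈ S → ∀ v : Fin 2 → Amb, (∀ i, inner ℝ (n y.1) (v i).1 = 0) →
      ∀ c : ℝ, B₁ (y + c • vecT) v = B₁ y v := fun y hy v hv c =>
    averageAlong_line_const hB two_pos rfl (fun y hy v hv => by
      rw [show (2 : ℝ) * 2 = 4 by norm_num]
      exact hinv.periodic_t hy hv) hy hv c
  have trs : ∀ y : Amb, y.1 ∈ S → ∀ v : Fin 2 → Amb, (∀ i, inner ℝ (n y.1) (v i).1 = 0) →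
      ∀ c : ℝ, B₂ (y + c • vecS) v = B₂ y v := fun y hy v hv c =>
    averageAlong_line_const sB₁ one_pos rfl (fun y hy v hv => by
      rw [mul_one]
      exact iB₁.periodic_s hy hv) hy hv c
  have trt : ∀ y : Amb, y.1 ∈ S → ∀ v : Fin 2 → Amb, (∀ i, inner ℝ (n y.1) (v i).1 = 0) →
      ∀ c : ℝ, B₂ (y + c • vecT) v = B₂ y v := by
    intro y hy v hv c
    rw [hB₂, averageAlong_apply _ _ sB₁, averageAlong_apply _ _ sB₁]
    refine intervalIntegral.integral_congr fun r _ => ?_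
    have e1 : y + c • vecT + (r * 1) • vecS = y + (r * 1) • vecS + c • vecT := by abel
    have e2 : y + c • vecT - (r * 1) • vecS = y - (r * 1) • vecS + c • vecT := by abel
    have e3 : (y + (r * 1) • vecS).1 = y.1 := by simp [vecS]
    have e4 : (y - (r * 1) • vecS).1 = y.1 := by simp [vecS]
    beta_reduce
    rw [e1, e2, tr₁ _ (by rwa [e3]) v (by rwa [e3]), tr₁ _ (by rwa [e4]) v (by rwa [e4])]
  have tr : ∀ y : Amb, y.1 ∈ S → ∀ v : Fin 2 → Amb, (∀ i, inner ℝ (n y.1) (v i).1 = 0) →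
      B₂ y v = B₂ (y.1, 0) v := by
    intro y hy v hv
    have e : y = (y.1, 0) + y.2.1 • vecT + y.2.2 • vecS := by
      conv_lhs => rw [amb_eq_add y]
      rw [add_assoc]
    have e' : ((y.1, 0) + y.2.1 • vecT : Amb).1 = y.1 := by simp [vecT]
    conv_lhs => rw [e]
    rw [trs _ (by rwa [e']) v (by rwa [e'])]
    exact trt (y.1, 0) hy v hv _
  obtain ⟨b, hb⟩ := ambEq_of_translation_invariant hS sB₂ iB₂ c₂ tr
  set b₀ := sliceForm B₂ with hb₀
  have sb₀ : ContDiff ℝ ∞ b₀ := contDiff_sliceForm sB₂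
  obtain ⟨a, η₀, sη₀, hη₀⟩ := hS.isMultipleModExact_area sb₀
  have sΩ : ContDiff ℝ ∞ fun x => volContract (n x) := contDiff_volContract.comp hS.smooth
  have hΩ : ∀ u w : ℤˣ, ∀ q ∈ S, ∀ v : Fin 2 → E3, (∀ i, inner ℝ (n q) (v i) = 0) →
      volContract (n (signMap u w q)) (fun i => signMap u w (v i)) = volContract (n q) v := by
    intro u w q hq v hv
    rw [volContract_apply, volContract_apply, hsym.normal _ _ _ hq, vol3_signMap]
  have hb₀inv : ∀ u w : ℤˣ, ∀ q ∈ S, ∀ v : Fin 2 → E3, (∀ i, inner ℝ (n q) (v i) = 0) →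
      b₀ (signMap u w q) (fun i => signMap u w (v i)) = b₀ q v := by
    intro u w q hq v hv
    -- A deck transformation that applies γ also shifts t by -2m. The shift is harmless because B₂
    -- does not depend on t and s, by `tr`.
    obtain ⟨m, hm⟩ : ∃ m : ℤ, Int.negOnePow m = w := by
      rcases Int.units_eq_one_or w with rfl | rfl
      · exact ⟨0, Int.negOnePow_zero⟩
      · exact ⟨1, Int.negOnePow_one⟩
    have h1 := iB₂ (1, u, m, 0) (q, 0) hq (fun i => (v i, 0)) hv
    have e1 : (symMap (1, u, m, 0) (q, 0)).1 = signMap u w q := by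
      rw [symMap_fst, ← hm]
    have e2 : (fun i => symLin (1, u, m, 0) (v i, 0)) = fun i => (signMap u w (v i), 0) := by
      ext1 i
      rw [symLin_apply, ← hm]
      ext <;> simp
    rw [tr _ (by rw [e1]; exact hsym.mapsTo _ _ _ hq) _ (fun i => hsym.inner_symLin _ hq (hv i)),
      e1, e2] at h1
    rw [hb₀, sliceForm_apply, sliceForm_apply, h1]
  -- The primitive on S need not be invariant. Its average over the four rotations is, and it is
  -- still a primitive because b₀ and the area form are invariant.
  set η₀' := signAverage η₀ with hη₀'
  have sη₀' : ContDiff ℝ ∞ η₀' := contDiff_signAverage sη₀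
  have hav : SurfEq S n b₀ (a • (fun x => volContract (n x)) + extDeriv η₀') := by
    rw [hη₀', extDeriv_signAverage sη₀]
    intro q hq v hv
    have h1 := signAverage_surfEq hsym hη₀ q hq v hv
    have h2 := signAverage_eq_self hb₀inv q hq v hv
    have h3 := signAverage_eq_self (b := fun x => volContract (n x)) hΩ q hq v hv
    have h4 : signAverage (a • (fun x => volContract (n x)) + extDeriv η₀) q v =
        a * signAverage (fun x => volContract (n x)) q v + signAverage (extDeriv η₀) q v := by
      rw [signAverage_apply, signAverage_apply, signAverage_apply, mul_left_comm, ← mul_add]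
      congr 1
      rw [Finset.mul_sum, ← Finset.sum_add_distrib]
      rfl
    rw [← h2, h1, h4, h3]
    rfl
  have sη' : ContDiff ℝ ∞ (cylinderForm η₀' - η₁) := (contDiff_cylinderForm sη₀').sub sη₁
  -- From dη₁ = B₁ - B and dη₂ = B₂ - B₁ one gets B = B₂ - dη₁ - dη₂, which accounts for the signs.
  refine ⟨a, b, cylinderForm η₀' - η₁ - η₂, sη'.sub sη₂,
    ((isSymInvariant_cylinderForm_signAverage η₀).sub iη₁).sub iη₂, ?_⟩
  rw [extDeriv_sub_of_contDiff sη' sη₂,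
    extDeriv_sub_of_contDiff (contDiff_cylinderForm sη₀') sη₁]
  have hd : extDeriv (cylinderForm η₀') = cylinderForm (extDeriv η₀') :=
    funext fun y => extDeriv_formPullback sη₀' contDiffAt_fst
  rw [hd]
  intro y hy v hv
  have h1 := d₁ y hy v hv
  have h2 := d₂ y hy v hv
  have h3 := hb y hy v hv
  have h4 := ambEq_cylinderForm hav y hy v hv
  have h5 : cylinderForm (a • (fun x => volContract (n x)) + extDeriv η₀') y v =
      a * areaAmb n y v + cylinderForm (extDeriv η₀') y v := by
    rw [cylinderForm_apply, cylinderForm_apply, areaAmb_apply]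
    rfl
  change _ = B₁ y v - B y v at h1
  change _ = B₂ y v - B₁ y v at h2
  change _ = cylinderForm b₀ y v + b * dtdsAmb y v at h3
  change _ = a * areaAmb n y v + b * dtdsAmb y v +
    (cylinderForm (extDeriv η₀') y v - extDeriv η₁ y v - extDeriv η₂ y v)
  linarith

/-- The area form and `dt ∧ ds` are independent modulo exterior derivatives of invariant forms. -/
theorem eq_zero_of_area_add_dtds_exact (hS : IsNormalSurface S n) {a b : ℝ}
    {η : Amb → Amb [⋀^Fin 1]→L[ℝ] ℝ} (hη : ContDiff ℝ ∞ η) (hinv : IsSymInvariant S n η)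
    (h : AmbEq S n (a • areaAmb n + b • dtdsAmb) (extDeriv η)) : a = 0 ∧ b = 0 := by
  have hval : ∀ y : Amb, y.1 ∈ S → ∀ v : Fin 2 → Amb, (∀ i, inner ℝ (n y.1) (v i).1 = 0) →
      a * vol3 (n y.1) (v 0).1 (v 1).1 + b * ((v 0).2.1 * (v 1).2.2 - (v 1).2.1 * (v 0).2.2)
        = extDeriv η y v := by
    intro y hy v hv
    rw [← areaAmb_apply, ← dtdsAmb_apply y]
    exact h y hy v hv
  constructor
  · by_contra ha
    -- On the slice S × 0 × 0 the form dt ∧ ds vanishes, so a ≠ 0 would give a primitive of the area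
    -- form of S.
    have s1 := contDiff_sliceForm hη
    refine hS.not_surfEq_extDeriv (s1.const_smul_form a⁻¹) ?_
    rw [extDeriv_const_smul]
    intro q hq v hv
    have h1 := hval (q, 0) hq (fun i => (v i, 0)) hv
    have h2 : extDeriv (sliceForm η) q = sliceForm (extDeriv η) q :=
      extDeriv_formPullback hη (ContinuousLinearMap.contDiff _).contDiffAt
    change _ = a⁻¹ * extDeriv (sliceForm η) q v
    rw [h2, sliceForm_apply, ← h1, volContract_apply]
    field_simp
    simp
  · obtain ⟨p, hp⟩ := hS.isConnected.nonempty
    -- On {p} × ℝ × ℝ the area form vanishes and η = G dt + F ds, so b = ∂F/∂t - ∂G/∂s.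
    set F : ℝ × ℝ → ℝ := fun z => η (p, z) ![vecS] with hF
    set G : ℝ × ℝ → ℝ := fun z => η (p, z) ![vecT] with hG
    have sη : ∀ e : Amb, ContDiff ℝ ∞ fun y => η y ![e] := fun e =>
      hη.alternating_apply contDiff_const
    have hder : ∀ (e : Amb) (z z' : ℝ × ℝ), HasFDerivAt (fun z => η (p, z) ![e])
        ((fderiv ℝ (fun y => η y ![e]) (p, z)).comp (ContinuousLinearMap.inr ℝ E3 (ℝ × ℝ))) z :=
      fun e z _ => ((sη e).differentiable (by simp) _).hasFDerivAt.comp z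
        (hasFDerivAt_prodMk_right p z)
    have hder' : ∀ (e : Amb) (z z' : ℝ × ℝ), fderiv ℝ (fun z => η (p, z) ![e]) z z' =
        fderiv ℝ η (p, z) (0, z') ![e] := by
      intro e z z'
      rw [(hder e z z').fderiv]
      exact fderiv_continuousAlternatingMap_apply_const_apply (hη.differentiable (by simp) _) _ _
    have hb : ∀ z, fderiv ℝ F z (1, 0) = b + fderiv ℝ G z (0, 1) := by
      intro z
      have h1 := hval (p, z) hp ![vecT, vecS] (by
        intro i
        fin_cases i <;> simp [vecT, vecS])
      rw [extDeriv_one_apply (hη.differentiable (by simp) _)] at h1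
      rw [hder' vecS, hder' vecT]
      have h2 : vol3 (n p) (vecT).1 (vecS).1 = 0 := by
        rw [vol3_eq]
        simp [vecT, vecS]
      simp only [Matrix.cons_val_zero, Matrix.cons_val_one, h2] at h1
      simp only [vecT, vecS] at h1 ⊢
      linarith
    have sF : ContDiff ℝ ∞ F := (sη vecS).comp (contDiff_const.prodMk contDiff_id)
    have sG : ContDiff ℝ ∞ G := (sη vecT).comp (contDiff_const.prodMk contDiff_id)
    have hper : ∀ e : Amb, e.1 = 0 → ∀ t s : ℝ, η (p, (t + 4, s)) ![e] = η (p, (t, s)) ![e] ∧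
        η (p, (t, s + 2)) ![e] = η (p, (t, s)) ![e] := by
      intro e he t s
      have hv : ∀ i, inner ℝ (n p) ((![e] : Fin 1 → Amb) i).1 = 0 := by
        intro i
        fin_cases i
        simp [he]
      have h1 := hinv.periodic_t (y := (p, (t, s))) hp hv
      have h2 := hinv.periodic_s (y := (p, (t, s))) hp hv
      have e1 : ((p, (t, s)) : Amb) + (4 : ℝ) • vecT = (p, (t + 4, s)) := by
        rw [vecT]
        ext <;> simp
      have e2 : ((p, (t, s)) : Amb) + (2 : ℝ) • vecS = (p, (t, s + 2)) := by
        rw [vecS]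
        ext <;> simp
      rw [e1] at h1
      rw [e2] at h2
      exact ⟨h1, h2⟩
    -- Periodicity of G in s gives Φ' = 2b, and periodicity of F in t gives Φ(4) = Φ(0). Hence b =
    -- 0.
    set Φ : ℝ → ℝ := fun t => ∫ s in (0 : ℝ)..2, F (t, s) with hΦ
    have hΦd : ∀ t, HasDerivAt Φ (2 * b) t := by
      intro t
      have h1 := (hasFDerivAt_intervalIntegral_of_contDiff (sF.of_le (by simp)) 0 2 t).hasDerivAt
      have hcont : Continuous fun s : ℝ => (fderiv ℝ F (t, s)).comp
          (ContinuousLinearMap.inl ℝ ℝ ℝ) :=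
        ((sF.continuous_fderiv (by simp)).comp (by fun_prop)).clm_comp continuous_const
      refine h1.congr_deriv ?_
      refine (ContinuousLinearMap.intervalIntegral_apply
        (hcont.intervalIntegrable 0 2) 1).trans ?_
      have hGc : Continuous fun s : ℝ => fderiv ℝ G (t, s) (0, 1) :=
        ((sG.continuous_fderiv (by simp)).comp (by fun_prop)).clm_apply continuous_const
      have h2 : ∀ s, HasDerivAt (fun s => G (t, s)) (fderiv ℝ G (t, s) (0, 1)) s := by
        intro s
        exact (sG.differentiable (by simp) (t, s)).hasFDerivAt.comp_hasDerivAt s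
          ((hasDerivAt_const s t).prodMk (hasDerivAt_id s))
      have h3 := intervalIntegral.integral_eq_sub_of_hasDerivAt (fun s _ => h2 s)
        (hGc.intervalIntegrable 0 2)
      have h4 : G (t, 2) = G (t, 0) := by
        have := (hper vecT rfl t 0).2
        rwa [zero_add] at this
      calc _ = ∫ s in (0 : ℝ)..2, (b + fderiv ℝ G (t, s) (0, 1)) :=
            intervalIntegral.integral_congr fun s _ => hb (t, s)
        _ = 2 * b := by
            rw [intervalIntegral.integral_add intervalIntegrable_const
              (hGc.intervalIntegrable 0 2), h3, h4]
            simp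
    have h1 := intervalIntegral.integral_eq_sub_of_hasDerivAt (a := 0) (b := 4)
      (fun t _ => hΦd t) intervalIntegrable_const
    have h2 : Φ 4 = Φ 0 := by
      refine intervalIntegral.integral_congr fun s _ => ?_
      have := (hper vecS rfl 0 s).1
      rwa [zero_add] at this
    rw [h2, sub_self] at h1
    simpa using h1

end InvariantCohomology

/-! ### Equivariance of the outer normal -/

section Equivariance

theorem signMap_neg_one_one (x : E3) : signMap (-1) 1 x = phi3 x := by
  ext i
  fin_cases i <;> simp [signMap_apply, phi3, unitSign]

theorem signMap_one_neg_one (x : E3) : signMap 1 (-1) x = gamma3 x := by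
  ext i
  fin_cases i <;> simp [signMap_apply, gamma3, unitSign]

theorem IsPlaneSymmetric.signMap_mem {S : Set E3} (hS : IsPlaneSymmetric S) (u w : ℤˣ) {x : E3}
    (hx : x ∈ S) : signMap u w x ∈ S := by
  have h : signMap u w x = signMap u 1 (signMap 1 w x) := by
    rw [signMap_signMap, mul_one, one_mul]
  rw [h]
  have h1 : ∀ w : ℤˣ, ∀ x ∈ S, signMap 1 w x ∈ S := by
    intro w x hx
    rcases Int.units_eq_one_or w with rfl | rfl
    · rwa [signMap_one]
    · rw [signMap_one_neg_one]
      exact hS.mapsTo_gamma3 hx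
  rcases Int.units_eq_one_or u with rfl | rfl
  · exact h1 1 _ (h1 w x hx)
  · rw [signMap_neg_one_one]
    exact hS.mapsTo_phi3 (h1 w x hx)

/-- A vector orthogonal to all tangent vectors is a multiple of the normal vector. -/
theorem IsNormalSurface.eq_smul_of_orthogonal {S : Set E3} {n : E3 → E3} (hS : IsNormalSurface S n)
    {p : E3} (hp : p ∈ S) {w : E3} (hw : ∀ v, inner ℝ (n p) v = 0 → inner ℝ w v = 0) :
    w = (inner ℝ (n p) w : ℝ) • n p := by
  have hn : inner ℝ (n p) (n p) = (1 : ℝ) := by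
    rw [real_inner_self_eq_norm_sq, hS.norm_eq_one p hp, one_pow]
  set r : E3 := w - (inner ℝ (n p) w : ℝ) • n p with hr
  have h1 : inner ℝ (n p) r = (0 : ℝ) := by
    rw [hr, inner_sub_right, inner_smul_right, hn]
    ring
  have h2 : inner ℝ r r = (0 : ℝ) := by
    conv_lhs => rw [hr]
    rw [inner_sub_left, inner_smul_left, h1, hw r h1]
    simp
  rw [inner_self_eq_zero] at h2
  rw [h2] at hr
  exact (sub_eq_zero.1 hr.symm)

theorem signMap_mul_self (u w : ℤˣ) (x : E3) : signMap u w (signMap u w x) = x := by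
  rw [signMap_signMap, Int.units_mul_self, Int.units_mul_self, signMap_one]

/-- The rotation is an involution of S, so composing it with a parametrization near the image point
gives a map into S through p. Its derivatives are orthogonal to n(p), and applying the isometry
moves this statement to the image point. -/
theorem IsNormalSurface.inner_signMap_normal {S : Set E3} {n : E3 → E3}
    (hS : IsNormalSurface S n) (hm : ∀ u w : ℤˣ, ∀ x ∈ S, signMap u w x ∈ S) (u w : ℤˣ) {p : E3}
    (hp : p ∈ S) {v : E3} (hv : inner ℝ (n (signMap u w p)) v = 0) :
    inner ℝ (signMap u w (n p)) v = 0 := by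
  obtain ⟨P, O, V, ψ, m, hV, hpt⟩ := hS.exists_patch _ (hm u w p hp)
  have hmem : signMap u w p ∈ S ∩ V := ⟨hm u w p hp, hV⟩
  have hO := hpt.proj_mem _ hV
  have h1 : HasFDerivAt (fun z => signMap u w (ψ z))
      ((signMap u w).comp (fderiv ℝ ψ (P (signMap u w p)))) (P (signMap u w p)) :=
    (signMap u w).hasFDerivAt.comp _ (hpt.hasFDerivAt hO)
  have h2 := hS.inner_hasFDerivAt_eq_zero h1 (by
    filter_upwards [hpt.isOpen_O.mem_nhds hO] with z hz
    exact hm u w _ (hpt.mem z hz).1) (P v)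
  rw [hpt.param_proj _ hmem, signMap_mul_self, ContinuousLinearMap.comp_apply,
    hpt.fderiv_proj hmem hv, ← inner_signMap u w, signMap_mul_self] at h2
  exact h2

/-- The rotation is an isometry that preserves the complement of S, so it maps the component of x
into the component of the image of x. -/
theorem not_isBounded_connectedComponentIn_signMap {S : Set E3}
    (hm : ∀ u w : ℤˣ, ∀ x ∈ S, signMap u w x ∈ S) (u w : ℤˣ) {x : E3} (hx : x ∉ S)
    (h : ¬ Bornology.IsBounded (connectedComponentIn Sᶜ x)) :
    ¬ Bornology.IsBounded (connectedComponentIn Sᶜ (signMap u w x)) := by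
  intro hb
  apply h
  have hsub : signMap u w '' connectedComponentIn Sᶜ x ⊆
      connectedComponentIn Sᶜ (signMap u w x) := by
    refine (isPreconnected_connectedComponentIn.image _
      (signMap u w).continuous.continuousOn).subset_connectedComponentIn
      ⟨x, mem_connectedComponentIn hx, rfl⟩ ?_
    rintro _ ⟨y, hy, rfl⟩ hyS
    refine connectedComponentIn_subset _ _ hy ?_
    have := hm u w _ hyS
    rwa [signMap_mul_self] at this
  obtain ⟨R, hR⟩ := (hb.subset hsub).exists_norm_le
  refine isBounded_iff_forall_norm_le.2 ⟨R, fun y hy => ?_⟩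
  rw [← norm_signMap u w]
  exact hR _ ⟨y, hy, rfl⟩

/-- The outer unit normal field of a surface that is symmetric with respect to the coordinate
planes is equivariant. -/
theorem IsOuterUnitNormal.isSymmetricSurface {S : Set E3} [ChartedSpace E2 S] {N : S → E3}
    (hN : IsOuterUnitNormal S N) (hS : IsPlaneSymmetric S) {n : E3 → E3}
    (hn : IsNormalSurface S n) (hnN : ∀ q : S, n q = N q) : IsSymmetricSurface S n where
  mapsTo u w x hx := hS.signMap_mem u w hx
  normal u w p hp := by
    have hm : ∀ u w : ℤˣ, ∀ x ∈ S, signMap u w x ∈ S := fun u w x hx => hS.signMap_mem u w hx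
    set q := signMap u w p with hq
    have hqS : q ∈ S := hm u w p hp
    have h1 := hn.eq_smul_of_orthogonal hqS fun v hv => hn.inner_signMap_normal hm u w hp hv
    set c : ℝ := inner ℝ (n q) (signMap u w (n p)) with hc
    have hcabs : |c| = 1 := by
      have := congrArg norm h1
      rw [norm_signMap, hn.norm_eq_one p hp, norm_smul, hn.norm_eq_one q hqS, mul_one] at this
      exact this.symm
    rcases (abs_eq zero_le_one).1 hcabs with h | h
    · rw [h1, h, one_smul]
    -- If the rotated normal were the inner one, a point slightly outside S near p would be carried
    -- to a point slightly inside S near q, hence from an unbounded component to a bounded one.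
    · exfalso
      rw [h] at h1
      obtain ⟨r, ⟨hr1, hr2⟩, hr3, hr4⟩ := ((hN.outside ⟨p, hp⟩).and (hN.inside ⟨q, hqS⟩)).exists
      refine not_isBounded_connectedComponentIn_signMap hm u w hr1 hr2 ?_
      have h2 : signMap u w (p + r • N ⟨p, hp⟩) = q - r • N ⟨q, hqS⟩ := by
        rw [map_add, map_smul, ← hnN, ← hnN, h1, ← hq, neg_one_smul, smul_neg, sub_eq_add_neg]
      rw [h2]
      exact hr4

theorem exists_normal_extension {S : Set E3} [ChartedSpace E2 S] [IsManifold (𝓡 2) ∞ S] {g : ℕ}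
    (hgenus : IsEmbeddedSurfaceOfGenus S g) (hS : IsPlaneSymmetric S) {N : S → E3}
    (hN : IsOuterUnitNormal S N) :
    ∃ n : E3 → E3, IsNormalSurface S n ∧ IsSymmetricSurface S n ∧ ∀ q : S, n q = N q := by
  obtain ⟨n, hn, hnN⟩ := exists_isNormalSurface hN.smooth hN.orthogonal hN.norm_eq_one
    hgenus.isSmoothEmbedding.isImmersion hgenus.isCompact hgenus.isConnected
  exact ⟨n, hn, hN.isSymmetricSurface hS hn hnN, hnN⟩

end Equivariance

/-! ### The projection onto X and its fibres -/

section QuotientTopology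

variable {S : Set E3} (hS : IsPlaneSymmetric S)

/-- The inclusion of `S × ℝ × ℝ` in `ℝ³ × ℝ × ℝ`. -/
def toAmb (y : S × ℝ × ℝ) : Amb := (y.1, y.2)

theorem toAmb_injective : Function.Injective (toAmb (S := S)) := fun _ _ h =>
  Prod.ext (Subtype.ext (congrArg (fun z : Amb => z.1) h)) (congrArg (fun z : Amb => z.2) h)

theorem continuous_toAmb : Continuous (toAmb (S := S)) :=
  (continuous_subtype_val.comp continuous_fst).prodMk continuous_snd

theorem isEmbedding_toAmb : IsEmbedding (toAmb (S := S)) :=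
  IsEmbedding.subtypeVal.prodMap IsEmbedding.id

/-- The rotation `signMap` of the surface. -/
noncomputable def surfaceSign (u w : ℤˣ) (p : S) : S := ⟨signMap u w p, hS.signMap_mem u w p.2⟩

/-- The deck transformations of `S × ℝ × ℝ`. -/
noncomputable def symAct (g : SymIndex) (y : S × ℝ × ℝ) : S × ℝ × ℝ :=
  (surfaceSign hS g.2.1 (Int.negOnePow g.2.2.1) y.1, unitSign g.1 * y.2.1 - 2 * (g.2.2.1 : ℝ),
    unitSign g.1 * y.2.2 + 2 * (g.2.2.2 : ℝ))

theorem toAmb_symAct (g : SymIndex) (y : S × ℝ × ℝ) :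
    toAmb (symAct hS g y) = symMap g (toAmb y) := by
  rw [symMap_apply]
  rfl

theorem continuous_surfaceSign (u w : ℤˣ) : Continuous (surfaceSign hS u w) :=
  ((signMap u w).continuous.comp continuous_subtype_val).subtype_mk _

theorem continuous_symAct (g : SymIndex) : Continuous (symAct hS g) := by
  refine ((continuous_surfaceSign hS _ _).comp continuous_fst).prodMk ?_
  fun_prop

theorem symAct_symAct (g h : SymIndex) (y : S × ℝ × ℝ) :
    symAct hS g (symAct hS h y) = symAct hS (symMul g h) y :=
  toAmb_injective (by simp only [toAmb_symAct, symMap_symMap])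

theorem symInv_symAct (g : SymIndex) (y : S × ℝ × ℝ) :
    symAct hS (symInv g) (symAct hS g y) = y :=
  toAmb_injective (by simp only [toAmb_symAct, symInv_symMap])

theorem symMap_one (y : Amb) : symMap (1, 1, 0, 0) y = y := by
  simp [symMap_apply, signMap_one]

theorem symAct_one (y : S × ℝ × ℝ) : symAct hS (1, 1, 0, 0) y = y :=
  toAmb_injective (by rw [toAmb_symAct, symMap_one])

/-- The deck transformations of `S × ℝ` over the mapping torus. -/
noncomputable def torusAct (m : ℤ) (z : S × ℝ) : S × ℝ :=
  (surfaceSign hS 1 (Int.negOnePow m) z.1, z.2 - 2 * (m : ℝ))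

theorem continuous_torusAct (m : ℤ) : Continuous (torusAct hS m) := by
  refine ((continuous_surfaceSign hS _ _).comp continuous_fst).prodMk ?_
  fun_prop

theorem torusAct_torusAct (m m' : ℤ) (z : S × ℝ) :
    torusAct hS m (torusAct hS m' z) = torusAct hS (m' + m) z := by
  refine Prod.ext (Subtype.ext ?_) ?_
  · simp only [torusAct, surfaceSign, signMap_signMap, mul_one, Int.negOnePow_add, mul_comm]
  · simp only [torusAct]
    push_cast
    ring

theorem torusAct_zero (z : S × ℝ) : torusAct hS 0 z = z := by
  refine Prod.ext (Subtype.ext ?_) ?_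
  · simp [torusAct, surfaceSign, signMap_one]
  · simp [torusAct]

theorem torusAct_one (z : S × ℝ) : torusAct hS 1 z = (surfaceGamma hS z.1, z.2 - 2) := by
  refine Prod.ext (Subtype.ext ?_) ?_
  · simp [torusAct, surfaceSign, signMap_one_neg_one, surfaceGamma]
  · simp [torusAct]

theorem MappingTorus.mk_torusAct (m : ℤ) (z : S × ℝ) :
    MappingTorus.mk hS (torusAct hS m z).1 (torusAct hS m z).2 = MappingTorus.mk hS z.1 z.2 := by
  have h1 : ∀ z : S × ℝ, MappingTorus.mk hS (torusAct hS 1 z).1 (torusAct hS 1 z).2 =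
      MappingTorus.mk hS z.1 z.2 := by
    intro z
    symm
    exact Quot.sound (torusAct_one hS z)
  induction m using Int.induction_on generalizing z with
  | zero => rw [torusAct_zero]
  | succ i ih => rw [← torusAct_torusAct, h1, ih]
  | pred i ih =>
    rw [← h1, torusAct_torusAct, sub_add_cancel, ih]

theorem MappingTorus.mk_eq_iff (z z' : S × ℝ) :
    MappingTorus.mk hS z.1 z.2 = MappingTorus.mk hS z'.1 z'.2 ↔ ∃ m : ℤ, torusAct hS m z = z' := by
  constructor
  · intro h
    have key : ∀ a b : S × ℝ, Relation.EqvGen (fun a b : S × ℝ => b = (surfaceGamma hS a.1, a.2 - 2))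
        a b → ∃ m : ℤ, torusAct hS m a = b := by
      intro a b hab
      induction hab with
      | rel a b hab => exact ⟨1, by rw [torusAct_one, hab]⟩
      | refl a => exact ⟨0, torusAct_zero hS a⟩
      | symm a b _ ih =>
        obtain ⟨m, rfl⟩ := ih
        exact ⟨-m, by rw [torusAct_torusAct, add_neg_cancel, torusAct_zero]⟩
      | trans a b c _ _ ih ih' =>
        obtain ⟨m, rfl⟩ := ih
        obtain ⟨m', rfl⟩ := ih'
        exact ⟨m + m', (torusAct_torusAct hS m' m a).symm⟩
    exact key _ _ (Quot.eqvGen_exact h)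
  · rintro ⟨m, rfl⟩
    exact (MappingTorus.mk_torusAct hS m z).symm

/-- The saturation of an open set is the union of its preimages under the deck transformations,
which are continuous. -/
theorem MappingTorus.isOpenMap_mk :
    IsOpenMap fun z : S × ℝ => MappingTorus.mk hS z.1 z.2 := by
  intro U hU
  have h : (fun z : S × ℝ => MappingTorus.mk hS z.1 z.2) ⁻¹'
      ((fun z : S × ℝ => MappingTorus.mk hS z.1 z.2) '' U) = ⋃ m : ℤ, torusAct hS m ⁻¹' U := by
    ext z
    simp only [mem_preimage, mem_image, mem_iUnion]
    constructor
    · rintro ⟨z', hz', h⟩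
      obtain ⟨m, rfl⟩ := (MappingTorus.mk_eq_iff hS z z').1 h.symm
      exact ⟨m, hz'⟩
    · rintro ⟨m, hm⟩
      exact ⟨_, hm, MappingTorus.mk_torusAct hS m z⟩
  have h2 : IsOpen ((fun z : S × ℝ => MappingTorus.mk hS z.1 z.2) ⁻¹'
      ((fun z : S × ℝ => MappingTorus.mk hS z.1 z.2) '' U)) := by
    rw [h]
    exact isOpen_iUnion fun m => hU.preimage (continuous_torusAct hS m)
  exact h2

theorem MappingTorus.continuous_mk :
    Continuous fun z : S × ℝ => MappingTorus.mk hS z.1 z.2 :=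
  continuous_quot_mk

/-- The projection of `S × ℝ × ℝ` to the product of the mapping torus with a circle. -/
def projTorus (y : S × ℝ × ℝ) : TorusProduct hS :=
  (MappingTorus.mk hS y.1 y.2.1, (y.2.2 : AddCircle (2 : ℝ)))

theorem isOpenMap_projTorus : IsOpenMap (projTorus hS) :=
  ((MappingTorus.isOpenMap_mk hS).prodMap
    (QuotientAddGroup.isOpenMap_coe (N := AddSubgroup.zmultiples (2 : ℝ)))).comp
    (Homeomorph.prodAssoc S ℝ ℝ).symm.isOpenMap

theorem continuous_projTorus : Continuous (projTorus hS) :=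
  ((MappingTorus.continuous_mk hS).prodMap (AddCircle.continuous_mk' (2 : ℝ))).comp
    (Homeomorph.prodAssoc S ℝ ℝ).symm.continuous

theorem surjective_projTorus : Function.Surjective (projTorus hS) := by
  rintro ⟨a, b⟩
  obtain ⟨⟨p, t⟩, rfl⟩ := Quot.exists_rep a
  obtain ⟨s, rfl⟩ := QuotientAddGroup.mk_surjective b
  exact ⟨(p, t, s), rfl⟩

theorem projTorus_symAct (m k : ℤ) (y : S × ℝ × ℝ) :
    projTorus hS (symAct hS (1, 1, m, k) y) = projTorus hS y := by
  refine Prod.ext ?_ ?_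
  · have h := MappingTorus.mk_torusAct hS m (y.1, y.2.1)
    simpa [projTorus, symAct, torusAct] using h
  · simp only [projTorus, symAct, map_one, one_mul]
    refine (QuotientAddGroup.eq).2 ?_
    exact ⟨-k, by simp; ring⟩

theorem exists_symAct_of_projTorus_eq {y z : S × ℝ × ℝ} (h : projTorus hS y = projTorus hS z) :
    ∃ g, symAct hS g y = z := by
  obtain ⟨m, hm⟩ := (MappingTorus.mk_eq_iff hS (y.1, y.2.1) (z.1, z.2.1)).1 (congrArg Prod.fst h)
  obtain ⟨k, hk⟩ := (QuotientAddGroup.eq).1 (congrArg Prod.snd h)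
  refine ⟨(1, 1, m, k), Prod.ext ?_ (Prod.ext ?_ ?_)⟩
  · exact congrArg (fun z : S × ℝ => z.1) hm
  · have := congrArg (fun z : S × ℝ => z.2) hm
    simpa [symAct, torusAct] using this
  · simp only [zsmul_eq_mul] at hk
    simp only [symAct, map_one, one_mul]
    linarith

theorem liftedPhi_projTorus (y : S × ℝ × ℝ) :
    liftedPhi hS (projTorus hS y) = projTorus hS (symAct hS (1, -1, 0, 0) y) := by
  refine Prod.ext ?_ ?_
  · have h : surfaceSign hS (-1) 1 y.1 = surfacePhi hS y.1 :=
      Subtype.ext (signMap_neg_one_one _)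
    simp [projTorus, symAct, liftedPhi, h]
    rfl
  · simp [projTorus, symAct, liftedPhi]

theorem liftedXi_projTorus (y : S × ℝ × ℝ) :
    liftedXi hS (projTorus hS y) = projTorus hS (symAct hS (-1, 1, 0, 0) y) := by
  have hu : unitSign (-1) = -1 := by simp [unitSign]
  refine Prod.ext ?_ ?_
  · have h : surfaceSign hS 1 1 y.1 = y.1 := Subtype.ext (signMap_one _)
    simp [projTorus, symAct, liftedXi, h, hu]
    rfl
  · simp [projTorus, symAct, liftedXi, hu]

theorem projX_eq_mk (y : S × ℝ × ℝ) : projX hS y = Quot.mk _ (projTorus hS y) := rfl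

theorem projX_symAct (g : SymIndex) (y : S × ℝ × ℝ) : projX hS (symAct hS g y) = projX hS y := by
  obtain ⟨ε, u, m, k⟩ := g
  have hφ : ∀ y, projX hS (symAct hS (1, -1, 0, 0) y) = projX hS y := by
    intro y
    rw [projX_eq_mk, projX_eq_mk, ← liftedPhi_projTorus]
    symm
    exact Quot.sound (Or.inl rfl)
  have hξ : ∀ y, projX hS (symAct hS (-1, 1, 0, 0) y) = projX hS y := by
    intro y
    rw [projX_eq_mk, projX_eq_mk, ← liftedXi_projTorus]
    symm
    exact Quot.sound (Or.inr rfl)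
  have h1 : ∀ ε y, projX hS (symAct hS (ε, 1, 0, 0) y) = projX hS y := by
    intro ε y
    rcases Int.units_eq_one_or ε with rfl | rfl
    · rw [symAct_one]
    · exact hξ y
  have h2 : ∀ u y, projX hS (symAct hS (1, u, 0, 0) y) = projX hS y := by
    intro u y
    rcases Int.units_eq_one_or u with rfl | rfl
    · rw [symAct_one]
    · exact hφ y
  have e : symAct hS (ε, u, m, k) y =
      symAct hS (1, 1, m, k) (symAct hS (1, u, 0, 0) (symAct hS (ε, 1, 0, 0) y)) := by
    rw [symAct_symAct, symAct_symAct]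
    congr 1
    simp [symMul]
  rw [e, projX_eq_mk, projTorus_symAct, ← projX_eq_mk, h2, h1]

/-- The fibres of `S × ℝ × ℝ → X` are the orbits of the deck transformations. -/
theorem projX_eq_iff (y z : S × ℝ × ℝ) : projX hS y = projX hS z ↔ ∃ g, symAct hS g y = z := by
  constructor
  · intro h
    -- The induction over the generated equivalence relation is carried out for all lifts y and z at
    -- once. In the transitive case the middle point is lifted by surjectivity of `projTorus`.
    have key : ∀ a b : TorusProduct hS, Relation.EqvGen
        (fun m n : TorusProduct hS => n = liftedPhi hS m ∨ n = liftedXi hS m) a b →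
        ∀ y z, projTorus hS y = a → projTorus hS z = b → ∃ g, symAct hS g y = z := by
      intro a b hab
      induction hab with
      | rel a b hab =>
        rintro y z rfl rfl
        rcases hab with hab | hab
        · rw [liftedPhi_projTorus] at hab
          obtain ⟨g, rfl⟩ := exists_symAct_of_projTorus_eq hS hab.symm
          exact ⟨_, (symAct_symAct hS _ _ y).symm⟩
        · rw [liftedXi_projTorus] at hab
          obtain ⟨g, rfl⟩ := exists_symAct_of_projTorus_eq hS hab.symm
          exact ⟨_, (symAct_symAct hS _ _ y).symm⟩
      | refl a =>
        rintro y z rfl h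
        exact exists_symAct_of_projTorus_eq hS h.symm
      | symm a b _ ih =>
        intro y z hy hz
        obtain ⟨g, rfl⟩ := ih z y hz hy
        exact ⟨symInv g, symInv_symAct hS g z⟩
      | trans a b c _ _ ih ih' =>
        intro y z hy hz
        obtain ⟨w, hw⟩ := surjective_projTorus hS b
        obtain ⟨g, rfl⟩ := ih y w hy hw
        obtain ⟨g', rfl⟩ := ih' _ z hw hz
        exact ⟨_, (symAct_symAct hS _ _ y).symm⟩
    exact key _ _ (Quot.eqvGen_exact h) y z rfl rfl
  · rintro ⟨g, rfl⟩
    exact (projX_symAct hS g y).symm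

theorem continuous_projX : Continuous (projX hS) :=
  continuous_quot_mk.comp (continuous_projTorus hS)

theorem isOpenMap_projX : IsOpenMap (projX hS) := by
  intro U hU
  have h : projX hS ⁻¹' (projX hS '' U) = ⋃ g : SymIndex, symAct hS g ⁻¹' U := by
    ext z
    simp only [mem_preimage, mem_image, mem_iUnion]
    constructor
    · rintro ⟨z', hz', h⟩
      obtain ⟨g, rfl⟩ := (projX_eq_iff hS z z').1 h.symm
      exact ⟨g, hz'⟩
    · rintro ⟨g, hg⟩
      exact ⟨_, hg, projX_symAct hS g z⟩
  have h2 : IsOpen (projX hS ⁻¹' (projX hS '' U)) := by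
    rw [h]
    exact isOpen_iUnion fun g => hU.preimage (continuous_symAct hS g)
  -- X is a quotient of the intermediate space M × S¹, where openness has to be tested. The open
  -- surjection `projTorus` pushes the saturated set down to it.
  have h3 : IsOpen (projTorus hS '' (projX hS ⁻¹' (projX hS '' U))) := isOpenMap_projTorus hS _ h2
  have h4 : projTorus hS '' (projX hS ⁻¹' (projX hS '' U)) =
      (Quot.mk _ : TorusProduct hS → OrbifoldX hS) ⁻¹' (projX hS '' U) :=
    image_preimage_eq (f := projTorus hS) (Quot.mk _ ⁻¹' (projX hS '' U)) (surjective_projTorus hS)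
  rw [h4] at h3
  exact h3

end QuotientTopology

/-! ### Lifts of charts as immersions into ℝ³ × ℝ × ℝ -/

section ChartLifts

variable {S : Set E3} [ChartedSpace E2 S]

/-- The model space of the orbifold. -/
abbrev ModelE := E2 × ℝ × ℝ

theorem surjective_of_injective_endo {F : Type*} [NormedAddCommGroup F] [NormedSpace ℝ F]
    [FiniteDimensional ℝ F] (L : F →L[ℝ] F) (h : Function.Injective L) : Function.Surjective L :=
  (LinearMap.injective_iff_surjective (f := (L : F →ₗ[ℝ] F))).1 h

/-- The parametrization has injective derivative. By the chain rule so does the chart inverse, whose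
derivative is an endomorphism of the plane and hence surjective. It can therefore be cancelled. -/
theorem mfderiv_subtypeVal_injective [IsManifold (𝓡 2) ∞ S]
    (hi : IsImmersion (𝓡 2) 𝓘(ℝ, E3) ∞ (Subtype.val : S → E3)) (p : S) :
    Function.Injective (mfderiv (𝓡 2) 𝓘(ℝ, E3) (Subtype.val : S → E3) p) := by
  have h := hi.isImmersionAt p
  have hp := h.domChart.map_source h.mem_domChart_source
  have h1 := (fderiv_comp_domChart_symm_injective h).2 _ hp
  have hsymm : MDifferentiableAt (𝓡 2) (𝓡 2) h.domChart.symm (h.domChart p) :=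
    ((contMDiffOn_symm_of_mem_maximalAtlas h.domChart_mem_maximalAtlas).contMDiffAt
      (h.domChart.open_target.mem_nhds hp)).mdifferentiableAt (by simp)
  have hpp : h.domChart.symm (h.domChart p) = p := h.domChart.left_inv h.mem_domChart_source
  have hval : MDifferentiableAt (𝓡 2) 𝓘(ℝ, E3) (Subtype.val : S → E3)
      (h.domChart.symm (h.domChart p)) := hi.contMDiff.mdifferentiableAt (by simp)
  have h2 : fderiv ℝ (fun u => (h.domChart.symm u : E3)) (h.domChart p) =
      (mfderiv (𝓡 2) 𝓘(ℝ, E3) (Subtype.val : S → E3) (h.domChart.symm (h.domChart p))).comp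
        (mfderiv (𝓡 2) (𝓡 2) h.domChart.symm (h.domChart p)) := by
    rw [← mfderiv_comp _ hval hsymm, ← mfderiv_eq_fderiv]
    rfl
  rw [h2] at h1
  have h3 : Function.Injective (mfderiv (𝓡 2) (𝓡 2) h.domChart.symm (h.domChart p) : E2 → E2) :=
    Function.Injective.of_comp h1
  have h4 : Function.Surjective (mfderiv (𝓡 2) (𝓡 2) h.domChart.symm (h.domChart p) : E2 → E2) :=
    surjective_of_injective_endo (F := E2) (mfderiv (𝓡 2) (𝓡 2) h.domChart.symm (h.domChart p)) h3
  have h5 := Function.Injective.of_comp_right (f := (mfderiv (𝓡 2) 𝓘(ℝ, E3)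
    (Subtype.val : S → E3) (h.domChart.symm (h.domChart p)) : E2 → E3)) h1 h4
  rwa [hpp] at h5

/-- The differential of the inclusion of `S × ℝ × ℝ` in `ℝ³ × ℝ × ℝ`. -/
noncomputable def dAmb (y : S × ℝ × ℝ) : ModelE →L[ℝ] Amb :=
  ContinuousLinearMap.prodMap
    (mfderiv (𝓡 2) 𝓘(ℝ, E3) (Subtype.val : S → E3) y.1 : E2 →L[ℝ] E3)
    (ContinuousLinearMap.id ℝ (ℝ × ℝ))

theorem dAmb_apply (y : S × ℝ × ℝ) (v : ModelE) :
    dAmb y v = ((mfderiv (𝓡 2) 𝓘(ℝ, E3) (Subtype.val : S → E3) y.1 : E2 →L[ℝ] E3) v.1, v.2) := rfl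

theorem dAmb_injective [IsManifold (𝓡 2) ∞ S]
    (hi : IsImmersion (𝓡 2) 𝓘(ℝ, E3) ∞ (Subtype.val : S → E3)) (y : S × ℝ × ℝ) :
    Function.Injective (dAmb y) := by
  intro v w h
  rw [dAmb_apply, dAmb_apply] at h
  exact Prod.ext (mfderiv_subtypeVal_injective hi y.1 (congrArg (fun z : Amb => z.1) h))
    (congrArg (fun z : Amb => z.2) h)

theorem fderiv_toAmb_comp {E : Type*} [NormedAddCommGroup E] [NormedSpace ℝ E]
    (hi : ContMDiff (𝓡 2) 𝓘(ℝ, E3) ∞ (Subtype.val : S → E3))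
    {psi : E → S × ℝ × ℝ} {u : E} (h : MDifferentiableAt 𝓘(ℝ, E) modelY psi u) (v : E) :
    fderiv ℝ (fun u => toAmb (psi u)) u v = dAmb (psi u) (mfderiv 𝓘(ℝ, E) modelY psi u v) := by
  have h1 : MDifferentiableAt 𝓘(ℝ, E) (𝓡 2) (fun u => (psi u).1) u := h.fst
  have h2 : MDifferentiableAt 𝓘(ℝ, E) 𝓘(ℝ, ℝ) (fun u => (psi u).2.1) u := h.snd.fst
  have h3 : MDifferentiableAt 𝓘(ℝ, E) 𝓘(ℝ, ℝ) (fun u => (psi u).2.2) u := h.snd.snd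
  have e1 : mfderiv 𝓘(ℝ, E) modelY psi u = (mfderiv 𝓘(ℝ, E) (𝓡 2) (fun u => (psi u).1) u).prod
      ((mfderiv 𝓘(ℝ, E) 𝓘(ℝ, ℝ) (fun u => (psi u).2.1) u).prod
        (mfderiv 𝓘(ℝ, E) 𝓘(ℝ, ℝ) (fun u => (psi u).2.2) u)) :=
    (mfderiv_prodMk h1 h.snd).trans (congrArg _ (mfderiv_prodMk h2 h3))
  have hval : MDifferentiableAt (𝓡 2) 𝓘(ℝ, E3) (Subtype.val : S → E3) (psi u).1 :=
    hi.mdifferentiableAt (by simp)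
  have e2 : fderiv ℝ (fun u => ((psi u).1 : E3)) u =
      (mfderiv (𝓡 2) 𝓘(ℝ, E3) (Subtype.val : S → E3) (psi u).1).comp
        (mfderiv 𝓘(ℝ, E) (𝓡 2) (fun u => (psi u).1) u) := by
    rw [← mfderiv_eq_fderiv]
    exact mfderiv_comp u hval h1
  have d1 : DifferentiableAt ℝ (fun u => ((psi u).1 : E3)) u :=
    mdifferentiableAt_iff_differentiableAt.1 (hval.comp u h1)
  have d2 : DifferentiableAt ℝ (fun u => (psi u).2.1) u := mdifferentiableAt_iff_differentiableAt.1 h2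
  have d3 : DifferentiableAt ℝ (fun u => (psi u).2.2) u := mdifferentiableAt_iff_differentiableAt.1 h3
  have e3 : HasFDerivAt (fun u => toAmb (psi u)) ((fderiv ℝ (fun u => ((psi u).1 : E3)) u).prod
      ((fderiv ℝ (fun u => (psi u).2.1) u).prod (fderiv ℝ (fun u => (psi u).2.2) u))) u :=
    d1.hasFDerivAt.prodMk (d2.hasFDerivAt.prodMk d3.hasFDerivAt)
  rw [e1]
  refine (congrArg (fun L : E →L[ℝ] Amb => L v) e3.fderiv).trans ?_
  refine Prod.ext ?_ (Prod.ext ?_ ?_)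
  · exact congrArg (fun L : E →L[ℝ] E3 => L v) e2
  · exact congrArg (fun L : E →L[ℝ] ℝ => L v) mfderiv_eq_fderiv.symm
  · exact congrArg (fun L : E →L[ℝ] ℝ => L v) mfderiv_eq_fderiv.symm

/-- Smoothness into S can be tested in ℝ³ because the inclusion is an immersion. That criterion
presupposes continuity into S, which holds because the inclusion is a topological embedding. -/
theorem contMDiffOn_iff_contDiffOn_toAmb [IsManifold (𝓡 2) ∞ S]
    (he : IsSmoothEmbedding (𝓡 2) 𝓘(ℝ, E3) ∞ (Subtype.val : S → E3))
    {E : Type*} [NormedAddCommGroup E] [NormedSpace ℝ E]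
    {psi : E → S × ℝ × ℝ} {U : Set E} (hU : IsOpen U) :
    ContMDiffOn 𝓘(ℝ, E) modelY ∞ psi U ↔ ContDiffOn ℝ ∞ (fun u => toAmb (psi u)) U := by
  constructor
  · intro h
    have h1 : ContDiffOn ℝ ∞ (fun u => ((psi u).1 : E3)) U :=
      contMDiffOn_iff_contDiffOn.1
        (he.isImmersion.contMDiff.comp_contMDiffOn (f := fun u => (psi u).1)
          fun u hu => (h u hu).fst)
    have h2 : ContDiffOn ℝ ∞ (fun u => (psi u).2.1) U := contMDiffOn_iff_contDiffOn.1 fun u hu => (h u hu).snd.fst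
    have h3 : ContDiffOn ℝ ∞ (fun u => (psi u).2.2) U := contMDiffOn_iff_contDiffOn.1 fun u hu => (h u hu).snd.snd
    exact h1.prodMk (h2.prodMk h3)
  · intro h u hu
    have hc : ContinuousAt psi u :=
      isEmbedding_toAmb.continuousAt_iff.2 (h.continuousOn.continuousAt (hU.mem_nhds hu))
    have h0 := h.contDiffAt (hU.mem_nhds hu)
    have h1 : ContMDiffAt 𝓘(ℝ, E) 𝓘(ℝ, E3) ∞ (fun u => ((psi u).1 : E3)) u :=
      contMDiffAt_iff_contDiffAt.2 h0.fst
    have h2 : ContMDiffAt 𝓘(ℝ, E) 𝓘(ℝ, ℝ) ∞ (fun u => (psi u).2.1) u :=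
      contMDiffAt_iff_contDiffAt.2 h0.snd.fst
    have h3 : ContMDiffAt 𝓘(ℝ, E) 𝓘(ℝ, ℝ) ∞ (fun u => (psi u).2.2) u :=
      contMDiffAt_iff_contDiffAt.2 h0.snd.snd
    have h4 : ContMDiffAt 𝓘(ℝ, E) (𝓡 2) ∞ (fun u => (psi u).1) u :=
      (ContMDiffAt.iff_comp_isImmersionAt (he.isImmersion.isImmersionAt _)).2 ⟨hc.fst, h1⟩
    exact (h4.prodMk (h2.prodMk h3)).contMDiffWithinAt

/-- A map to `S × ℝ × ℝ` is a local diffeomorphism if it is an immersion into `ℝ³ × ℝ × ℝ`. -/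
theorem isChartLift_iff [IsManifold (𝓡 2) ∞ S]
    (he : IsSmoothEmbedding (𝓡 2) 𝓘(ℝ, E3) ∞ (Subtype.val : S → E3)) {X : Type*}
    [TopologicalSpace X] {q : S × ℝ × ℝ → X} {c : OrbifoldChart ModelE X}
    {psi : ModelE → S × ℝ × ℝ} :
    IsChartLift modelY q c psi ↔ ContDiffOn ℝ ∞ (fun u => toAmb (psi u)) c.source ∧
      (∀ u ∈ c.source, Function.Injective (fderiv ℝ (fun u => toAmb (psi u)) u)) ∧
      ∀ u : c.source, q (psi u) = c.toFun u := by
  have key : ContMDiffOn 𝓘(ℝ, ModelE) modelY ∞ psi c.source → ∀ u ∈ c.source,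
      (Function.Bijective (mfderiv 𝓘(ℝ, ModelE) modelY psi u) ↔
        Function.Injective (fderiv ℝ (fun u => toAmb (psi u)) u)) := by
    intro h u hu
    have hd := (h.contMDiffAt (c.isOpen_source.mem_nhds hu)).mdifferentiableAt (by simp)
    have h1 : (fderiv ℝ (fun u => toAmb (psi u)) u : ModelE → Amb) =
        dAmb (psi u) ∘ (mfderiv 𝓘(ℝ, ModelE) modelY psi u : ModelE → ModelE) :=
      funext fun v => fderiv_toAmb_comp he.isImmersion.contMDiff hd v
    rw [h1]
    constructor
    · intro hb
      exact (dAmb_injective he.isImmersion _).comp hb.1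
    · intro hinj
      have h2 : Function.Injective (mfderiv 𝓘(ℝ, ModelE) modelY psi u : ModelE → ModelE) :=
        Function.Injective.of_comp hinj
      exact ⟨h2, surjective_of_injective_endo (F := ModelE)
        (mfderiv 𝓘(ℝ, ModelE) modelY psi u) h2⟩
  constructor
  · intro h
    exact ⟨(contMDiffOn_iff_contDiffOn_toAmb he c.isOpen_source).1 h.smooth,
      fun u hu => (key h.smooth u hu).1 (h.bijective_mfderiv u hu), h.over_base⟩
  · rintro ⟨h1, h2, h3⟩
    have h := (contMDiffOn_iff_contDiffOn_toAmb he c.isOpen_source).2 h1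
    exact ⟨h, fun u hu => (key h u hu).2 (h2 u hu), h3⟩

end ChartLifts

/-! ### Orbifold charts of X built from graph patches -/

section NiceCharts

theorem abs_le_of_abs_unitSign_mul_add_sub_lt {ε : ℤˣ} {t a : ℝ}
    (h : |unitSign ε * t + 2 * a - t| < 1) : |a| ≤ |t| + 1 := by
  rw [abs_lt] at h
  rw [abs_le]
  have h1 := neg_abs_le t
  have h2 := le_abs_self t
  rcases unitSign_eq ε with he | he <;> rw [he] at h <;> constructor <;> linarith

/-- The signs take finitely many values, and a small displacement of t and s bounds the two integer
parameters. -/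
theorem finite_symMap_dist_lt (y : Amb) : {g : SymIndex | dist (symMap g y) y < 1}.Finite := by
  set M : ℤ := ⌈|y.2.1| + |y.2.2| + 1⌉ with hM
  refine (Set.finite_univ.prod (Set.finite_univ.prod
    ((Set.finite_Icc (-M) M).prod (Set.finite_Icc (-M) M)))).subset ?_
  rintro ⟨ε, u, m, k⟩ hg
  have hle : |y.2.1| + |y.2.2| + 1 ≤ (M : ℝ) := Int.le_ceil _
  rw [Set.mem_ofPred_eq, dist_eq_norm, symMap_apply] at hg
  have h1 := (norm_snd_le _).trans_lt hg
  have h2 := (norm_fst_le _).trans_lt h1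
  have h3 := (norm_snd_le _).trans_lt h1
  simp only [Prod.snd_sub, Prod.fst_sub, Real.norm_eq_abs] at h2 h3
  rw [show unitSign ε * y.2.1 - 2 * (m : ℝ) - y.2.1 =
    unitSign ε * y.2.1 + 2 * (-(m : ℝ)) - y.2.1 by ring] at h2
  have h4 := abs_le_of_abs_unitSign_mul_add_sub_lt h2
  have h5 := abs_le_of_abs_unitSign_mul_add_sub_lt h3
  rw [abs_neg] at h4
  have h6 := abs_le.1 (h4.trans (show _ ≤ (M : ℝ) by linarith [abs_nonneg y.2.2]))
  have h7 := abs_le.1 (h5.trans (show _ ≤ (M : ℝ) by linarith [abs_nonneg y.2.1]))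
  refine ⟨trivial, trivial, ⟨?_, ?_⟩, ⟨?_, ?_⟩⟩
  · exact_mod_cast h6.1
  · exact_mod_cast h6.2
  · exact_mod_cast h7.1
  · exact_mod_cast h7.2

/-- Only finitely many g move y by less than 1, and r is taken below half the distance for each of
those that do move it. The factor 2 is needed because two points of the r-ball around y are
compared. -/
theorem exists_discrete_radius (y : Amb) :
    ∃ r : ℝ, 0 < r ∧ ∀ g : SymIndex, dist (symMap g y) y < 2 * r → symMap g y = y := by
  have h1 : ∀ᶠ r in 𝓝[>] (0 : ℝ), ∀ g ∈ {g : SymIndex | dist (symMap g y) y < 1},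
      dist (symMap g y) y < 2 * r → symMap g y = y := by
    rw [Filter.eventually_all_finite (finite_symMap_dist_lt y)]
    intro g _
    by_cases hg : symMap g y = y
    · exact Eventually.of_forall fun _ _ => hg
    · have hd : 0 < dist (symMap g y) y := dist_pos.2 hg
      filter_upwards [Ioo_mem_nhdsGT (half_pos hd)] with r hr h
      linarith [hr.2]
  have h2 : ∀ᶠ r in 𝓝[>] (0 : ℝ), r < 1 / 2 ∧ 0 < r := by
    filter_upwards [Ioo_mem_nhdsGT (show (0 : ℝ) < 1 / 2 by norm_num)] with r hr
    exact ⟨hr.2, hr.1⟩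
  obtain ⟨r, hr, hr1, hr0⟩ := (h1.and h2).exists
  exact ⟨r, hr0, fun g hg => hr g (show _ < (1 : ℝ) by linarith) hg⟩

/-- A graph patch of `S` around the first component of `y`, together with a radius in which the
orbit of `y` is discrete. -/
structure NicePatch (S : Set E3) (n : E3 → E3) (P : E3 →L[ℝ] E2) (O : Set E2) (V : Set E3)
    (ψ : E2 → E3) (m : E3) (y : Amb) (r : ℝ) : Prop where
  patch : IsGraphPatch S n P O V ψ m
  pos : 0 < r
  ball_subset : ∀ q, dist q y.1 < r → q ∈ V
  discrete : ∀ g : SymIndex, dist (symMap g y) y < 2 * r → symMap g y = y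

theorem IsGraphPatch.exists_nicePatch {S : Set E3} {n : E3 → E3} {P : E3 →L[ℝ] E2} {O : Set E2}
    {V : Set E3} {ψ : E2 → E3} {m : E3} (hp : IsGraphPatch S n P O V ψ m) {y : Amb}
    (hV : y.1 ∈ V) : ∃ r, NicePatch S n P O V ψ m y r := by
  obtain ⟨r₁, hr₁, h₁⟩ := exists_discrete_radius y
  obtain ⟨r₂, hr₂, h₂⟩ := Metric.isOpen_iff.1 hp.isOpen_V _ hV
  refine ⟨min r₁ r₂, hp, lt_min hr₁ hr₂, fun q hq => h₂ ?_, fun g hg => h₁ g ?_⟩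
  · exact hq.trans_le (min_le_right _ _)
  · linarith [min_le_left r₁ r₂]

theorem IsNormalSurface.exists_nicePatch {S : Set E3} {n : E3 → E3} (hn : IsNormalSurface S n)
    {y : Amb} (hy : y.1 ∈ S) : ∃ P O V ψ m r, NicePatch S n P O V ψ m y r := by
  obtain ⟨P, O, V, ψ, m, hV, hp⟩ := hn.exists_patch _ hy
  exact ⟨P, O, V, ψ, m, hp.exists_nicePatch hV⟩

variable {S : Set E3} {n : E3 → E3} {P : E3 →L[ℝ] E2} {O : Set E2} {V : Set E3}
  {ψ : E2 → E3} {m : E3}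

/-- The domain of the chart defined by a patch. -/
def niceSource (O : Set E2) (ψ : E2 → E3) (y : Amb) (r : ℝ) : Set ModelE :=
  {w | w.1 ∈ O ∧ dist (liftPatch ψ w) y < r}

open Classical in
/-- The lift to `S × ℝ × ℝ` of the chart defined by a patch. -/
noncomputable def niceLift (ψ : E2 → E3) (y₀ : S × ℝ × ℝ) (w : ModelE) : S × ℝ × ℝ :=
  if h : ψ w.1 ∈ S then (⟨ψ w.1, h⟩, w.2) else y₀

namespace NicePatch

variable {y : Amb} {y₀ : S × ℝ × ℝ} {r : ℝ}

theorem mono (h : NicePatch S n P O V ψ m y r) {r' : ℝ} (h0 : 0 < r') (hr : r' ≤ r) :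
    NicePatch S n P O V ψ m y r' where
  patch := h.patch
  pos := h0
  ball_subset q hq := h.ball_subset q (hq.trans_le hr)
  discrete g hg := h.discrete g (by linarith)

theorem isOpen_source (h : NicePatch S n P O V ψ m y r) : IsOpen (niceSource O ψ y r) :=
  h.patch.contDiffOn_liftPatch.continuousOn.isOpen_inter_preimage h.patch.isOpen_fst_preimage
    (Metric.isOpen_ball (x := y) (ε := r))

theorem toAmb_niceLift (h : NicePatch S n P O V ψ m y r) {w : ModelE} (hw : w.1 ∈ O) :
    toAmb (niceLift ψ y₀ w) = liftPatch ψ w := by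
  rw [niceLift, dif_pos (h.patch.mem _ hw).1]
  rfl

theorem liftPatch_injOn (h : NicePatch S n P O V ψ m y r) :
    InjOn (liftPatch ψ) (niceSource O ψ y r) := by
  intro w hw w' hw' he
  rw [← h.patch.liftProj_liftPatch hw.1, he, h.patch.liftProj_liftPatch hw'.1]

theorem liftPatch_liftProj (h : NicePatch S n P O V ψ m y r) {z : Amb} (hz : z.1 ∈ S)
    (hzy : dist z y < r) : liftPatch ψ (liftProj P z) = z ∧ liftProj P z ∈ niceSource O ψ y r := by
  have hV : z.1 ∈ V := h.ball_subset _ ((le_max_left _ _).trans_lt hzy)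
  have h1 := h.patch.liftPatch_liftProj hz hV
  exact ⟨h1, h.patch.liftProj_mem hV, by rwa [h1]⟩

theorem action (h : NicePatch S n P O V ψ m y r) (hsym : IsSymmetricSurface S n) {g : SymIndex}
    (hg : symMap g y = y) {w : ModelE} (hw : w ∈ niceSource O ψ y r) :
    liftPatch ψ (liftProj P (symMap g (liftPatch ψ w))) = symMap g (liftPatch ψ w) ∧
      liftProj P (symMap g (liftPatch ψ w)) ∈ niceSource O ψ y r := by
  refine h.liftPatch_liftProj (hsym.symMap_mem g (h.patch.mem _ hw.1).1) ?_
  rw [← hg, dist_symMap]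
  exact hw.2

theorem symMap_symInv_eq {g : SymIndex} {y : Amb} (hg : symMap g y = y) :
    symMap (symInv g) y = y := by
  conv_lhs => rw [← hg]
  exact symInv_symMap g y

/-- The element of the group of the chart which is given by a deck transformation. -/
noncomputable def perm (h : NicePatch S n P O V ψ m y r) (hsym : IsSymmetricSurface S n)
    {g : SymIndex} (hg : symMap g y = y) : Equiv.Perm (niceSource O ψ y r) where
  toFun w := ⟨liftProj P (symMap g (liftPatch ψ w)), (h.action hsym hg w.2).2⟩
  invFun w := ⟨liftProj P (symMap (symInv g) (liftPatch ψ w)),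
    (h.action hsym (symMap_symInv_eq hg) w.2).2⟩
  left_inv w := by
    apply Subtype.ext
    simp only [(h.action hsym hg w.2).1, symInv_symMap]
    exact h.patch.liftProj_liftPatch w.2.1
  right_inv w := by
    apply Subtype.ext
    simp only [(h.action hsym (symMap_symInv_eq hg) w.2).1, symMap_symInv]
    exact h.patch.liftProj_liftPatch w.2.1

theorem liftPatch_perm (h : NicePatch S n P O V ψ m y r) (hsym : IsSymmetricSurface S n)
    {g : SymIndex} (hg : symMap g y = y) (w : niceSource O ψ y r) :
    liftPatch ψ (h.perm hsym hg w) = symMap g (liftPatch ψ w) :=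
  (h.action hsym hg w.2).1

/-- The orbifold chart of `X` which is defined by a patch. -/
noncomputable def chart (hS : IsPlaneSymmetric S) (hsym : IsSymmetricSurface S n)
    (h : NicePatch S n P O V ψ m (toAmb y₀) r) : OrbifoldChart ModelE (OrbifoldX hS) where
  source := niceSource O ψ (toAmb y₀) r
  isOpen_source := h.isOpen_source
  -- The chart group consists of the permutations of the domain that are induced by the stabilizer
  -- of the centre.
  group :=
    { carrier := {σ | ∃ g, symMap g (toAmb y₀) = toAmb y₀ ∧
        ∀ w : niceSource O ψ (toAmb y₀) r, liftPatch ψ (σ w) = symMap g (liftPatch ψ w)}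
      mul_mem' := by
        rintro σ τ ⟨g, hg, hσ⟩ ⟨k, hk, hτ⟩
        refine ⟨symMul g k, by rw [← symMap_symMap, hk, hg], fun w => ?_⟩
        rw [Equiv.Perm.mul_apply, hσ, hτ, symMap_symMap]
      one_mem' := ⟨(1, 1, 0, 0), symMap_one _, fun w => (symMap_one _).symm⟩
      inv_mem' := by
        rintro σ ⟨g, hg, hσ⟩
        refine ⟨symInv g, symMap_symInv_eq hg, fun w => ?_⟩
        have h1 := hσ (σ.symm w)
        rw [Equiv.apply_symm_apply] at h1
        rw [h1, symInv_symMap]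
        rfl }
  finite_group := by
    have hfin : Finite {g : SymIndex | symMap g (toAmb y₀) = toAmb y₀} :=
      ((finite_symMap_dist_lt (toAmb y₀)).subset fun g hg => by
        rw [mem_ofPred_eq] at hg ⊢
        rw [hg, dist_self]
        exact one_pos).to_subtype
    -- Choosing an inducing stabilizer element for each permutation is injective, since the element
    -- determines the permutation.
    refine Finite.of_injective (β := {g : SymIndex | symMap g (toAmb y₀) = toAmb y₀})
      (fun σ => ⟨σ.2.choose, σ.2.choose_spec.1⟩) ?_
    intro σ τ hστ
    have h1 : σ.2.choose = τ.2.choose := congrArg Subtype.val hστ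
    apply Subtype.ext
    ext1 w
    apply Subtype.ext
    refine h.liftPatch_injOn (σ.1 w).2 (τ.1 w).2 ?_
    exact (σ.2.choose_spec.2 w).trans ((congrArg (fun g => symMap g (liftPatch ψ w)) h1).trans
      (τ.2.choose_spec.2 w).symm)
  smooth_group := by
    rintro σ ⟨g, hg, hσ⟩
    refine ⟨fun w => liftProj P (symMap g (liftPatch ψ w)), ?_, fun w => ?_⟩
    · exact (liftProj P).contDiff.comp_contDiffOn ((contDiff_symMap g).comp_contDiffOn
        (h.patch.contDiffOn_liftPatch.mono fun w hw => hw.1))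
    · beta_reduce
      rw [← hσ w]
      exact h.patch.liftProj_liftPatch (σ w).2.1
  toFun w := projX hS (niceLift ψ y₀ w)
  continuous_toFun := by
    refine (continuous_projX hS).comp (isEmbedding_toAmb.continuous_iff.2 ?_)
    have h1 : toAmb ∘ (fun w : niceSource O ψ (toAmb y₀) r => niceLift ψ y₀ (w : ModelE)) =
        fun w : niceSource O ψ (toAmb y₀) r => liftPatch ψ (w : ModelE) := funext fun w => h.toAmb_niceLift w.2.1
    rw [h1]
    exact (h.patch.contDiffOn_liftPatch.continuousOn.mono
      fun w (hw : w ∈ niceSource O ψ (toAmb y₀) r) => hw.1).domRestrict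
  isOpenMap_toFun := by
    refine (isOpenMap_projX hS).comp ?_
    intro W hW
    obtain ⟨W', hW', rfl⟩ := isOpen_induced_iff.1 hW
    have h1 : (fun w : niceSource O ψ (toAmb y₀) r => niceLift ψ y₀ (w : ModelE)) ''
        (Subtype.val ⁻¹' W') = toAmb ⁻¹' (Prod.fst ⁻¹' V ∩
          liftProj P ⁻¹' (W' ∩ niceSource O ψ (toAmb y₀) r)) := by
      ext z
      constructor
      · rintro ⟨w, hw, rfl⟩
        have h2 : toAmb (niceLift ψ y₀ (w : ModelE)) = liftPatch ψ w := h.toAmb_niceLift w.2.1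
        rw [mem_preimage, h2]
        refine ⟨(h.patch.mem _ w.2.1).2, ?_⟩
        rw [mem_preimage, h.patch.liftProj_liftPatch w.2.1]
        exact ⟨hw, w.2⟩
      · rintro ⟨hzV, hzW, hzU⟩
        refine ⟨⟨_, hzU⟩, hzW, toAmb_injective ?_⟩
        rw [h.toAmb_niceLift hzU.1]
        exact h.patch.liftPatch_liftProj z.1.2 hzV
    rw [h1]
    exact ((h.patch.isOpen_V.preimage continuous_fst).inter
      ((hW'.inter h.isOpen_source).preimage (liftProj P).continuous)).preimage continuous_toAmb
  toFun_eq_iff := by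
    intro w w'
    rw [projX_eq_iff]
    constructor
    · rintro ⟨g, hg⟩
      have h1 : symMap g (liftPatch ψ w) = liftPatch ψ w' := by
        rw [← h.toAmb_niceLift (y₀ := y₀) w.2.1, ← h.toAmb_niceLift (y₀ := y₀) w'.2.1, ← hg,
          toAmb_symAct]
      -- If g carries a point of the r-ball into the r-ball, it moves the centre by less than 2r, as
      -- g is an isometry. By the choice of r it then fixes the centre.
      have hgy : symMap g (toAmb y₀) = toAmb y₀ := by
        refine h.discrete g ?_
        have h2 := dist_triangle (symMap g (toAmb y₀)) (symMap g (liftPatch ψ w)) (toAmb y₀)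
        rw [dist_symMap, h1, dist_comm (toAmb y₀)] at h2
        linarith [w.2.2, w'.2.2]
      refine ⟨h.perm hsym hgy, ⟨g, hgy, h.liftPatch_perm hsym hgy⟩, Subtype.ext ?_⟩
      refine h.liftPatch_injOn (Subtype.prop _) w'.2 ?_
      rw [h.liftPatch_perm hsym hgy, h1]
    · rintro ⟨σ, ⟨g, hg, hσ⟩, rfl⟩
      refine ⟨g, toAmb_injective ?_⟩
      rw [toAmb_symAct, h.toAmb_niceLift w.2.1, h.toAmb_niceLift (σ w).2.1, hσ]

theorem isChartLift_chart [ChartedSpace E2 S] [IsManifold (𝓡 2) ∞ S]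
    (he : IsSmoothEmbedding (𝓡 2) 𝓘(ℝ, E3) ∞ (Subtype.val : S → E3))
    (hS : IsPlaneSymmetric S) (hsym : IsSymmetricSurface S n)
    (h : NicePatch S n P O V ψ m (toAmb y₀) r) :
    IsChartLift modelY (projX hS) (h.chart hS hsym) (niceLift ψ y₀) := by
  rw [isChartLift_iff he]
  refine ⟨?_, fun w hw => ?_, fun w => rfl⟩
  · exact (h.patch.contDiffOn_liftPatch.mono fun w hw => hw.1).congr
      fun w hw => h.toAmb_niceLift hw.1
  · have h1 : (fun w => toAmb (niceLift ψ y₀ w)) =ᶠ[𝓝 w] liftPatch ψ := by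
      filter_upwards [h.isOpen_source.mem_nhds hw] with w' hw'
      exact h.toAmb_niceLift hw'.1
    rw [h1.fderiv_eq]
    intro v v' hv
    rw [h.patch.fderiv_liftPatch_apply hw.1, h.patch.fderiv_liftPatch_apply hw.1] at hv
    refine Prod.ext ?_ (congrArg (fun z : Amb => z.2) hv)
    rw [← h.patch.proj_fderiv hw.1 v.1, ← h.patch.proj_fderiv hw.1 v'.1]
    exact congrArg P (congrArg (fun z : Amb => z.1) hv)

end NicePatch

end NiceCharts

/-! ### From invariant ambient forms to orbifold forms -/

section Representation

variable {S : Set E3} {n : E3 → E3} {k : ℕ}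

/-- Two maps into `S × ℝ × ℝ` which agree up to deck transformations pull back an invariant form to
the same form. -/
theorem formPullback_eq_of_forall_exists_symMap (hn : IsNormalSurface S n)
    {B : Amb → Amb [⋀^Fin k]→L[ℝ] ℝ} (hB : ContDiff ℝ ∞ B) (hinv : IsSymInvariant S n B)
    {U : Set ModelE} (hU : IsOpen U) {f₁ f₂ : ModelE → Amb} (h₁ : ContDiffOn ℝ ∞ f₁ U)
    (h₂ : ContDiffOn ℝ ∞ f₂ U) (hS₁ : ∀ u ∈ U, (f₁ u).1 ∈ S)
    (hg : ∀ u ∈ U, ∃ g, symMap g (f₁ u) = f₂ u) {u : ModelE} (hu : u ∈ U) :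
    formPullback f₂ B u = formPullback f₁ B u := by
  have : LocallyCompactSpace U := hU.locallyCompactSpace
  -- The deck transformation g may jump from point to point. The countably many closed sets C g
  -- cover U, so by Baire's theorem their interiors are dense. On these interiors g is constant and
  -- invariance applies, and continuity extends the equality to U.
  set C : SymIndex → Set U := fun g => {w | symMap g (f₁ w) = f₂ w} with hC
  have c₁ : Continuous fun w : U => f₁ w := h₁.continuousOn.domRestrict
  have c₂ : Continuous fun w : U => f₂ w := h₂.continuousOn.domRestrict
  have hclosed : ∀ g, IsClosed (C g) := fun g =>
    isClosed_eq ((contDiff_symMap g).continuous.comp c₁) c₂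
  have hunion : ⋃ g, C g = univ := eq_univ_of_forall fun w => by
    obtain ⟨g, hg⟩ := hg w w.2
    exact mem_iUnion.2 ⟨g, hg⟩
  have hdense : Dense (⋃ g, interior (C g)) := dense_iUnion_interior_of_closed hclosed hunion
  have p₁ : Continuous fun w : U => formPullback f₁ B w :=
    (h₁.formPullback hU hB.contDiffOn (mapsTo_univ _ _)).continuousOn.domRestrict
  have p₂ : Continuous fun w : U => formPullback f₂ B w :=
    (h₂.formPullback hU hB.contDiffOn (mapsTo_univ _ _)).continuousOn.domRestrict
  have heq := Continuous.ext_on hdense p₂ p₁ (by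
    intro w hw
    obtain ⟨g, hgw⟩ := mem_iUnion.1 hw
    have h3 : ∀ᶠ z : U in 𝓝 w, symMap g (f₁ z) = f₂ z := mem_interior_iff_mem_nhds.1 hgw
    have h4 : ∀ᶠ z in 𝓝 (w : ModelE), symMap g (f₁ z) = f₂ z := by
      rw [← hU.isOpenEmbedding_subtypeVal.map_nhds_eq w]
      exact h3
    have hd := ((h₁.contDiffAt (hU.mem_nhds w.2)).differentiableAt (by simp)).hasFDerivAt
    have h5 : fderiv ℝ f₂ w = (symLin g).comp (fderiv ℝ f₁ w) :=
      (((hasFDerivAt_symMap g _).comp (w : ModelE) hd).congr_of_eventuallyEq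
        (h4.mono fun z hz => hz.symm)).fderiv
    have htan : ∀ v, inner ℝ (n (f₁ w).1) (fderiv ℝ f₁ w v).1 = 0 := by
      intro v
      refine hn.inner_hasFDerivAt_eq_zero (f := fun z => (f₁ z).1) hd.fst ?_ v
      filter_upwards [hU.mem_nhds w.2] with z hz using hS₁ z hz
    ext v
    rw [formPullback_apply, formPullback_apply, h5, ← h4.self_of_nhds]
    exact hinv g _ (hS₁ w w.2) _ fun i => htan _)
  exact congrFun heq ⟨u, hu⟩

variable [ChartedSpace E2 S] (hS : IsPlaneSymmetric S)

/-- The form `B` of `ℝ³ × ℝ × ℝ` restricts on `S × ℝ × ℝ` to the pullback of the orbifold form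
`α`. -/
def Represents (B : Amb → Amb [⋀^Fin k]→L[ℝ] ℝ) (α : orbifoldForms (atlasX hS) k) : Prop :=
  ∀ (c : atlasX hS) (psi : ModelE → S × ℝ × ℝ), IsChartLift modelY (projX hS) c.1 psi →
    ∀ u ∈ c.1.source, α.1 c u = formPullback (fun u => toAmb (psi u)) B u

variable {hS}

theorem represents_zero : Represents hS (0 : Amb → Amb [⋀^Fin k]→L[ℝ] ℝ) 0 := by
  intro c psi _ u _
  ext v
  rw [formPullback_apply]
  rfl

theorem Represents.add {B B' : Amb → Amb [⋀^Fin k]→L[ℝ] ℝ} {α α' : orbifoldForms (atlasX hS) k}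
    (h : Represents hS B α) (h' : Represents hS B' α') : Represents hS (B + B') (α + α') := by
  intro c psi hpsi u hu
  change α.1 c u + α'.1 c u = _
  rw [h c psi hpsi u hu, h' c psi hpsi u hu]
  rfl

theorem Represents.smul {B : Amb → Amb [⋀^Fin k]→L[ℝ] ℝ} {α : orbifoldForms (atlasX hS) k}
    (h : Represents hS B α) (a : ℝ) : Represents hS (a • B) (a • α) := by
  intro c psi hpsi u hu
  change a • α.1 c u = _
  rw [h c psi hpsi u hu]
  rfl

theorem Represents.isInducedBy
    (he : IsSmoothEmbedding (𝓡 2) 𝓘(ℝ, E3) ∞ (Subtype.val : S → E3))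
    {B : Amb → Amb [⋀^Fin k]→L[ℝ] ℝ} {α : orbifoldForms (atlasX hS) k} (h : Represents hS B α)
    {Ω : (y : S × ℝ × ℝ) → (Fin k → TangentSpace modelY y) → ℝ}
    (hΩ : ∀ (y : S × ℝ × ℝ) (v : Fin k → ModelE), Ω y v = B (toAmb y) fun i => dAmb y (v i)) :
    IsInducedBy modelY (projX hS) α Ω := by
  intro c psi hpsi u hu v
  have hd := (hpsi.smooth.contMDiffAt (c.1.isOpen_source.mem_nhds hu)).mdifferentiableAt
    (by simp)
  rw [h c psi hpsi u hu, formPullback_apply]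
  refine Eq.trans ?_ (hΩ (psi u) fun i => mfderiv 𝓘(ℝ, ModelE) modelY psi u (v i)).symm
  congr 1
  ext1 i
  exact fderiv_toAmb_comp he.isImmersion.contMDiff hd (v i)

variable [IsManifold (𝓡 2) ∞ S]

theorem contDiffOn_toAmb_of_isChartLift
    (he : IsSmoothEmbedding (𝓡 2) 𝓘(ℝ, E3) ∞ (Subtype.val : S → E3))
    {c : OrbifoldChart ModelE (OrbifoldX hS)} {psi : ModelE → S × ℝ × ℝ}
    (h : IsChartLift modelY (projX hS) c psi) :
    ContDiffOn ℝ ∞ (fun u => toAmb (psi u)) c.source :=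
  ((isChartLift_iff he).1 h).1

theorem Represents.orbifoldD (he : IsSmoothEmbedding (𝓡 2) 𝓘(ℝ, E3) ∞ (Subtype.val : S → E3))
    {B : Amb → Amb [⋀^Fin k]→L[ℝ] ℝ} (hB : ContDiff ℝ ∞ B) {α : orbifoldForms (atlasX hS) k}
    (h : Represents hS B α) : Represents hS (extDeriv B) (orbifoldD (atlasX hS) k α) := by
  intro c psi hpsi u hu
  have hn := c.1.isOpen_source.mem_nhds hu
  have h1 : (_root_.orbifoldD (atlasX hS) k α).1 c u = extDeriv (α.1 c) u := if_pos hu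
  have h2 : α.1 c =ᶠ[𝓝 u] formPullback (fun u => toAmb (psi u)) B := by
    filter_upwards [hn] with w hw using h c psi hpsi w hw
  rw [h1, h2.extDeriv_eq,
    extDeriv_formPullback hB ((contDiffOn_toAmb_of_isChartLift he hpsi).contDiffAt hn)]

/-- Every invariant form represents an orbifold form. -/
theorem exists_represents (he : IsSmoothEmbedding (𝓡 2) 𝓘(ℝ, E3) ∞ (Subtype.val : S → E3))
    (hn : IsNormalSurface S n) {B : Amb → Amb [⋀^Fin k]→L[ℝ] ℝ} (hB : ContDiff ℝ ∞ B)
    (hinv : IsSymInvariant S n B) : ∃ α : orbifoldForms (atlasX hS) k, Represents hS B α := by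
  classical
  -- The form in a chart is the pullback of B by one chosen lift. Two lifts of the same points agree
  -- up to deck transformations, so neither the choice nor a change of charts matters.
  have hlift : ∀ c : atlasX hS, ∃ psi, IsChartLift modelY (projX hS) c.1 psi := fun c => c.2
  choose psi hpsi using hlift
  have hsm : ∀ c, ContDiffOn ℝ ∞ (fun u => toAmb (psi c u)) c.1.source := fun c =>
    contDiffOn_toAmb_of_isChartLift he (hpsi c)
  have hpull : ∀ c, ContDiffOn ℝ ∞ (formPullback (fun u => toAmb (psi c u)) B) c.1.source :=
    fun c => (hsm c).formPullback c.1.isOpen_source hB.contDiffOn (mapsTo_univ _ _)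
  refine ⟨⟨fun c u => if u ∈ c.1.source then formPullback (fun u => toAmb (psi c u)) B u else 0,
    fun c => (hpull c).congr fun u hu => if_pos hu, fun c u hu => if_neg hu,
    fun c c' lam hlam u hu => ?_⟩, fun c psi' hpsi' u hu => ?_⟩
  · have hlu := hlam.mapsTo hu
    have hd : DifferentiableAt ℝ lam u :=
      (hlam.smooth.contDiffAt (c.1.isOpen_source.mem_nhds hu)).differentiableAt (by simp)
    have hd' : DifferentiableAt ℝ (fun u => toAmb (psi c' u)) (lam u) :=
      ((hsm c').contDiffAt (c'.1.isOpen_source.mem_nhds hlu)).differentiableAt (by simp)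
    beta_reduce
    rw [if_pos hu, if_pos hlu]
    have h1 := formPullback_eq_of_forall_exists_symMap hn hB hinv c.1.isOpen_source (hsm c)
      (f₂ := fun u => toAmb (psi c' (lam u))) ((hsm c').comp hlam.smooth hlam.mapsTo)
      (fun u _ => (psi c u).1.2) (fun w hw => by
        have h2 := hlam.over_base ⟨w, hw⟩
        rw [← (hpsi c).over_base ⟨w, hw⟩, ← (hpsi c').over_base ⟨lam w, hlam.mapsTo hw⟩] at h2
        obtain ⟨g, hg⟩ := (projX_eq_iff hS _ _).1 h2.symm
        exact ⟨g, by rw [← toAmb_symAct hS, hg]⟩) hu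
    rw [← h1]
    ext v
    rw [formPullback_apply]
    have h3 := (hd'.hasFDerivAt.comp u hd.hasFDerivAt).fderiv
    change fderiv ℝ (fun u => toAmb (psi c' (lam u))) u = _ at h3
    rw [h3]
    rfl
  · change (if u ∈ c.1.source then formPullback (fun u => toAmb (psi c u)) B u else 0) = _
    rw [if_pos hu]
    exact formPullback_eq_of_forall_exists_symMap hn hB hinv c.1.isOpen_source
      (contDiffOn_toAmb_of_isChartLift he hpsi') (hsm c)
      (fun u _ => (psi' u).1.2) (fun w hw => by
        have h2 := (hpsi c).over_base ⟨w, hw⟩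
        rw [← hpsi'.over_base ⟨w, hw⟩] at h2
        obtain ⟨g, hg⟩ := (projX_eq_iff hS _ _).1 h2.symm
        exact ⟨g, by rw [← toAmb_symAct hS, hg]⟩) hu

theorem inner_fderiv_toAmb_of_isChartLift
    (he : IsSmoothEmbedding (𝓡 2) 𝓘(ℝ, E3) ∞ (Subtype.val : S → E3)) (hn : IsNormalSurface S n)
    {c : OrbifoldChart ModelE (OrbifoldX hS)} {psi : ModelE → S × ℝ × ℝ}
    (h : IsChartLift modelY (projX hS) c psi) {u : ModelE} (hu : u ∈ c.source) (v : ModelE) :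
    inner ℝ (n (toAmb (psi u)).1) (fderiv ℝ (fun u => toAmb (psi u)) u v).1 = 0 := by
  have hd := ((contDiffOn_toAmb_of_isChartLift he h).contDiffAt
    (c.isOpen_source.mem_nhds hu)).differentiableAt (by simp)
  exact hn.inner_hasFDerivAt_eq_zero (f := fun z => (toAmb (psi z)).1) hd.hasFDerivAt.fst
    (Eventually.of_forall fun z => (psi z).1.2) v

/-- Orbifold forms that are represented by forms with equal restrictions are equal. -/
theorem Represents.eq_of_ambEq
    (he : IsSmoothEmbedding (𝓡 2) 𝓘(ℝ, E3) ∞ (Subtype.val : S → E3)) (hn : IsNormalSurface S n)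
    {B B' : Amb → Amb [⋀^Fin k]→L[ℝ] ℝ} {α α' : orbifoldForms (atlasX hS) k}
    (h : Represents hS B α) (h' : Represents hS B' α') (hBB' : AmbEq S n B B') : α = α' := by
  apply Subtype.ext
  ext1 c
  ext1 u
  by_cases hu : u ∈ c.1.source
  · obtain ⟨psi, hpsi⟩ := c.2
    rw [h c psi hpsi u hu, h' c psi hpsi u hu]
    ext v
    exact hBB' _ (psi u).1.2 _ fun i => inner_fderiv_toAmb_of_isChartLift he hn hpsi hu _
  · rw [α.2.2.1 c u hu, α'.2.2.1 c u hu]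

end Representation

/-! ### Comparison of an arbitrary chart with a patch chart -/

section Comparison

variable {S : Set E3} {n : E3 → E3} {k : ℕ} {P : E3 →L[ℝ] E2} {O : Set E2} {V : Set E3}
  {ψ : E2 → E3} {m : E3}

theorem NicePatch.exists_niceSource_subset {y : Amb} {r : ℝ} (h : NicePatch S n P O V ψ m y r)
    {T : Set ModelE} (hT : T ∈ 𝓝 (liftProj P y)) :
    ∃ r', 0 < r' ∧ r' ≤ r ∧ niceSource O ψ y r' ⊆ T := by
  obtain ⟨δ, hδ, hball⟩ := Metric.mem_nhds_iff.1
    ((liftProj P).continuous.continuousAt.preimage_mem_nhds hT)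
  refine ⟨min δ r, lt_min hδ h.pos, min_le_right _ _, fun w hw => ?_⟩
  have h1 : liftProj P (liftPatch ψ w) ∈ T := hball (hw.2.trans_le (min_le_left _ _))
  rwa [h.patch.liftProj_liftPatch hw.1] at h1

theorem exists_continuousLinearEquiv_of_injective {F : Type*} [NormedAddCommGroup F]
    [NormedSpace ℝ F] [FiniteDimensional ℝ F] {L : F →L[ℝ] F} (h : Function.Injective L) :
    ∃ e : F ≃L[ℝ] F, (e : F →L[ℝ] F) = L :=
  ⟨(LinearEquiv.ofInjectiveEndo (L : F →ₗ[ℝ] F) h).toContinuousLinearEquiv, by ext; rfl⟩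

/-- Near a point at which its derivatives are injective, a smooth map has a smooth local
inverse. -/
theorem exists_smooth_local_inverse {F : Type*} [NormedAddCommGroup F] [NormedSpace ℝ F]
    [FiniteDimensional ℝ F] {h : F → F} {W : Set F} (hW : IsOpen W) (hs : ContDiffOn ℝ ∞ h W)
    (hinj : ∀ u ∈ W, Function.Injective (fderiv ℝ h u)) {u : F} (hu : u ∈ W) :
    ∃ (T : Set F) (lam : F → F), T ∈ 𝓝 (h u) ∧ lam (h u) = u ∧ ContDiffOn ℝ ∞ lam T ∧
      MapsTo lam T W ∧ (∀ w ∈ T, h (lam w) = w) ∧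
      ∀ w ∈ T, (fderiv ℝ h (lam w)).comp (fderiv ℝ lam w) = ContinuousLinearMap.id ℝ F ∧
        Function.Bijective (fderiv ℝ lam w) := by
  have : CompleteSpace F := FiniteDimensional.complete ℝ F
  have hder : ∀ u ∈ W, ∃ e : F ≃L[ℝ] F, HasFDerivAt h (e : F →L[ℝ] F) u := by
    intro u hu
    obtain ⟨e, he⟩ := exists_continuousLinearEquiv_of_injective (hinj u hu)
    refine ⟨e, ?_⟩
    rw [he]
    exact ((hs.contDiffAt (hW.mem_nhds hu)).differentiableAt (by simp)).hasFDerivAt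
  obtain ⟨e, he⟩ := hder u hu
  set Φ := (hs.contDiffAt (hW.mem_nhds hu)).toOpenPartialHomeomorph h he (by simp) with hΦ
  have hcoe : ∀ x, Φ x = h x := fun x => rfl
  have hmem : u ∈ Φ.source := ContDiffAt.mem_toOpenPartialHomeomorph_source _ he _
  have hinvu : Φ.symm (h u) = u := Φ.left_inv hmem
  have hTn : Φ.target ∩ Φ.symm ⁻¹' W ∈ 𝓝 (h u) := by
    have ht : h u ∈ Φ.target := Φ.map_source hmem
    refine (Φ.isOpen_inter_preimage_symm hW).mem_nhds ⟨ht, ?_⟩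
    rw [mem_preimage, hinvu]
    exact hu
  have hright : ∀ w ∈ Φ.target, h (Φ.symm w) = w := fun w hw => Φ.right_inv hw
  refine ⟨Φ.target ∩ Φ.symm ⁻¹' W, Φ.symm, hTn, hinvu, fun w hw => ?_, fun w hw => hw.2,
    fun w hw => hright w hw.1, fun w hw => ?_⟩
  · obtain ⟨e', he'⟩ := hder _ hw.2
    exact (Φ.contDiffAt_symm hw.1 he' (hs.contDiffAt (hW.mem_nhds hw.2))).contDiffWithinAt
  · obtain ⟨e', he'⟩ := hder _ hw.2
    rw [(Φ.hasFDerivAt_symm hw.1 he').fderiv, he'.fderiv]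
    exact ⟨by ext v; simp, e'.symm.bijective⟩

variable [ChartedSpace E2 S] [IsManifold (𝓡 2) ∞ S] {hS : IsPlaneSymmetric S}

/-- The atlas element given by a patch. -/
noncomputable def NicePatch.atlasChart
    (he : IsSmoothEmbedding (𝓡 2) 𝓘(ℝ, E3) ∞ (Subtype.val : S → E3)) (hS : IsPlaneSymmetric S)
    (hsym : IsSymmetricSurface S n) {y₀ : S × ℝ × ℝ} {r : ℝ}
    (h : NicePatch S n P O V ψ m (toAmb y₀) r) : atlasX hS :=
  ⟨h.chart hS hsym, niceLift ψ y₀, h.isChartLift_chart he hS hsym⟩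

/-- An orbifold form in an arbitrary chart is determined by the chart of a patch. -/
theorem NicePatch.apply_eq
    (he : IsSmoothEmbedding (𝓡 2) 𝓘(ℝ, E3) ∞ (Subtype.val : S → E3)) (hn : IsNormalSurface S n)
    (hsym : IsSymmetricSurface S n) {y₀ : S × ℝ × ℝ} {r : ℝ}
    (h₀ : NicePatch S n P O V ψ m (toAmb y₀) r) (α : orbifoldForms (atlasX hS) k)
    (c : atlasX hS) {psi : ModelE → S × ℝ × ℝ} (hpsi : IsChartLift modelY (projX hS) c.1 psi)
    {u : ModelE} (hu : u ∈ c.1.source) (huV : (toAmb (psi u)).1 ∈ V)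
    (hu₀ : liftProj P (toAmb (psi u)) ∈ niceSource O ψ (toAmb y₀) r) :
    α.1 c u = (α.1 (h₀.atlasChart he hS hsym) (liftProj P (toAmb (psi u)))).compContinuousLinearMap
      ((liftProj P).comp (fderiv ℝ (fun u => toAmb (psi u)) u)) := by
  set f : ModelE → Amb := fun u => toAmb (psi u) with hf
  obtain ⟨hfs, hfi, hfo⟩ := (isChartLift_iff he).1 hpsi
  have hc := c.1.isOpen_source
  set W : Set ModelE := c.1.source ∩ f ⁻¹' (Prod.fst ⁻¹' V) with hW
  have hWo : IsOpen W := hfs.continuousOn.isOpen_inter_preimage hc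
    (h₀.patch.isOpen_V.preimage continuous_fst)
  have hfd : ∀ w ∈ W, HasFDerivAt f (fderiv ℝ f w) w := fun w hw =>
    ((hfs.contDiffAt (hc.mem_nhds hw.1)).differentiableAt (by simp)).hasFDerivAt
  set h : ModelE → ModelE := fun u => liftProj P (f u) with hh
  have hhs : ContDiffOn ℝ ∞ h W := (liftProj P).contDiff.comp_contDiffOn
    (hfs.mono inter_subset_left)
  have hhd : ∀ w ∈ W, fderiv ℝ h w = (liftProj P).comp (fderiv ℝ f w) := fun w hw =>
    ((liftProj P).hasFDerivAt.comp w (hfd w hw)).fderiv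
  have hSf : ∀ w, (f w).1 ∈ S := fun w => (psi w).1.2
  have hinj : ∀ w ∈ W, Function.Injective (fderiv ℝ h w) := by
    intro w hw
    rw [hhd w hw]
    intro v v' hv
    have htan := inner_fderiv_toAmb_of_isChartLift he hn hpsi hw.1
    have e := fun v => h₀.patch.fderiv_liftPatch_liftProj (hSf w) hw.2 (htan v)
    apply hfi w hw.1
    have e1 := e v
    have e2 := e v'
    rw [← e1, ← e2]
    exact congrArg _ hv
  have huW : u ∈ W := ⟨hu, huV⟩
  obtain ⟨T, lam, hT, hlamu, hlams, hlamW, hright, hbij⟩ :=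
    exists_smooth_local_inverse hWo hhs hinj huW
  have hT₀ : T ∩ niceSource O ψ (toAmb y₀) r ∈ 𝓝 (h u) :=
    inter_mem hT (h₀.isOpen_source.mem_nhds hu₀)
  obtain ⟨r₁, hr₁⟩ := h₀.patch.exists_nicePatch (y := f u) huV
  obtain ⟨r₂, hr₂, hr₂₁, hsub⟩ := hr₁.exists_niceSource_subset hT₀
  -- A smaller patch chart centred at the point psi(u) embeds into the given patch chart by the
  -- identity and into c by the local inverse of liftProj ∘ toAmb ∘ psi. Compatibility under these
  -- two embeddings relates the two values of α.
  have h₁ : NicePatch S n P O V ψ m (toAmb (psi u)) r₂ := hr₁.mono hr₂ hr₂₁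
  have hmem : h u ∈ niceSource O ψ (f u) r₂ := by
    refine ⟨hu₀.1, ?_⟩
    rw [h₀.patch.liftPatch_liftProj (hSf u) huV, dist_self]
    exact hr₂
  have hflam : ∀ w ∈ niceSource O ψ (f u) r₂, f (lam w) = liftPatch ψ w := by
    intro w hw
    have hw' := hlamW (hsub hw).1
    have e1 := h₀.patch.liftPatch_liftProj (hSf (lam w)) hw'.2
    have e2 : liftProj P (f (lam w)) = w := hright w (hsub hw).1
    rw [e2] at e1
    exact e1.symm
  have emb₀ : IsChartEmbedding (h₁.atlasChart he hS hsym).1 (h₀.atlasChart he hS hsym).1 id := by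
    refine ⟨contDiffOn_id, injOn_id _, fun w _ => ?_, fun w hw => (hsub hw).2, fun w => ?_⟩
    · rw [fderiv_id]
      exact Function.bijective_id
    · change projX hS (niceLift ψ y₀ w) = projX hS (niceLift ψ (psi u) w)
      congr 1
      apply toAmb_injective
      rw [h₀.toAmb_niceLift w.2.1, h₁.toAmb_niceLift w.2.1]
  have emb : IsChartEmbedding (h₁.atlasChart he hS hsym).1 c.1 lam := by
    refine ⟨hlams.mono fun w hw => (hsub hw).1, fun w hw w' hw' hww => ?_,
      fun w hw => (hbij w (hsub hw).1).2, fun w hw => (hlamW (hsub hw).1).1, fun w => ?_⟩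
    · rw [← hright w (hsub hw).1, hww, hright w' (hsub hw').1]
    · rw [← hfo]
      change projX hS (psi (lam w)) = projX hS (niceLift ψ (psi u) w)
      congr 1
      apply toAmb_injective
      rw [h₁.toAmb_niceLift w.2.1]
      exact hflam w w.2
  have a₀ := α.2.2.2 _ _ _ emb₀ (h u) hmem
  have a₁ := α.2.2.2 _ _ _ emb (h u) hmem
  rw [a₀, hlamu] at a₁
  have hcomp := (hbij (h u) (mem_of_mem_nhds hT)).1
  have hsurj := (hbij (h u) (mem_of_mem_nhds hT)).2.2
  rw [hlamu, hhd u huW] at hcomp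
  ext v
  -- Writing the vectors as images under the bijective derivative of lam allows that derivative to
  -- be cancelled against the derivative of h.
  choose v' hv' using fun i => hsurj (v i)
  have a₂ := congrArg (fun L => L v') a₁
  have e1 : v = fun i => fderiv ℝ lam (h u) (v' i) := funext fun i => (hv' i).symm
  rw [e1]
  refine a₂.symm.trans ?_
  rw [fderiv_id]
  refine congrArg (α.1 (h₀.atlasChart he hS hsym) (h u)) (funext fun i => ?_)
  exact (congrArg (fun L : ModelE →L[ℝ] ModelE => L (v' i)) hcomp).symm

end Comparison

/-! ### From orbifold forms to ambient forms -/

section Extension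

variable {S : Set E3} {n : E3 → E3} {k : ℕ} [ChartedSpace E2 S] [IsManifold (𝓡 2) ∞ S]
  {hS : IsPlaneSymmetric S}

/-- Every orbifold form is represented by a form on `ℝ³ × ℝ × ℝ`. -/
theorem exists_form_represents
    (he : IsSmoothEmbedding (𝓡 2) 𝓘(ℝ, E3) ∞ (Subtype.val : S → E3)) (hn : IsNormalSurface S n)
    (hsym : IsSymmetricSurface S n) (α : orbifoldForms (atlasX hS) k) :
    ∃ B : Amb → Amb [⋀^Fin k]→L[ℝ] ℝ, ContDiff ℝ ∞ B ∧ Represents hS B α := by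
  -- Pulling back to α under all lifts through z is a convex condition on the value at z, so local
  -- solutions glue by a partition of unity. Near S × ℝ × ℝ a solution is the pullback by `liftProj`
  -- of the form in a patch chart. Elsewhere there is no condition.
  have key : ∃ g : C^∞⟮𝓘(ℝ, Amb), Amb; 𝓘(ℝ, Amb [⋀^Fin k]→L[ℝ] ℝ), Amb [⋀^Fin k]→L[ℝ] ℝ⟯,
      ∀ z, g z ∈ {b : Amb [⋀^Fin k]→L[ℝ] ℝ | ∀ (c : atlasX hS) (psi : ModelE → S × ℝ × ℝ),
        IsChartLift modelY (projX hS) c.1 psi → ∀ u ∈ c.1.source, toAmb (psi u) = z →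
          α.1 c u = b.compContinuousLinearMap (fderiv ℝ (fun u => toAmb (psi u)) u)} := by
    refine exists_contMDiffMap_forall_mem_convex_of_local 𝓘(ℝ, Amb) (fun z => ?_) (fun z => ?_)
    · intro b hb b' hb' s t _ _ hst c psi hpsi u hu hz
      have h1 : α.1 c u = s • α.1 c u + t • α.1 c u := by rw [← add_smul, hst, one_smul]
      rw [h1]
      conv_lhs =>
        congr
        · rw [hb c psi hpsi u hu hz]
        · rw [hb' c psi hpsi u hu hz]
      rfl
    · by_cases hz : z.1 ∈ S
      · set y₀ : S × ℝ × ℝ := (⟨z.1, hz⟩, z.2) with hy₀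
        obtain ⟨P, O, V, ψ, m, r, h₀⟩ := hn.exists_nicePatch (y := toAmb y₀) hz
        have hV : z.1 ∈ V := h₀.ball_subset _ (by
          rw [show (toAmb y₀).1 = z.1 from rfl, dist_self]
          exact h₀.pos)
        set N : Set Amb := Prod.fst ⁻¹' V ∩ liftProj P ⁻¹' niceSource O ψ (toAmb y₀) r with hN
        have hNo : IsOpen N := (h₀.patch.isOpen_V.preimage continuous_fst).inter
          (h₀.isOpen_source.preimage (liftProj P).continuous)
        have hzN : z ∈ N := ⟨hV, (h₀.liftPatch_liftProj (z := z) hz (by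
          rw [show toAmb y₀ = z from rfl, dist_self]
          exact h₀.pos)).2⟩
        refine ⟨N, hNo.mem_nhds hzN,
          formPullback (liftProj P) (α.1 (h₀.atlasChart he hS hsym)), ?_, fun z' hz' => ?_⟩
        · rw [contMDiffOn_iff_contDiffOn]
          exact ContDiffOn.formPullback hNo (liftProj P).contDiff.contDiffOn
            (α.2.1 (h₀.atlasChart he hS hsym)) fun z' hz' => hz'.2
        · rintro c psi hpsi u hu rfl
          rw [h₀.apply_eq he hn hsym α c hpsi hu hz'.1 hz'.2]
          ext v
          rw [formPullback, ContinuousLinearMap.fderiv]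
          rfl
      · refine ⟨(Prod.fst ⁻¹' S)ᶜ, ?_, fun _ => 0, contMDiffOn_const, fun z' hz' => ?_⟩
        · exact (hn.isCompact.isClosed.preimage continuous_fst).isOpen_compl.mem_nhds hz
        · rintro c psi hpsi u hu rfl
          exact absurd (psi u).1.2 hz'
  obtain ⟨g, hg⟩ := key
  exact ⟨g, contMDiff_iff_contDiff.1 g.contMDiff, fun c psi hpsi u hu => hg _ c psi hpsi u hu rfl⟩

/-- The chart of a patch at `y`, in a form that is convenient for evaluating orbifold forms. -/
theorem exists_isChartLift_through
    (he : IsSmoothEmbedding (𝓡 2) 𝓘(ℝ, E3) ∞ (Subtype.val : S → E3)) (hn : IsNormalSurface S n)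
    (hsym : IsSymmetricSurface S n) {y : Amb} (hy : y.1 ∈ S) :
    ∃ (c : atlasX hS) (psi : ModelE → S × ℝ × ℝ) (u : ModelE),
      IsChartLift modelY (projX hS) c.1 psi ∧ u ∈ c.1.source ∧ toAmb (psi u) = y ∧
      ∀ v : Amb, inner ℝ (n y.1) v.1 = 0 → ∃ v', fderiv ℝ (fun u => toAmb (psi u)) u v' = v := by
  set y₀ : S × ℝ × ℝ := (⟨y.1, hy⟩, y.2) with hy₀
  obtain ⟨P, O, V, ψ, m, r, h₀⟩ := hn.exists_nicePatch (y := toAmb y₀) hy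
  have hV : y.1 ∈ V := h₀.ball_subset _ (by
    rw [show (toAmb y₀).1 = y.1 from rfl, dist_self]
    exact h₀.pos)
  have hu := h₀.liftPatch_liftProj (z := y) hy (by
    rw [show toAmb y₀ = y from rfl, dist_self]
    exact h₀.pos)
  refine ⟨h₀.atlasChart he hS hsym, niceLift ψ y₀, liftProj P y, h₀.isChartLift_chart he hS hsym,
    hu.2, (h₀.toAmb_niceLift hu.2.1).trans hu.1, fun v hv => ⟨liftProj P v, ?_⟩⟩
  have h1 : (fun w => toAmb (niceLift ψ y₀ w)) =ᶠ[𝓝 (liftProj P y)] liftPatch ψ := by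
    filter_upwards [h₀.isOpen_source.mem_nhds hu.2] with w hw
    exact h₀.toAmb_niceLift hw.1
  rw [h1.fderiv_eq]
  exact h₀.patch.fderiv_liftPatch_liftProj hy hV hv

/-- The restriction of a form is determined by the orbifold form that it represents. -/
theorem Represents.ambEq
    (he : IsSmoothEmbedding (𝓡 2) 𝓘(ℝ, E3) ∞ (Subtype.val : S → E3)) (hn : IsNormalSurface S n)
    (hsym : IsSymmetricSurface S n) {B B' : Amb → Amb [⋀^Fin k]→L[ℝ] ℝ}
    {α : orbifoldForms (atlasX hS) k} (h : Represents hS B α) (h' : Represents hS B' α) :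
    AmbEq S n B B' := by
  intro y hy v hv
  obtain ⟨c, psi, u, hpsi, hu, rfl, hsurj⟩ := exists_isChartLift_through (hS := hS) he hn hsym hy
  choose v' hv' using fun i => hsurj (v i) (hv i)
  have h1 := (h c psi hpsi u hu).symm.trans (h' c psi hpsi u hu)
  have h2 := congrArg (fun L => L v') h1
  simp only [formPullback_apply, hv'] at h2
  exact h2

/-- A lift composed with a deck transformation is another lift of the same chart, and B pulls back
to the same form under both. -/
theorem Represents.isSymInvariant
    (he : IsSmoothEmbedding (𝓡 2) 𝓘(ℝ, E3) ∞ (Subtype.val : S → E3)) (hn : IsNormalSurface S n)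
    (hsym : IsSymmetricSurface S n) {B : Amb → Amb [⋀^Fin k]→L[ℝ] ℝ}
    {α : orbifoldForms (atlasX hS) k} (h : Represents hS B α) : IsSymInvariant S n B := by
  intro g y hy v hv
  obtain ⟨c, psi, u, hpsi, hu, rfl, hsurj⟩ := exists_isChartLift_through (hS := hS) he hn hsym hy
  choose v' hv' using fun i => hsurj (v i) (hv i)
  obtain ⟨hs, hi, ho⟩ := (isChartLift_iff he).1 hpsi
  have hd : ∀ w ∈ c.1.source, HasFDerivAt (fun u => toAmb (symAct hS g (psi u)))
      ((symLin g).comp (fderiv ℝ (fun u => toAmb (psi u)) w)) w := by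
    intro w hw
    have h1 := (hasFDerivAt_symMap g (toAmb (psi w))).comp w
      ((hs.contDiffAt (c.1.isOpen_source.mem_nhds hw)).differentiableAt (by simp)).hasFDerivAt
    refine h1.congr_of_eventuallyEq (Eventually.of_forall fun w => ?_)
    exact toAmb_symAct hS g (psi w)
  have hpsi' : IsChartLift modelY (projX hS) c.1 fun u => symAct hS g (psi u) := by
    rw [isChartLift_iff he]
    refine ⟨?_, fun w hw => ?_, fun w => ?_⟩
    · refine ((contDiff_symMap g).comp_contDiffOn hs).congr fun w _ => ?_
      exact toAmb_symAct hS g (psi w)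
    · rw [(hd w hw).fderiv]
      exact (symLin_injective g).comp (hi w hw)
    · rw [projX_symAct, ho]
  have h1 := (h c psi hpsi u hu).symm.trans (h c _ hpsi' u hu)
  have h2 := congrArg (fun L => L v') h1
  simp only [formPullback_apply] at h2
  rw [(hd u hu).fderiv] at h2
  simp only [ContinuousLinearMap.comp_apply, hv', toAmb_symAct] at h2
  exact h2.symm

end Extension

/-! ### The given forms as restrictions of ambient forms -/

section InducedForms

variable {S : Set E3} [ChartedSpace E2 S]

theorem mfderiv_val_fst (hi : ContMDiff (𝓡 2) 𝓘(ℝ, E3) ∞ (Subtype.val : S → E3))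
    (y : S × ℝ × ℝ) (v : ModelE) :
    (mfderiv modelY 𝓘(ℝ, E3) (fun z : S × ℝ × ℝ => (z.1 : E3)) y : ModelE →L[ℝ] E3) v =
      (dAmb y v).1 := by
  have h1 : MDifferentiableAt modelY (𝓡 2) (Prod.fst : S × ℝ × ℝ → S) y := mdifferentiableAt_fst
  have h2 : MDifferentiableAt (𝓡 2) 𝓘(ℝ, E3) (Subtype.val : S → E3) y.1 :=
    hi.mdifferentiableAt (by simp)
  have h3 := mfderiv_comp y h2 h1
  rw [mfderiv_fst] at h3
  exact congrArg (fun L : ModelE →L[ℝ] E3 => L v) h3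

theorem formDt_eq (y : S × ℝ × ℝ) (v : ModelE) : formDt y v = (dAmb y v).2.1 := by
  have h1 : MDifferentiableAt modelY (𝓘(ℝ, ℝ).prod 𝓘(ℝ, ℝ)) (Prod.snd : S × ℝ × ℝ → ℝ × ℝ) y :=
    mdifferentiableAt_snd
  have h2 : MDifferentiableAt (𝓘(ℝ, ℝ).prod 𝓘(ℝ, ℝ)) 𝓘(ℝ, ℝ) (Prod.fst : ℝ × ℝ → ℝ) y.2 :=
    mdifferentiableAt_fst
  have h3 := mfderiv_comp y h2 h1
  rw [mfderiv_fst, mfderiv_snd] at h3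
  exact congrArg (fun L : ModelE →L[ℝ] ℝ => L v) h3

theorem formDs_eq (y : S × ℝ × ℝ) (v : ModelE) : formDs y v = (dAmb y v).2.2 := by
  have h1 : MDifferentiableAt modelY (𝓘(ℝ, ℝ).prod 𝓘(ℝ, ℝ)) (Prod.snd : S × ℝ × ℝ → ℝ × ℝ) y :=
    mdifferentiableAt_snd
  have h2 : MDifferentiableAt (𝓘(ℝ, ℝ).prod 𝓘(ℝ, ℝ)) 𝓘(ℝ, ℝ) (Prod.snd : ℝ × ℝ → ℝ) y.2 :=
    mdifferentiableAt_snd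
  have h3 := mfderiv_comp y h2 h1
  rw [mfderiv_snd, mfderiv_snd] at h3
  exact congrArg (fun L : ModelE →L[ℝ] ℝ => L v) h3

theorem areaForm_eq (hi : ContMDiff (𝓡 2) 𝓘(ℝ, E3) ∞ (Subtype.val : S → E3)) {N : S → E3}
    {n : E3 → E3} (hnN : ∀ q : S, n q = N q) (y : S × ℝ × ℝ) (v : Fin 2 → ModelE) :
    areaForm N y v = areaAmb n (toAmb y) fun i => dAmb y (v i) := by
  rw [areaAmb_apply, ← mfderiv_val_fst hi, ← mfderiv_val_fst hi, show (toAmb y).1 = y.1 from rfl,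
    hnN]
  rfl

theorem formDtDs_eq (y : S × ℝ × ℝ) (v : Fin 2 → ModelE) :
    formDtDs y v = dtdsAmb (toAmb y) fun i => dAmb y (v i) := by
  rw [dtdsAmb_apply, ← formDt_eq, ← formDt_eq, ← formDs_eq, ← formDs_eq]
  rfl

end InducedForms

/-! ### Translation to the cohomology of X -/

set_option maxHeartbeats 1000000 in
theorem mainTheorem4 (S : Set E3) [ChartedSpace E2 S] [IsManifold (𝓡 2) ∞ S]
    (hgenus : IsEmbeddedSurfaceOfGenus S 2) (hS : IsPlaneSymmetric S)
    (N : S → E3) (hN : IsOuterUnitNormal S N) :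
    Module.finrank ℝ (orbifoldCohomology (atlasX hS) 2) = 2 ∧
    ∃ omegaS dtds : closedForms (atlasX hS) 2,
      IsInducedBy modelY (projX hS) omegaS.1 (areaForm N) ∧
      IsInducedBy modelY (projX hS) dtds.1 formDtDs ∧
      LinearIndependent ℝ ![cohomologyClass (atlasX hS) 2 omegaS,
        cohomologyClass (atlasX hS) 2 dtds] ∧
      Submodule.span ℝ {cohomologyClass (atlasX hS) 2 omegaS,
        cohomologyClass (atlasX hS) 2 dtds} = ⊤ := by
  obtain ⟨n, hn, hsym, hnN⟩ := exists_normal_extension hgenus hS hN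
  have he := hgenus.isSmoothEmbedding
  have sA := contDiff_areaAmb hn.smooth
  obtain ⟨om, hom⟩ := exists_represents (hS := hS) he hn sA (isSymInvariant_areaAmb hsym)
  obtain ⟨τ, hτ⟩ := exists_represents (hS := hS) he hn contDiff_dtdsAmb isSymInvariant_dtdsAmb
  have com : orbifoldD (atlasX hS) 2 om = 0 :=
    (hom.orbifoldD he sA).eq_of_ambEq he hn represents_zero (extDeriv_areaAmb hn)
  have cτ : orbifoldD (atlasX hS) 2 τ = 0 :=
    (hτ.orbifoldD he contDiff_dtdsAmb).eq_of_ambEq he hn represents_zero (by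
      rw [extDeriv_dtdsAmb]
      exact AmbEq.refl 0)
  set omegaS : closedForms (atlasX hS) 2 := ⟨om, LinearMap.mem_ker.2 com⟩ with homega
  set dtds : closedForms (atlasX hS) 2 := ⟨τ, LinearMap.mem_ker.2 cτ⟩ with hdtds
  have hind : LinearIndependent ℝ ![cohomologyClass (atlasX hS) 2 omegaS,
      cohomologyClass (atlasX hS) 2 dtds] := by
    refine LinearIndependent.pair_iff.2 fun a b hab => ?_
    have h1 : cohomologyClass (atlasX hS) 2 (a • omegaS + b • dtds) = 0 := hab
    rw [Submodule.Quotient.mk_eq_zero] at h1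
    obtain ⟨β, hβ⟩ : ∃ β, orbifoldD (atlasX hS) 1 β = a • om + b • τ := h1
    -- An orbifold primitive comes from an ambient form, which is automatically invariant, so
    -- independence reduces to the statement about invariant forms.
    obtain ⟨η, hη, hηβ⟩ := exists_form_represents (hS := hS) he hn hsym β
    refine eq_zero_of_area_add_dtds_exact hn hη (hηβ.isSymInvariant he hn hsym) ?_
    refine Represents.ambEq he hn hsym ((hom.smul a).add (hτ.smul b)) ?_
    rw [← hβ]
    exact hηβ.orbifoldD he hη
  have hspan : Submodule.span ℝ {cohomologyClass (atlasX hS) 2 omegaS,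
      cohomologyClass (atlasX hS) 2 dtds} = ⊤ := by
    refine eq_top_iff.2 fun x _ => ?_
    obtain ⟨α, rfl⟩ := Submodule.Quotient.mk_surjective _ x
    have hα : orbifoldD (atlasX hS) 2 α.1 = 0 := LinearMap.mem_ker.1 α.2
    obtain ⟨B, hB, hBα⟩ := exists_form_represents (hS := hS) he hn hsym α.1
    have hdB := hBα.orbifoldD he hB
    rw [hα] at hdB
    -- The primitive η is invariant, which is what allows it to descend to an orbifold form β.
    obtain ⟨a, b, η, hη, hηinv, hdec⟩ := exists_eq_area_add_dtds_add_exact hn hsym hB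
      (hBα.isSymInvariant he hn hsym) (hdB.ambEq he hn hsym represents_zero)
    obtain ⟨β, hβ⟩ := exists_represents (hS := hS) he hn hη hηinv
    have h1 : α.1 = a • om + b • τ + orbifoldD (atlasX hS) 1 β :=
      hBα.eq_of_ambEq he hn (((hom.smul a).add (hτ.smul b)).add (hβ.orbifoldD he hη)) hdec
    refine Submodule.mem_span_pair.2 ⟨a, b, ?_⟩
    refine (Submodule.Quotient.eq _).2 ?_
    change a • om + b • τ - α.1 ∈ exactForms (atlasX hS) 2
    refine ⟨-β, ?_⟩
    rw [map_neg, h1]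
    abel
  refine ⟨?_, omegaS, dtds, hom.isInducedBy he (areaForm_eq he.isImmersion.contMDiff hnN),
    hτ.isInducedBy he formDtDs_eq, hind, hspan⟩
  have h1 := finrank_span_eq_card hind
  rw [Matrix.range_cons, Matrix.range_cons, Matrix.range_empty, union_empty, singleton_union,
    hspan, finrank_top] at h1
  exact h1
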